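/- Let $M>0$, $p_1,p_2\in(0,1]$ and $\delta\in(0,1)$. There is a constant $C>0$, depending only on $M,p_1,p_2,\delta$, such that the following holds for all real $a,Q$ with $a^2+Q^2<M^2$. Consider the Kerr--Newman exterior $r>r_+$ in Boyer--Lindquist coordinates $(t,r,\theta,\phi)$, with $$g=-\tfrac{\Delta}{|q|^2}(dt-a\sin^2\theta\,d\phi)^2+\tfrac{|q|^2}{\Delta}dr^2+|q|^2d\theta^2+\tfrac{\sin^2\theta}{|q|^2}(a\,dt-(r^2+a^2)d\phi)^2,$$ $q=r+ia\cos\theta$, $\Delta=(r-r_+)(r-r_-)$, $r_\pm=M\pm\sqrt{M^2-a^2-Q^2}$, and put $\mathcal T=r^3-3Mr^2+(a^2+2Q^2)r+Ma^2$. Horizontal tensors are those annihilated by the principal null directions $e_3,e_4$, i.e. by $\partial_r$ and $(r^2+a^2)\partial_t+a\partial_\phi$; they are identified with tensors on the planes orthogonal to $e_3,e_4$, whose orthonormal frame is $e_1=|q|^{-1}\partial_\theta$, $e_2=(|q|\sin\theta)^{-1}(\partial_\phi+a\sin^2\theta\,\partial_t)$. $\nabla$ is the projection of the Levi-Civita derivative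 to these planes, $T=\partial_t$, ${}^*$ is the Hodge dual on them with $\epsilon_{12}=1$, and $\mathcal D=\nabla+i\,{}^*\nabla$. Let $$V_1=\tfrac{1}{|q|^2}\Big(1-\tfrac{2M}{r}+\tfrac{6Q^2}{r^2}\Big),\qquad V_2=\tfrac{4}{|q|^2}\Big(1-\tfrac{2M}{r}+\tfrac{3Q^2}{2r^2}\Big).$$ Let $u$ be a smooth real function on $(r_+,\infty)$ of the form $u=v\,\mathcal T$ with $v\ge0$ (so $v=u/\mathcal T$ where $\mathcal T\ne0$), let $w_Y=\frac{\Delta}{(r^2+a^2)^2}\partial_ru$, and $$\mathcal V_i=-\tfrac14\partial_r(\Delta\,\partial_rw_Y)-\tfrac12u\,\partial_r\Big(\tfrac{\Delta}{(r^2+a^2)^2}|q|^2V_i\Big),\quad i=1,2.$$ Let $\psi_1=f+i\,{}^*f$ and $\psi_2=h+i\,{}^*h$, where $f$ is a smooth real horizontal one-form and $h$ a smooth real horizontal symmetric traceless two-tensor on the exterior (smooth across the axis), and set $$\mathrm I=\tfrac{u\mathcal T}{(r^2+a^2)^3}\big(|\nabla\psi_1|^2+8Q^2|\nabla\psi_2|^2\big)+\tfrac{8Q^2}{|q|^5(r^2+a^2)^2}\Re\Big[uq^3\Big(\tfrac{\mathcal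 T}{r^2+a^2}+\tfrac{\Delta(r+3ia\cos\theta)}{2|q|^2}\Big)\psi_1\cdot(\mathcal D\cdot\overline{\psi_2})\Big],$$ $$\mathrm{II}=\tfrac1{|q|^2}\big(\mathcal V_1|\psi_1|^2+8Q^2\mathcal V_2|\psi_2|^2\big),$$ $$A_1=(1-\delta)\tfrac{u\mathcal T}{(r^2+a^2)^3}\tfrac1{r^2}-\tfrac{8p_1^2Q^2r^6}{(1-\delta)p_2|q|^{10}(r^2+a^2)}\,v\,\Big(\tfrac{\mathcal T}{r^2+a^2}+\tfrac{\Delta r}{2|q|^2}\Big)^2+\tfrac{\mathcal V_1}{|q|^2},$$ $$A_2=(1-\delta)\tfrac{2(1-p_2)u\mathcal T}{(r^2+a^2)^3}\tfrac1{r^2}-\tfrac{4(1-p_1)^2Q^2r^6}{(1-\delta)|q|^{10}(r^2+a^2)}\,v\,\Big(\tfrac{\mathcal T}{r^2+a^2}+\tfrac{\Delta r}{2|q|^2}\Big)^2+\tfrac{\mathcal V_2}{|q|^2}.$$ Then, for every sphere $S=S(t,r)$ of constant $t$ and $r>r_+$, with its induced area, both sides of the following are integrable and $$\int_S(\mathrm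 I+\mathrm{II})\;\ge\;\int_S\Big[\delta\tfrac{u\mathcal T}{(r^2+a^2)^3}\big(|\nabla\psi_1|^2+8Q^2|\nabla\psi_2|^2\big)+A_1|\psi_1|^2+8Q^2A_2|\psi_2|^2-C|a|\,\mathcal E_1-C|a|\,\mathcal E_2\Big],$$ where $$\mathcal E_1=\tfrac{u\mathcal T}{(r^2+a^2)^3}\sum_{i=1,2}\big(|\nabla\psi_i|^2+r^{-2}|\nabla_T\psi_i|^2+r^{-2}|\psi_i|^2\big),$$ $$\mathcal E_2=|u|\,r^{-6}\big(|\Re[\psi_1\cdot(\mathcal D\cdot\overline{\psi_2})]|+|\Im[\psi_1\cdot(\mathcal D\cdot\overline{\psi_2})]|+r^{-1}|\psi_1|^2+r^{-1}|\psi_2|^2\big).$$ -/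

import Mathlib

open Real Set MeasureTheory
open scoped ContDiff

noncomputable section

namespace KerrNewman

/-! # The Kerr-Newman exterior in Boyer-Lindquist coordinates -/

/-- Coordinate quadruples: Boyer-Lindquist `(t, r, θ, φ)`, or `(t, x, y, z)`; also the tangent
vectors in such coordinates. -/
abbrev Pt := Fin 4 → ℝ

def rPlus (M a Q : ℝ) : ℝ := M + √(M ^ 2 - a ^ 2 - Q ^ 2)

def rMinus (M a Q : ℝ) : ℝ := M - √(M ^ 2 - a ^ 2 - Q ^ 2)

/-- `Δ = (r - r₊)(r - r₋)`. -/
def Delta (M a Q r : ℝ) : ℝ := (r - rPlus M a Q) * (r - rMinus M a Q)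

/-- `q = r + i a cos θ`. -/
def q (a r θ : ℝ) : ℂ := (r : ℂ) + Complex.I * ((a * cos θ : ℝ) : ℂ)

/-- The modulus `|q| = √(r² + a² cos² θ)`. -/
def absq (a r θ : ℝ) : ℝ := √(r ^ 2 + a ^ 2 * cos θ ^ 2)

theorem norm_q (a r θ : ℝ) : ‖q a r θ‖ = absq a r θ := by
  rw [q, absq, mul_comm Complex.I, Complex.norm_add_mul_I, mul_pow]

/-- The trapping polynomial `𝒯 = r³ - 3 M r² + (a² + 2 Q²) r + M a²`. -/
def trap (M a Q r : ℝ) : ℝ := r ^ 3 - 3 * M * r ^ 2 + (a ^ 2 + 2 * Q ^ 2) * r + M * a ^ 2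

/-- The Kerr-Newman metric at the Boyer-Lindquist point `p = (t, r, θ, φ)`, on the tangent vectors
`v`, `w` given by their components along `∂_t, ∂_r, ∂_θ, ∂_φ`. -/
def metric (M a Q : ℝ) (p v w : Pt) : ℝ :=
  -(Delta M a Q (p 1) / absq a (p 1) (p 2) ^ 2)
      * (v 0 - a * sin (p 2) ^ 2 * v 3) * (w 0 - a * sin (p 2) ^ 2 * w 3)
    + absq a (p 1) (p 2) ^ 2 / Delta M a Q (p 1) * v 1 * w 1
    + absq a (p 1) (p 2) ^ 2 * v 2 * w 2
    + sin (p 2) ^ 2 / absq a (p 1) (p 2) ^ 2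
      * (a * v 0 - ((p 1) ^ 2 + a ^ 2) * v 3) * (a * w 0 - ((p 1) ^ 2 + a ^ 2) * w 3)

/-- `g(D_X Y, Z)` for the Levi-Civita connection `D` of the metric, through the Koszul formula. -/
def leviCivita (M a Q : ℝ) (X Y Z : Pt → Pt) (p : Pt) : ℝ :=
  (1 / 2) *
    (fderiv ℝ (fun p' => metric M a Q p' (Y p') (Z p')) p (X p)
      + fderiv ℝ (fun p' => metric M a Q p' (X p') (Z p')) p (Y p)
      - fderiv ℝ (fun p' => metric M a Q p' (X p') (Y p')) p (Z p)
      + metric M a Q p (VectorField.lieBracket ℝ X Y p) (Z p)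
      - metric M a Q p (VectorField.lieBracket ℝ X Z p) (Y p)
      - metric M a Q p (VectorField.lieBracket ℝ Y Z p) (X p))

/-- The stationary Killing field `T = ∂_t`. -/
def vecT : Pt → Pt := fun _ => ![1, 0, 0, 0]

/-- The outgoing principal null vector field
`e₄ = ((r² + a²) ∂_t + a ∂_φ) / Δ + ∂_r`. -/
def e4 (M a Q : ℝ) (p : Pt) : Pt :=
  ![((p 1) ^ 2 + a ^ 2) / Delta M a Q (p 1), 1, 0, a / Delta M a Q (p 1)]

/-- The ingoing principal null vector field
`e₃ = ((r² + a²) ∂_t - Δ ∂_r + a ∂_φ) / |q|²`, so that `g(e₃, e₄) = -2`. -/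
def e3 (M a Q : ℝ) (p : Pt) : Pt :=
  ![((p 1) ^ 2 + a ^ 2) / absq a (p 1) (p 2) ^ 2, -(Delta M a Q (p 1) / absq a (p 1) (p 2) ^ 2), 0,
    a / absq a (p 1) (p 2) ^ 2]

/-- The orthonormal frame of the horizontal planes (the orthogonal complement of `e₃`, `e₄`):
`e₁ = |q|⁻¹ ∂_θ` and `e₂ = (|q| sin θ)⁻¹ (∂_φ + a sin² θ ∂_t)`. -/
def frame (a : ℝ) : Fin 2 → Pt → Pt :=
  ![fun p => ![0, 0, 1 / absq a (p 1) (p 2), 0],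
    fun p => ![a * sin (p 2) / absq a (p 1) (p 2), 0, 0, 1 / (absq a (p 1) (p 2) * sin (p 2))]]

/-! # Horizontal tensors

The exterior is `{(t, x, y, z) : √(x² + y² + z²) > r₊}`, the Boyer-Lindquist coordinates being polar
coordinates there. This chart covers the axis of rotation, and tensor fields are required to be
smooth in it. -/

/-- `(t, r, θ, φ) ↦ (t, r sin θ cos φ, r sin θ sin φ, r cos θ)`. -/
def cart (p : Pt) : Pt :=
  ![p 0, p 1 * sin (p 2) * cos (p 3), p 1 * sin (p 2) * sin (p 3), p 1 * cos (p 2)]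

/-- The exterior region, in the coordinates `(t, x, y, z)`. -/
def exterior (M a Q : ℝ) : Set Pt :=
  {x | rPlus M a Q < √((x 1) ^ 2 + (x 2) ^ 2 + (x 3) ^ 2)}

/-- The Boyer-Lindquist coordinate domain (the exterior without the axis). -/
def blDomain (M a Q : ℝ) : Set Pt := {p | rPlus M a Q < p 1 ∧ 0 < p 2 ∧ p 2 < π}

/-- The volume form of the horizontal planes in the frame `e₁, e₂`. -/
def eps : Fin 2 → Fin 2 → ℂ := ![![0, 1], ![-1, 0]]

/-- Elements of `𝔰₁(ℂ)`: smooth complex one-forms `ψ` on the exterior that are horizontal,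
`ψ(e₃) = ψ(e₄) = 0`, and anti-self-dual, `*ψ = -i ψ` where `(*ψ)_b = ε_{bc} ψ_c`; equivalently,
`ψ = f + i *f` with a real horizontal one-form `f`. -/
structure OneForm (M a Q : ℝ) where
  toFun : Pt → Pt →L[ℝ] ℂ
  smooth : ContDiffOn ℝ ∞ toFun (exterior M a Q)
  horizontal : ∀ p ∈ blDomain M a Q,
    toFun (cart p) (fderiv ℝ cart p (e3 M a Q p)) = 0 ∧
    toFun (cart p) (fderiv ℝ cart p (e4 M a Q p)) = 0
  antiSelfDual : ∀ p ∈ blDomain M a Q, ∀ b,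
    ∑ c, eps b c * toFun (cart p) (fderiv ℝ cart p (frame a c p))
      = -Complex.I * toFun (cart p) (fderiv ℝ cart p (frame a b p))

/-- Elements of `𝔰₂(ℂ)`: smooth complex symmetric two-tensors `ψ` on the exterior that are
horizontal, trace-free and anti-self-dual, `*ψ = -i ψ` where `(*ψ)_{bc} = ε_{bd} ψ_{dc}`;
equivalently, `ψ = u + i *u` with a real symmetric trace-free horizontal two-tensor `u`. -/
structure TwoTensor (M a Q : ℝ) where
  toFun : Pt → Pt →L[ℝ] Pt →L[ℝ] ℂ
  smooth : ContDiffOn ℝ ∞ toFun (exterior M a Q)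
  symmetric : ∀ x ∈ exterior M a Q, ∀ v w, toFun x v w = toFun x w v
  horizontal : ∀ p ∈ blDomain M a Q, ∀ w,
    toFun (cart p) (fderiv ℝ cart p (e3 M a Q p)) w = 0 ∧
    toFun (cart p) (fderiv ℝ cart p (e4 M a Q p)) w = 0
  traceFree : ∀ p ∈ blDomain M a Q,
    ∑ b, toFun (cart p) (fderiv ℝ cart p (frame a b p)) (fderiv ℝ cart p (frame a b p)) = 0
  antiSelfDual : ∀ p ∈ blDomain M a Q, ∀ b c,
    ∑ d, eps b d * toFun (cart p) (fderiv ℝ cart p (frame a d p)) (fderiv ℝ cart p (frame a c p))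
      = -Complex.I *
        toFun (cart p) (fderiv ℝ cart p (frame a b p)) (fderiv ℝ cart p (frame a c p))

/-- The components `ψ_b = ψ(e_b)`, as functions of the Boyer-Lindquist coordinates. -/
def OneForm.comp {M a Q : ℝ} (ψ : OneForm M a Q) (b : Fin 2) (p : Pt) : ℂ :=
  ψ.toFun (cart p) (fderiv ℝ cart p (frame a b p))

/-- The components `ψ_{bc} = ψ(e_b, e_c)`, as functions of the Boyer-Lindquist coordinates. -/
def TwoTensor.comp {M a Q : ℝ} (ψ : TwoTensor M a Q) (b c : Fin 2) (p : Pt) : ℂ :=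
  ψ.toFun (cart p) (fderiv ℝ cart p (frame a b p)) (fderiv ℝ cart p (frame a c p))

/-! # Horizontal covariant derivatives, in components along `e₁, e₂` -/

/-- `(∇_X ψ)_b = X(ψ_b) - g(D_X e_b, e_c) ψ_c`. -/
def nabla₁ (M a Q : ℝ) (X : Pt → Pt) (ψ : Fin 2 → Pt → ℂ) (b : Fin 2) (p : Pt) : ℂ :=
  fderiv ℝ (ψ b) p (X p)
    - ∑ c, (leviCivita M a Q X (frame a b) (frame a c) p : ℂ) * ψ c p

/-- `(∇_X ψ)_{bc} = X(ψ_{bc}) - g(D_X e_b, e_d) ψ_{dc} - g(D_X e_c, e_d) ψ_{bd}`. -/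
def nabla₂ (M a Q : ℝ) (X : Pt → Pt) (ψ : Fin 2 → Fin 2 → Pt → ℂ) (b c : Fin 2) (p : Pt) : ℂ :=
  fderiv ℝ (ψ b c) p (X p)
    - ∑ d, (leviCivita M a Q X (frame a b) (frame a d) p : ℂ) * ψ d c p
    - ∑ d, (leviCivita M a Q X (frame a c) (frame a d) p : ℂ) * ψ b d p

/-- `|ψ|² = ψ · ψ̄` for one-forms. -/
def normSq₁ (ψ : Fin 2 → Pt → ℂ) (p : Pt) : ℝ := ∑ b, ‖ψ b p‖ ^ 2

/-- `|ψ|² = ψ · ψ̄` for two-tensors. -/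
def normSq₂ (ψ : Fin 2 → Fin 2 → Pt → ℂ) (p : Pt) : ℝ := ∑ b, ∑ c, ‖ψ b c p‖ ^ 2

/-- `|∇ψ|²` for one-forms, `∇` being the horizontal gradient. -/
def gradSq₁ (M a Q : ℝ) (ψ : Fin 2 → Pt → ℂ) (p : Pt) : ℝ :=
  ∑ d, normSq₁ (nabla₁ M a Q (frame a d) ψ) p

/-- `|∇ψ|²` for two-tensors, `∇` being the horizontal gradient. -/
def gradSq₂ (M a Q : ℝ) (ψ : Fin 2 → Fin 2 → Pt → ℂ) (p : Pt) : ℝ :=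
  ∑ d, normSq₂ (nabla₂ M a Q (frame a d) ψ) p

/-- `|∇_T ψ|²` for one-forms. -/
def nablaTSq₁ (M a Q : ℝ) (ψ : Fin 2 → Pt → ℂ) (p : Pt) : ℝ :=
  normSq₁ (nabla₁ M a Q vecT ψ) p

/-- `|∇_T ψ|²` for two-tensors. -/
def nablaTSq₂ (M a Q : ℝ) (ψ : Fin 2 → Fin 2 → Pt → ℂ) (p : Pt) : ℝ :=
  normSq₂ (nabla₂ M a Q vecT ψ) p

/-- `(𝒟 · U)_c = (∇_b + i (*∇)_b) U_{bc}`, where `𝒟 = ∇ + i *∇` and `(*∇)_b = ε_{bd} ∇_d`. -/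
def calDdiv (M a Q : ℝ) (U : Fin 2 → Fin 2 → Pt → ℂ) (c : Fin 2) (p : Pt) : ℂ :=
  ∑ b, (nabla₂ M a Q (frame a b) U b c p
    + Complex.I * ∑ d, eps b d * nabla₂ M a Q (frame a d) U b c p)

/-- The scalar `ψ₁ · (𝒟 · ψ̄₂)`. -/
def coupling (M a Q : ℝ) (ψ₁ : Fin 2 → Pt → ℂ) (ψ₂ : Fin 2 → Fin 2 → Pt → ℂ) (p : Pt) : ℂ :=
  ∑ c, ψ₁ c p * calDdiv M a Q (fun b d p' => starRingEnd ℂ (ψ₂ b d p')) c p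

/-! # Integration on spheres -/

/-- The area density, with respect to `dθ dφ`, of the sphere of constant `t` and `r`. -/
def areaDensity (M a Q : ℝ) (p : Pt) : ℝ :=
  √(metric M a Q p (Pi.single 2 1) (Pi.single 2 1) * metric M a Q p (Pi.single 3 1) (Pi.single 3 1)
    - metric M a Q p (Pi.single 2 1) (Pi.single 3 1) ^ 2)

/-- Integrability on the sphere `S(t, r)`. -/
def SphereIntegrable (M a Q t r : ℝ) (F : Pt → ℝ) : Prop :=
  IntegrableOn (fun x : ℝ × ℝ => F ![t, r, x.1, x.2] * areaDensity M a Q ![t, r, x.1, x.2])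
    (Ioo 0 π ×ˢ Ioo 0 (2 * π))

/-- `∫_{S(t, r)} F`. -/
def sphereIntegral (M a Q t r : ℝ) (F : Pt → ℝ) : ℝ :=
  ∫ x in Ioo (0 : ℝ) π ×ˢ Ioo (0 : ℝ) (2 * π),
    F ![t, r, x.1, x.2] * areaDensity M a Q ![t, r, x.1, x.2]

/-- `F ≥_S G` on the sphere `S(t, r)`: the inequality holds upon integration on the sphere (both
integrals being meaningful). -/
def GeS (M a Q t r : ℝ) (F G : Pt → ℝ) : Prop :=
  SphereIntegrable M a Q t r F ∧ SphereIntegrable M a Q t r G ∧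
    sphereIntegral M a Q t r G ≤ sphereIntegral M a Q t r F

/-! # The terms of the Morawetz bulk, for the multiplier function `u` -/

/-- `V₁ = |q|⁻² (1 - 2M/r + 6Q²/r²)`. -/
def V₁ (M a Q r θ : ℝ) : ℝ :=
  1 / absq a r θ ^ 2 * (1 - 2 * M / r + 6 * Q ^ 2 / r ^ 2)

/-- `V₂ = 4 |q|⁻² (1 - 2M/r + 3Q²/(2r²))`. -/
def V₂ (M a Q r θ : ℝ) : ℝ :=
  4 / absq a r θ ^ 2 * (1 - 2 * M / r + 3 * Q ^ 2 / (2 * r ^ 2))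

/-- `w_Y = Δ/(r² + a²)² ∂_r u`. -/
def wY (M a Q : ℝ) (u : ℝ → ℝ) (r : ℝ) : ℝ :=
  Delta M a Q r / (r ^ 2 + a ^ 2) ^ 2 * deriv u r

/-- `𝒱 = -1/4 ∂_r(Δ ∂_r w_Y) - 1/2 u ∂_r(Δ/(r² + a²)² |q|² V)`. -/
def calV (M a Q : ℝ) (u : ℝ → ℝ) (V : ℝ → ℝ → ℝ) (r θ : ℝ) : ℝ :=
  -(1 / 4) * deriv (fun s => Delta M a Q s * deriv (wY M a Q u) s) r
    - 1 / 2 * u r *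
      deriv (fun s => Delta M a Q s / (s ^ 2 + a ^ 2) ^ 2 * absq a s θ ^ 2 * V s θ) r

/-- The term `I`. -/
def termI (M a Q : ℝ) (u : ℝ → ℝ) (ψ₁ : Fin 2 → Pt → ℂ) (ψ₂ : Fin 2 → Fin 2 → Pt → ℂ)
    (p : Pt) : ℝ :=
  let r := p 1
  let θ := p 2
  u r * trap M a Q r / (r ^ 2 + a ^ 2) ^ 3
      * (gradSq₁ M a Q ψ₁ p + 8 * Q ^ 2 * gradSq₂ M a Q ψ₂ p)
    + 8 * Q ^ 2 / (absq a r θ ^ 5 * (r ^ 2 + a ^ 2) ^ 2) *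
      ((u r : ℂ) * q a r θ ^ 3 *
        (((trap M a Q r / (r ^ 2 + a ^ 2) : ℝ) : ℂ)
          + (Delta M a Q r : ℂ) * ((r : ℂ) + 3 * Complex.I * ((a * cos θ : ℝ) : ℂ))
            / ((2 * absq a r θ ^ 2 : ℝ) : ℂ))
        * coupling M a Q ψ₁ ψ₂ p).re

/-- The term `II`. -/
def termII (M a Q : ℝ) (u : ℝ → ℝ) (ψ₁ : Fin 2 → Pt → ℂ) (ψ₂ : Fin 2 → Fin 2 → Pt → ℂ)
    (p : Pt) : ℝ :=
  1 / absq a (p 1) (p 2) ^ 2 *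
    (calV M a Q u (V₁ M a Q) (p 1) (p 2) * normSq₁ ψ₁ p
      + 8 * Q ^ 2 * (calV M a Q u (V₂ M a Q) (p 1) (p 2) * normSq₂ ψ₂ p))

/-- The coefficient `A₁`; the function `v` stands for the quotient `u/𝒯`. -/
def A₁ (M a Q p₁ p₂ δ : ℝ) (u v : ℝ → ℝ) (r θ : ℝ) : ℝ :=
  (1 - δ) * (u r * trap M a Q r / (r ^ 2 + a ^ 2) ^ 3) * (1 / r ^ 2)
    - 8 * p₁ ^ 2 * Q ^ 2 * r ^ 6 / ((1 - δ) * p₂ * absq a r θ ^ 10 * (r ^ 2 + a ^ 2)) * v r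
      * (trap M a Q r / (r ^ 2 + a ^ 2) + Delta M a Q r * r / (2 * absq a r θ ^ 2)) ^ 2
    + 1 / absq a r θ ^ 2 * calV M a Q u (V₁ M a Q) r θ

/-- The coefficient `A₂`; the function `v` stands for the quotient `u/𝒯`. -/
def A₂ (M a Q p₁ p₂ δ : ℝ) (u v : ℝ → ℝ) (r θ : ℝ) : ℝ :=
  (1 - δ) * (2 * (1 - p₂) * u r * trap M a Q r / (r ^ 2 + a ^ 2) ^ 3) * (1 / r ^ 2)
    - 4 * (1 - p₁) ^ 2 * Q ^ 2 * r ^ 6 / ((1 - δ) * absq a r θ ^ 10 * (r ^ 2 + a ^ 2)) * v r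
      * (trap M a Q r / (r ^ 2 + a ^ 2) + Delta M a Q r * r / (2 * absq a r θ ^ 2)) ^ 2
    + 1 / absq a r θ ^ 2 * calV M a Q u (V₂ M a Q) r θ

/-- The density multiplied by `O(a)` in the first error term. -/
def error₁ (M a Q : ℝ) (u : ℝ → ℝ) (ψ₁ : Fin 2 → Pt → ℂ) (ψ₂ : Fin 2 → Fin 2 → Pt → ℂ)
    (p : Pt) : ℝ :=
  let r := p 1
  u r * trap M a Q r / (r ^ 2 + a ^ 2) ^ 3 *
    (gradSq₁ M a Q ψ₁ p + nablaTSq₁ M a Q ψ₁ p / r ^ 2 + normSq₁ ψ₁ p / r ^ 2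
      + gradSq₂ M a Q ψ₂ p + nablaTSq₂ M a Q ψ₂ p / r ^ 2 + normSq₂ ψ₂ p / r ^ 2)

/-- The density multiplied by `O(a)` in the second error term; the quantities without a sign enter
through their absolute values. -/
def error₂ (M a Q : ℝ) (u : ℝ → ℝ) (ψ₁ : Fin 2 → Pt → ℂ) (ψ₂ : Fin 2 → Fin 2 → Pt → ℂ)
    (p : Pt) : ℝ :=
  let r := p 1
  |u r| / r ^ 6 *
    (|(coupling M a Q ψ₁ ψ₂ p).re| + |(coupling M a Q ψ₁ ψ₂ p).im|
      + normSq₁ ψ₁ p / r + normSq₂ ψ₂ p / r)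

end KerrNewman

end

noncomputable section

namespace KerrNewman

/-! ### Coordinate derivatives of the polar map and of the horizontal frame. -/

section

/-! Anti-self-duality leaves each field a single complex component, `f = ψ₁(e₁)` of spin 1 and `s =
ψ₂(e₁, e₁)` of spin 2. The horizontal derivative `∇_X` acts on such a component as `X + i k ω(X)`,
where `k` is the spin and `ω(X) = g(D_X e₁, e₂)`. All the tensorial quantities thus become scalar
ones (`OneForm.nabla_comp`, `TwoTensor.nabla_comp`, `coupling_comp`). On a sphere, write `x = ∂_θ f`
and `X = ∂_φ f / sin θ + i k cot θ f`, and `y`, `Y` for the same derivatives of `s`. Smoothness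
across the axis makes `X` continuous up to the poles, which is what `SpinFunction` records. Since
`e₂` contains a multiple of `∂_t`, it is not tangent to the sphere, and `|q| ∇_{e₂} f` differs from
`X` by a defect of size `|a|`, controlled by `∇_T f` and `f` (`Exterior.norm_frameDefect_le`).

The potential terms are the same on both sides and cancel. What remains is to control the coupling
by the share `1 - δ` of the gradients, with exact zero-order coefficients. Two identities on the
sphere are used.

Commuting `∂_θ` with the azimuthal derivative shows that `2 Im(x X̄) + k |f|²` has integral zero, up
to derivatives of the weight (`SpinFunction.integral_curv`). Since `|x|² + |X|² = |x + iX|² + 2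
Im(x̄ ...)`-type expansions involve exactly this cross term, the gradient controls `|x + iX|²`
together with `k |f|² / r²`: a Poincaré inequality that keeps the square (`Exterior.coercivity`).
Integrating by parts moves the derivative in the coupling from `ψ₂` to `ψ₁`, where it becomes `x +
iX` (`integral_pairingDensity`, `Exterior.coupling_by_parts`). The weights depend on `θ` only
through `a²`, so their derivatives are errors.

The coupling is split in proportions `p₁` and `1 - p₁`. The first part is bounded by Young's
inequality against the share `p₂` of `|∇ψ₂|²`. The second is transposed and bounded against the
square `|x + iX|²` supplied by `∇ψ₁` (`Exterior.coupling_transposed`). The share `1 - p₂` of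
`|∇ψ₂|²` yields the positive `|ψ₂|²` term.

One error is delicate. The transposition leaves `|a| |u| |ψ₁| |∇_T ψ₂|`, and a naive splitting would
produce `|a| v |ψ₁|²` without the factor `𝒯²` present in `ℰ₁`. It is estimated jointly with the part
of proportion `p₁ > 0`: the slack of that Young inequality absorbs it without changing the
coefficient of `|ψ₁|²` (`young_with_slack`, `Exterior.coupling_absorb`). This is the source of the
`p₁⁻²` in the constant. `Exterior.pointwise_estimate` assembles these bounds up to densities of zero
integral, and `geS_morawetz` integrates the result. -/

theorem fderiv_pt {F : Pt → Pt} {p : Pt} {L₀ L₁ L₂ L₃ : Pt →L[ℝ] ℝ}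
    (h₀ : HasFDerivAt (fun x => F x 0) L₀ p) (h₁ : HasFDerivAt (fun x => F x 1) L₁ p)
    (h₂ : HasFDerivAt (fun x => F x 2) L₂ p) (h₃ : HasFDerivAt (fun x => F x 3) L₃ p) :
    DifferentiableAt ℝ F p ∧ ∀ v, fderiv ℝ F p v = ![L₀ v, L₁ v, L₂ v, L₃ v] := by
  have hc : HasFDerivAt F (ContinuousLinearMap.pi ![L₀, L₁, L₂, L₃]) p := by
    refine hasFDerivAt_pi.2 fun i => ?_
    fin_cases i
    exacts [h₀, h₁, h₂, h₃]
  refine ⟨hc.differentiableAt, fun v => ?_⟩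
  rw [hc.fderiv]
  ext i
  fin_cases i <;> rfl

theorem hasFDerivAt_coord (p : Pt) (i : Fin 4) :
    HasFDerivAt (fun p : Pt => p i) (ContinuousLinearMap.proj i : Pt →L[ℝ] ℝ) p :=
  (ContinuousLinearMap.proj i : Pt →L[ℝ] ℝ).hasFDerivAt

theorem hasFDerivAt_inv_comp {g : Pt → ℝ} {p : Pt} {L : Pt →L[ℝ] ℝ} (hg : HasFDerivAt g L p)
    (hne : g p ≠ 0) : HasFDerivAt (fun x => (g x)⁻¹) (-(g p ^ 2)⁻¹ • L) p :=
  (hasDerivAt_inv hne).comp_hasFDerivAt p hg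

theorem fderiv_cart_apply (p v : Pt) : fderiv ℝ cart p v =
    ![v 0,
      v 1 * (sin (p 2) * cos (p 3)) + v 2 * (p 1 * cos (p 2) * cos (p 3))
        - v 3 * (p 1 * sin (p 2) * sin (p 3)),
      v 1 * (sin (p 2) * sin (p 3)) + v 2 * (p 1 * cos (p 2) * sin (p 3))
        + v 3 * (p 1 * sin (p 2) * cos (p 3)),
      v 1 * cos (p 2) - v 2 * (p 1 * sin (p 2))] := by
  have h := hasFDerivAt_coord p
  have h1 := ((h 1).mul (h 2).sin).mul (h 3).cos
  have h2 := ((h 1).mul (h 2).sin).mul (h 3).sin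
  have h3 := (h 1).mul (h 2).cos
  rw [(fderiv_pt (F := cart) (h 0) h1 h2 h3).2 v]
  ext i
  fin_cases i <;> simp <;> ring

theorem contDiff_cart : ContDiff ℝ ∞ cart := by
  rw [contDiff_pi]
  intro i
  fin_cases i <;> simp [cart] <;> fun_prop

section Frame

variable {M a Q : ℝ} {p : Pt}

theorem absq_sq (a r θ : ℝ) : absq a r θ ^ 2 = r ^ 2 + a ^ 2 * cos θ ^ 2 :=
  sq_sqrt (by positivity)

theorem absq_pos {r : ℝ} (hr : 0 < r) (a θ : ℝ) : 0 < absq a r θ :=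
  sqrt_pos.2 (by positivity)

theorem hasFDerivAt_absq (a : ℝ) (hp : 0 < p 1) :
    HasFDerivAt (fun p : Pt => absq a (p 1) (p 2))
      ((1 / absq a (p 1) (p 2)) • ((p 1) • (ContinuousLinearMap.proj 1 : Pt →L[ℝ] ℝ)
        - (a ^ 2 * cos (p 2) * sin (p 2)) • (ContinuousLinearMap.proj 2 : Pt →L[ℝ] ℝ))) p := by
  have h := hasFDerivAt_coord p
  have h1 := (((h 1).pow 2).add (((h 2).cos.pow 2).const_mul (a ^ 2))).sqrt
    (ne_of_gt (by simp only [Pi.add_apply]; positivity))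
  refine h1.congr_fderiv ?_
  ext v
  simp [absq]
  ring

theorem frame_zero (a : ℝ) : frame a 0 = fun p : Pt => ![0, 0, 1 / absq a (p 1) (p 2), 0] := rfl

theorem frame_one (a : ℝ) : frame a 1 = fun p : Pt =>
    ![a * sin (p 2) / absq a (p 1) (p 2), 0, 0, 1 / (absq a (p 1) (p 2) * sin (p 2))] := rfl

/-- The directions needed later are `e₁`, `e₂` and `∂_t`. They have no radial component, so the
`r`-derivative of `|q|` can be dropped. -/
theorem fderiv_frame_zero (a : ℝ) (hp : 0 < p 1) (v : Pt) (hv1 : v 1 = 0) :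
    DifferentiableAt ℝ (frame a 0) p ∧
    fderiv ℝ (frame a 0) p v =
      ![0, 0, a ^ 2 * cos (p 2) * sin (p 2) / absq a (p 1) (p 2) ^ 3 * v 2, 0] := by
  have hN := absq_pos hp a (p 2)
  have h1 := (hasFDerivAt_inv_comp (hasFDerivAt_absq a hp) hN.ne').const_mul 1
  have h0 : HasFDerivAt (fun _ : Pt => (0 : ℝ)) (0 : Pt →L[ℝ] ℝ) p := hasFDerivAt_const _ _
  obtain ⟨hd, hf⟩ := fderiv_pt (F := frame a 0) h0 h0 (h1.congr_of_eventuallyEq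
    (.of_forall fun x => by simp [frame_zero])) h0
  refine ⟨hd, ?_⟩
  rw [hf]
  ext i
  fin_cases i <;> simp [hv1]
  field_simp

theorem fderiv_frame_one (a : ℝ) (hp : 0 < p 1) (hs : sin (p 2) ≠ 0) (v : Pt) (hv1 : v 1 = 0) :
    DifferentiableAt ℝ (frame a 1) p ∧
    fderiv ℝ (frame a 1) p v =
      ![a * cos (p 2) * (p 1 ^ 2 + a ^ 2) / absq a (p 1) (p 2) ^ 3 * v 2, 0, 0,
        -(cos (p 2) * (absq a (p 1) (p 2) ^ 2 - a ^ 2 * sin (p 2) ^ 2)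
          / (absq a (p 1) (p 2) ^ 3 * sin (p 2) ^ 2)) * v 2] := by
  have hN := absq_pos hp a (p 2)
  have h := hasFDerivAt_coord p
  have h0 := ((h 2).sin.const_mul a).mul
    (hasFDerivAt_inv_comp (hasFDerivAt_absq a hp) hN.ne')
  have h3 := (hasFDerivAt_inv_comp ((hasFDerivAt_absq a hp).mul (h 2).sin)
    (mul_ne_zero hN.ne' hs)).const_mul 1
  have hz : HasFDerivAt (fun _ : Pt => (0 : ℝ)) (0 : Pt →L[ℝ] ℝ) p := hasFDerivAt_const _ _
  obtain ⟨hd, hf⟩ := fderiv_pt (F := frame a 1)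
    (h0.congr_of_eventuallyEq (.of_forall fun x => by simp [frame_one, div_eq_mul_inv])) hz hz
    (h3.congr_of_eventuallyEq (.of_forall fun x => by simp [frame_one]))
  refine ⟨hd, ?_⟩
  rw [hf]
  simp only [Pi.mul_apply]
  clear hf h0 h3
  have hq := absq_sq a (p 1) (p 2)
  have hcs := sin_sq_add_cos_sq (p 2)
  generalize absq a (p 1) (p 2) = N at *
  ext i
  fin_cases i <;> simp [hv1]
  · field_simp
    have : p 1 ^ 2 + a ^ 2 = N ^ 2 + a ^ 2 * sin (p 2) ^ 2 := by
      rw [hq]; linear_combination (-a ^ 2) * hcs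
    rw [this]
    ring
  · field_simp
    ring

end Frame

end

/-! ### Orthonormality of the frame, its connection coefficients, and the area density. -/

section

section Frame

variable {M a Q : ℝ} {p : Pt}

theorem metric_comm (M a Q : ℝ) (p v w : Pt) : metric M a Q p v w = metric M a Q p w v := by
  simp only [metric]; ring

theorem absq_sq_add (a r θ : ℝ) : absq a r θ ^ 2 + a ^ 2 * sin θ ^ 2 = r ^ 2 + a ^ 2 := by
  rw [absq_sq]; linear_combination a ^ 2 * sin_sq_add_cos_sq θ

theorem metric_frame_zero (hp : 0 < p 1) (w : Pt) :
    metric M a Q p (frame a 0 p) w = absq a (p 1) (p 2) * w 2 := by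
  have hN := absq_pos hp a (p 2)
  simp only [metric, frame_zero]
  simp
  field_simp
  simp

theorem metric_frame_one (hp : 0 < p 1) (hs : sin (p 2) ≠ 0) (w : Pt) :
    metric M a Q p (frame a 1 p) w
      = -(sin (p 2) / absq a (p 1) (p 2)) * (a * w 0 - (p 1 ^ 2 + a ^ 2) * w 3) := by
  have hN := absq_pos hp a (p 2)
  simp only [metric, frame_one, ← absq_sq_add a (p 1) (p 2)]
  simp
  field_simp
  ring

/-- The vector `e₂` is annihilated by `dt - a sin² θ dφ`, so the part of the metric carrying `Δ` as
a numerator never contributes, and `e₁` and `e₂` have no radial component. -/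
theorem metric_frame (hp : 0 < p 1) (hs : sin (p 2) ≠ 0) (b c : Fin 2) :
    metric M a Q p (frame a b p) (frame a c p) = if b = c then 1 else 0 := by
  have hN := absq_pos hp a (p 2)
  fin_cases b <;> fin_cases c <;> simp [metric_frame_zero hp, metric_frame_one hp hs]
  · simp [frame_zero]
    field_simp
  · simp [frame_one]
  · simp [frame_zero]
  · simp only [frame_one, ← absq_sq_add a (p 1) (p 2)]
    simp
    field_simp
    ring

theorem isOpen_regular : IsOpen {p : Pt | 0 < p 1 ∧ sin (p 2) ≠ 0} :=
  (isOpen_lt continuous_const (continuous_apply 1)).inter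
    (isOpen_ne_fun (continuous_sin.comp (continuous_apply 2)) continuous_const)

/-- The scalar products of the frame are constant on an open set. In the Koszul formula for frame
vectors only the brackets survive. -/
theorem fderiv_metric_frame (hp : 0 < p 1) (hs : sin (p 2) ≠ 0) (b c : Fin 2) (v : Pt) :
    fderiv ℝ (fun p' => metric M a Q p' (frame a b p') (frame a c p')) p v = 0 := by
  have : (fun p' => metric M a Q p' (frame a b p') (frame a c p'))
      =ᶠ[nhds p] fun _ => if b = c then 1 else 0 := by
    filter_upwards [isOpen_regular.mem_nhds ⟨hp, hs⟩] with x hx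
    exact metric_frame hx.1 hx.2 b c
  rw [this.fderiv_eq]
  simp

theorem leviCivita_antisymm (X Y Z : Pt → Pt) :
    leviCivita M a Q X Y Z p + leviCivita M a Q X Z Y p
      = fderiv ℝ (fun p' => metric M a Q p' (Y p') (Z p')) p (X p) := by
  have h : ∀ A B : Pt → Pt, (fun p' => metric M a Q p' (A p') (B p'))
      = fun p' => metric M a Q p' (B p') (A p') := fun A B => by
    ext p'; exact metric_comm ..
  have hl : VectorField.lieBracket ℝ Z Y p = - VectorField.lieBracket ℝ Y Z p := by
    simp [VectorField.lieBracket]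
  have hn : metric M a Q p (-VectorField.lieBracket ℝ Y Z p) (X p)
      = - metric M a Q p (VectorField.lieBracket ℝ Y Z p) (X p) := by
    simp only [metric, Pi.neg_apply]; ring
  rw [leviCivita, leviCivita, h Z Y, hl, hn]
  ring

/-- The connection coefficient `g(D_X e₁, e₂)`. -/
def omega (M a Q : ℝ) (X : Pt → Pt) (p : Pt) : ℝ := leviCivita M a Q X (frame a 0) (frame a 1) p

theorem leviCivita_frame (hp : 0 < p 1) (hs : sin (p 2) ≠ 0) (X : Pt → Pt) (b c : Fin 2) :
    leviCivita M a Q X (frame a b) (frame a c) p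
      = (![![0, omega M a Q X p], ![-omega M a Q X p, 0]] : Fin 2 → Fin 2 → ℝ) b c := by
  have h := fun b c => leviCivita_antisymm (M := M) (a := a) (Q := Q) (p := p) X (frame a b)
    (frame a c)
  simp only [fderiv_metric_frame hp hs] at h
  have h00 := h 0 0
  have h01 := h 0 1
  have h11 := h 1 1
  fin_cases b <;> fin_cases c <;> simp [omega] <;> linarith

theorem lieBracket_frame (hp : 0 < p 1) (hs : sin (p 2) ≠ 0) :
    VectorField.lieBracket ℝ (frame a 0) (frame a 1) p
      = ![a * cos (p 2) * (p 1 ^ 2 + a ^ 2) / absq a (p 1) (p 2) ^ 4, 0, 0,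
        -(cos (p 2) * (absq a (p 1) (p 2) ^ 2 - a ^ 2 * sin (p 2) ^ 2)
          / (absq a (p 1) (p 2) ^ 4 * sin (p 2) ^ 2))] := by
  have hN := absq_pos hp a (p 2)
  rw [VectorField.lieBracket,
    (fderiv_frame_one a hp hs (frame a 0 p) (by simp [frame_zero])).2,
    (fderiv_frame_zero a hp (frame a 1 p) (by simp [frame_one])).2]
  ext i
  fin_cases i <;> simp [frame_zero, frame_one] <;> field_simp

/-- Koszul reduces this to `-g([e₁, e₂], e₁)`. The bracket has only `∂_t` and `∂_φ` components, both
orthogonal to `e₁`. -/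
theorem omega_frame_zero (hp : 0 < p 1) (hs : sin (p 2) ≠ 0) :
    omega M a Q (frame a 0) p = 0 := by
  have h0 : VectorField.lieBracket ℝ (frame a 0) (frame a 0) p = 0 := by
    simp [VectorField.lieBracket]
  simp only [omega, leviCivita, fderiv_metric_frame hp hs, h0]
  rw [metric_comm M a Q p 0, metric_comm M a Q p (VectorField.lieBracket ℝ _ _ p) (frame a 0 p),
    metric_frame_one hp hs, metric_frame_zero hp, lieBracket_frame hp hs]
  simp

theorem omega_frame_one (hp : 0 < p 1) (hs : sin (p 2) ≠ 0) :
    omega M a Q (frame a 1) p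
      = cos (p 2) * (p 1 ^ 2 + a ^ 2) / (absq a (p 1) (p 2) ^ 3 * sin (p 2)) := by
  have hN := absq_pos hp a (p 2)
  have h0 : VectorField.lieBracket ℝ (frame a 1) (frame a 1) p = 0 := by
    simp [VectorField.lieBracket]
  have hl : VectorField.lieBracket ℝ (frame a 1) (frame a 0) p
      = - VectorField.lieBracket ℝ (frame a 0) (frame a 1) p := by
    simp [VectorField.lieBracket]
  simp only [omega, leviCivita, fderiv_metric_frame hp hs, h0, hl]
  rw [metric_comm M a Q p 0, metric_comm M a Q p (-VectorField.lieBracket ℝ _ _ p),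
    metric_comm M a Q p (VectorField.lieBracket ℝ _ _ p) (frame a 1 p),
    metric_frame_one hp hs, metric_frame_zero hp, metric_frame_one hp hs, lieBracket_frame hp hs]
  simp [← absq_sq_add a (p 1) (p 2)]
  field_simp
  ring

/-- As `∂_t` commutes with the frame, Koszul leaves half the exterior derivative of the one-form
`g(∂_t, ·)` on `(e₁, e₂)`. The ingredients are `g(∂_t, e₁) = 0`, `g(∂_t, e₂) = -a sin θ / |q|` and
the bracket of the frame. -/
theorem omega_vecT (hp : 0 < p 1) (hs : sin (p 2) ≠ 0) :
    omega M a Q vecT p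
      = a * cos (p 2) * (Delta M a Q (p 1) - (p 1 ^ 2 + a ^ 2)) / absq a (p 1) (p 2) ^ 4 := by
  have hN := absq_pos hp a (p 2)
  have hT : ∀ x, fderiv ℝ vecT x = 0 := fun x => by
    unfold vecT; simp
  have h0 : VectorField.lieBracket ℝ vecT (frame a 0) p = 0 := by
    rw [VectorField.lieBracket, hT, (fderiv_frame_zero a hp (vecT p) (by simp [vecT])).2]
    ext i; fin_cases i <;> simp [vecT]
  have h1 : VectorField.lieBracket ℝ vecT (frame a 1) p = 0 := by
    rw [VectorField.lieBracket, hT, (fderiv_frame_one a hp hs (vecT p) (by simp [vecT])).2]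
    ext i; fin_cases i <;> simp [vecT]
  have g0 : (fun p' => metric M a Q p' (vecT p') (frame a 0 p')) =ᶠ[nhds p] fun _ => 0 := by
    filter_upwards [isOpen_regular.mem_nhds ⟨hp, hs⟩] with x hx
    rw [metric_comm, metric_frame_zero hx.1]
    simp [vecT]
  have g1 : (fun p' => metric M a Q p' (vecT p') (frame a 1 p'))
      =ᶠ[nhds p] fun p' => -a * (sin (p' 2) * (absq a (p' 1) (p' 2))⁻¹) := by
    filter_upwards [isOpen_regular.mem_nhds ⟨hp, hs⟩] with x hx
    rw [metric_comm, metric_frame_one hx.1 hx.2]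
    simp [vecT]
    ring
  have hd := (((hasFDerivAt_coord p 2).sin).mul
    (hasFDerivAt_inv_comp (hasFDerivAt_absq a hp) hN.ne')).const_mul (-a)
  have hd' := hd.fderiv
  simp only [Pi.mul_apply] at hd'
  simp only [omega, leviCivita, fderiv_metric_frame hp hs, h0, h1, g0.fderiv_eq, g1.fderiv_eq, hd']
  rw [metric_comm M a Q p 0, metric_comm M a Q p 0,
    metric_frame_one hp hs, metric_frame_zero hp, lieBracket_frame hp hs]
  simp [← absq_sq_add a (p 1) (p 2), metric, frame_zero, vecT]
  field_simp
  ring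

theorem areaDensity_eq (hp : 0 < p 1) (hs : 0 ≤ sin (p 2)) :
    areaDensity M a Q p = sin (p 2)
      * √((p 1 ^ 2 + a ^ 2) ^ 2 - a ^ 2 * Delta M a Q (p 1) * sin (p 2) ^ 2) := by
  have hN := absq_pos hp a (p 2)
  rw [areaDensity, ← sqrt_sq hs, ← sqrt_mul (sq_nonneg _)]
  congr 1
  simp [metric, sqrt_sq hs]
  field_simp
  ring

end Frame

end

/-! ### Reduction of anti-self-dual tensors to one spin-weighted component. -/

section

theorem rPlus_ge (M a Q : ℝ) : M ≤ rPlus M a Q := le_add_of_nonneg_right (sqrt_nonneg _)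

theorem cart_mem_exterior {M a Q : ℝ} (hM : 0 < M) {p : Pt} (hp : rPlus M a Q < p 1) :
    cart p ∈ exterior M a Q := by
  have h0 : 0 ≤ p 1 := (hM.le.trans (rPlus_ge M a Q)).trans hp.le
  have : (cart p 1) ^ 2 + (cart p 2) ^ 2 + (cart p 3) ^ 2 = p 1 ^ 2 := by
    simp only [cart]
    simp
    linear_combination (p 1 ^ 2 * sin (p 2) ^ 2) * sin_sq_add_cos_sq (p 3)
      + p 1 ^ 2 * sin_sq_add_cos_sq (p 2)
  rw [exterior, mem_ofPred_eq, this, sqrt_sq h0]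
  exact hp

theorem isOpen_exterior (M a Q : ℝ) : IsOpen (exterior M a Q) := by
  refine isOpen_lt continuous_const (continuous_sqrt.comp ?_)
  fun_prop

theorem isOpen_blDomain (M a Q : ℝ) : IsOpen (blDomain M a Q) :=
  (isOpen_lt continuous_const (continuous_apply 1)).inter
    ((isOpen_lt continuous_const (continuous_apply 2)).inter
      (isOpen_lt (continuous_apply 2) continuous_const))

/-- The image of `e₁` in the coordinates `(t, x, y, z)`, which is smooth across the axis. -/
def polarVec (a : ℝ) (p : Pt) : Pt :=
  ![0, p 1 * cos (p 2) * cos (p 3) / absq a (p 1) (p 2),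
    p 1 * cos (p 2) * sin (p 3) / absq a (p 1) (p 2), -(p 1 * sin (p 2) / absq a (p 1) (p 2))]

/-- The unit azimuthal vector in the coordinates `(t, x, y, z)`. -/
def azimVec (p : Pt) : Pt := ![0, -sin (p 3), cos (p 3), 0]

theorem fderiv_cart_frame_zero (a : ℝ) (p : Pt) :
    fderiv ℝ cart p (frame a 0 p) = polarVec a p := by
  rw [fderiv_cart_apply]
  ext i
  fin_cases i <;> simp [frame_zero, polarVec] <;> ring

theorem fderiv_cart_frame_one (a : ℝ) {p : Pt} (hs : sin (p 2) ≠ 0) :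
    fderiv ℝ cart p (frame a 1 p) = (a * sin (p 2) / absq a (p 1) (p 2)) • vecT p
      + (p 1 / absq a (p 1) (p 2)) • azimVec p := by
  rw [fderiv_cart_apply]
  ext i
  fin_cases i <;> simp [frame_one, azimVec, vecT] <;> field_simp

theorem contDiffAt_absq (a : ℝ) {p : Pt} (hp : 0 < p 1) :
    ContDiffAt ℝ ∞ (fun p : Pt => absq a (p 1) (p 2)) p := by
  unfold absq
  refine ContDiffAt.sqrt ?_ (by positivity)
  fun_prop

theorem contDiffAt_polarVec (a : ℝ) {p : Pt} (hp : 0 < p 1) :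
    ContDiffAt ℝ ∞ (polarVec a) p := by
  have hN := contDiffAt_absq a hp
  have hne := (absq_pos hp a (p 2)).ne'
  rw [contDiffAt_pi]
  intro i
  fin_cases i
  · exact contDiffAt_const
  · exact ContDiffAt.div (by fun_prop) hN hne
  · exact ContDiffAt.div (by fun_prop) hN hne
  · exact (ContDiffAt.div (by fun_prop) hN hne).neg

section Components

variable {M a Q : ℝ}

theorem OneForm.comp_zero_eq (ψ : OneForm M a Q) :
    ψ.comp 0 = fun p => ψ.toFun (cart p) (polarVec a p) := by
  ext p; rw [OneForm.comp, fderiv_cart_frame_zero]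

theorem TwoTensor.comp_zero_eq (ψ : TwoTensor M a Q) :
    ψ.comp 0 0 = fun p => ψ.toFun (cart p) (polarVec a p) (polarVec a p) := by
  ext p; rw [TwoTensor.comp, fderiv_cart_frame_zero]

theorem OneForm.contDiffAt_comp_cart (hM : 0 < M) (ψ : OneForm M a Q) {p : Pt}
    (hp : rPlus M a Q < p 1) : ContDiffAt ℝ ∞ (fun p => ψ.toFun (cart p)) p :=
  ((ψ.smooth _ (cart_mem_exterior hM hp)).contDiffAt
    ((isOpen_exterior M a Q).mem_nhds (cart_mem_exterior hM hp))).comp p contDiff_cart.contDiffAt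

theorem TwoTensor.contDiffAt_comp_cart (hM : 0 < M) (ψ : TwoTensor M a Q) {p : Pt}
    (hp : rPlus M a Q < p 1) : ContDiffAt ℝ ∞ (fun p => ψ.toFun (cart p)) p :=
  ((ψ.smooth _ (cart_mem_exterior hM hp)).contDiffAt
    ((isOpen_exterior M a Q).mem_nhds (cart_mem_exterior hM hp))).comp p contDiff_cart.contDiffAt

theorem OneForm.contDiffAt_comp (hM : 0 < M) (ψ : OneForm M a Q) {p : Pt}
    (hp : rPlus M a Q < p 1) : ContDiffAt ℝ ∞ (ψ.comp 0) p := by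
  have h0 : 0 < p 1 := (hM.trans_le (rPlus_ge M a Q)).trans hp
  rw [ψ.comp_zero_eq]
  exact (ψ.contDiffAt_comp_cart hM hp).clm_apply (contDiffAt_polarVec a h0)

theorem TwoTensor.contDiffAt_comp (hM : 0 < M) (ψ : TwoTensor M a Q) {p : Pt}
    (hp : rPlus M a Q < p 1) : ContDiffAt ℝ ∞ (ψ.comp 0 0) p := by
  have h0 : 0 < p 1 := (hM.trans_le (rPlus_ge M a Q)).trans hp
  rw [ψ.comp_zero_eq]
  exact ((ψ.contDiffAt_comp_cart hM hp).clm_apply (contDiffAt_polarVec a h0)).clm_apply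
    (contDiffAt_polarVec a h0)

theorem OneForm.comp_one {ψ : OneForm M a Q} {p : Pt} (hp : p ∈ blDomain M a Q) :
    ψ.comp 1 p = -Complex.I * ψ.comp 0 p := by
  have := ψ.antiSelfDual p hp 0
  simpa [eps, Fin.sum_univ_two, OneForm.comp] using this

theorem TwoTensor.comp_one_left {ψ : TwoTensor M a Q} {p : Pt} (hp : p ∈ blDomain M a Q)
    (c : Fin 2) : ψ.comp 1 c p = -Complex.I * ψ.comp 0 c p := by
  have := ψ.antiSelfDual p hp 0 c
  simpa [eps, Fin.sum_univ_two, TwoTensor.comp] using this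

theorem TwoTensor.comp_zero_one (hM : 0 < M) {ψ : TwoTensor M a Q} {p : Pt}
    (hp : p ∈ blDomain M a Q) : ψ.comp 0 1 p = -Complex.I * ψ.comp 0 0 p := by
  rw [← comp_one_left hp]
  exact ψ.symmetric _ (cart_mem_exterior hM hp.1) _ _

/-- Anti-self-duality acts on the first index and symmetry transfers it to the second, so the matrix
of components is a multiple of `(1, -i) ⊗ (1, -i)`. -/
theorem TwoTensor.comp_eq (hM : 0 < M) {ψ : TwoTensor M a Q} {p : Pt}
    (hp : p ∈ blDomain M a Q) (b c : Fin 2) : ψ.comp b c p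
      = (![![1, -Complex.I], ![-Complex.I, -1]] : Fin 2 → Fin 2 → ℂ) b c * ψ.comp 0 0 p := by
  have h10 := comp_one_left hp (ψ := ψ) 0
  have h01 := comp_zero_one hM hp (ψ := ψ)
  have h11 := comp_one_left hp (ψ := ψ) 1
  fin_cases b <;> fin_cases c <;> simp [h10, h01, h11]
  rw [← mul_assoc, Complex.I_mul_I]; simp

theorem OneForm.comp_eq {ψ : OneForm M a Q} {p : Pt} (hp : p ∈ blDomain M a Q) (b : Fin 2) :
    ψ.comp b p = (![1, -Complex.I] : Fin 2 → ℂ) b * ψ.comp 0 p := by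
  have h1 := comp_one hp (ψ := ψ)
  fin_cases b <;> simp [h1]

/-- The horizontal derivative `∇_X` acting on the component of spin `k`. -/
def spinNabla (M a Q k : ℝ) (X : Pt → Pt) (f : Pt → ℂ) (p : Pt) : ℂ :=
  fderiv ℝ f p (X p) + k * omega M a Q X p * Complex.I * f p

theorem sin_ne_zero_of_mem {p : Pt} (hp : p ∈ blDomain M a Q) : sin (p 2) ≠ 0 :=
  (sin_pos_of_pos_of_lt_pi hp.2.1 hp.2.2).ne'

theorem fderiv_const_mul_of_eventuallyEq {f g : Pt → ℂ} {p : Pt} (c : ℂ)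
    (h : g =ᶠ[nhds p] fun x => c * f x) (v : Pt) : fderiv ℝ g p v = c * fderiv ℝ f p v := by
  rw [h.fderiv_eq]
  have h2 := congrArg (fun L : Pt → Pt →L[ℝ] ℂ => L p v)
    (fderiv_const_smul_field (𝕜 := ℝ) (f := f) c)
  exact h2

/-- The vector `(1, -i)` is an eigenvector of the antisymmetric connection matrix, so the covariant
derivative preserves anti-self-duality and the connection acts as multiplication by `i ω`. -/
theorem OneForm.nabla_comp (hM : 0 < M) (ψ : OneForm M a Q) {p : Pt} (hp : p ∈ blDomain M a Q)
    (X : Pt → Pt) (b : Fin 2) : nabla₁ M a Q X ψ.comp b p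
      = (![1, -Complex.I] : Fin 2 → ℂ) b * spinNabla M a Q 1 X (ψ.comp 0) p := by
  have h0 : 0 < p 1 := (hM.trans_le (rPlus_ge M a Q)).trans hp.1
  have hd : fderiv ℝ (ψ.comp b) p (X p)
      = (![1, -Complex.I] : Fin 2 → ℂ) b * fderiv ℝ (ψ.comp 0) p (X p) :=
    fderiv_const_mul_of_eventuallyEq _ (by
      filter_upwards [(isOpen_blDomain M a Q).mem_nhds hp] with x hx using comp_eq hx b) _
  rw [nabla₁, hd]
  simp only [leviCivita_frame h0 (sin_ne_zero_of_mem hp), Fin.sum_univ_two, comp_one hp, spinNabla]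
  fin_cases b
  · simp; ring
  · simp; ring_nf; simp

/-- The sign `j` treats `ψ₂` (`j = 1`) and its conjugate (`j = -1`) together. Conjugation reverses
the eigenvector, and with it the spin. -/
theorem nabla₂_comp (hM : 0 < M) {U : Fin 2 → Fin 2 → Pt → ℂ} {p : Pt} (hp : p ∈ blDomain M a Q)
    (j : ℝ) (hj : j ^ 2 = 1)
    (hU : ∀ x ∈ blDomain M a Q, ∀ b c, U b c x = (![![1, -j * Complex.I],
      ![-j * Complex.I, -1]] : Fin 2 → Fin 2 → ℂ) b c * U 0 0 x)
    (X : Pt → Pt) (b c : Fin 2) : nabla₂ M a Q X U b c p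
      = (![![1, -j * Complex.I], ![-j * Complex.I, -1]] : Fin 2 → Fin 2 → ℂ) b c
        * spinNabla M a Q (2 * j) X (U 0 0) p := by
  have h0 : 0 < p 1 := (hM.trans_le (rPlus_ge M a Q)).trans hp.1
  have hd : fderiv ℝ (U b c) p (X p) = (![![1, -j * Complex.I],
      ![-j * Complex.I, -1]] : Fin 2 → Fin 2 → ℂ) b c * fderiv ℝ (U 0 0) p (X p) :=
    fderiv_const_mul_of_eventuallyEq _ (by
      filter_upwards [(isOpen_blDomain M a Q).mem_nhds hp] with x hx using hU x hx b c) _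
  have hj' : (j : ℂ) ^ 2 = 1 := by exact_mod_cast hj
  rw [nabla₂, hd]
  simp only [leviCivita_frame h0 (sin_ne_zero_of_mem hp), Fin.sum_univ_two, spinNabla]
  have h01 := hU p hp 0 1
  have h10 := hU p hp 1 0
  have h11 := hU p hp 1 1
  fin_cases b <;> fin_cases c <;> simp [h01, h10, h11] <;> ring_nf <;> simp [hj']

theorem TwoTensor.nabla_comp (hM : 0 < M) (ψ : TwoTensor M a Q) {p : Pt}
    (hp : p ∈ blDomain M a Q) (X : Pt → Pt) (b c : Fin 2) : nabla₂ M a Q X ψ.comp b c p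
      = (![![1, -Complex.I], ![-Complex.I, -1]] : Fin 2 → Fin 2 → ℂ) b c
        * spinNabla M a Q 2 X (ψ.comp 0 0) p := by
  have := nabla₂_comp hM hp 1 (by norm_num) (U := ψ.comp) (fun x hx b c => by
    simpa using comp_eq hM hx b c) X b c
  simpa using this

theorem spinNabla_conj (k : ℝ) (X : Pt → Pt) (f : Pt → ℂ) (p : Pt) :
    spinNabla M a Q (-k) X (fun x => starRingEnd ℂ (f x)) p
      = starRingEnd ℂ (spinNabla M a Q k X f p) := by
  have h : fderiv ℝ (fun x => starRingEnd ℂ (f x)) p (X p)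
      = starRingEnd ℂ (fderiv ℝ f p (X p)) := by
    have := fderiv_star (𝕜 := ℝ) (f := f) (x := p)
    have h2 := congrArg (fun L : Pt →L[ℝ] ℂ => L (X p)) this
    simpa using h2
  simp [spinNabla, h]

theorem TwoTensor.nabla_conj_comp (hM : 0 < M) (ψ : TwoTensor M a Q) {p : Pt}
    (hp : p ∈ blDomain M a Q) (X : Pt → Pt) (b c : Fin 2) :
    nabla₂ M a Q X (fun b d p' => starRingEnd ℂ (ψ.comp b d p')) b c p
      = (![![1, Complex.I], ![Complex.I, -1]] : Fin 2 → Fin 2 → ℂ) b c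
        * starRingEnd ℂ (spinNabla M a Q 2 X (ψ.comp 0 0) p) := by
  have := nabla₂_comp hM hp (-1) (by norm_num)
    (U := fun b d p' => starRingEnd ℂ (ψ.comp b d p')) (fun x hx b c => by
      have h := comp_eq hM hx (ψ := ψ) b c
      rw [h, map_mul]
      fin_cases b <;> fin_cases c <;> simp) X b c
  rw [this, ← spinNabla_conj]
  simp

theorem OneForm.normSq_comp (ψ : OneForm M a Q) {p : Pt} (hp : p ∈ blDomain M a Q) :
    normSq₁ ψ.comp p = 2 * ‖ψ.comp 0 p‖ ^ 2 := by
  rw [normSq₁, Fin.sum_univ_two, comp_one hp]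
  simp; ring

theorem TwoTensor.normSq_comp (hM : 0 < M) (ψ : TwoTensor M a Q) {p : Pt}
    (hp : p ∈ blDomain M a Q) : normSq₂ ψ.comp p = 4 * ‖ψ.comp 0 0 p‖ ^ 2 := by
  simp only [normSq₂, Fin.sum_univ_two, comp_eq hM hp (ψ := ψ) 0 1, comp_eq hM hp (ψ := ψ) 1]
  simp; ring

theorem OneForm.normSq_nabla (hM : 0 < M) (ψ : OneForm M a Q) {p : Pt} (hp : p ∈ blDomain M a Q)
    (X : Pt → Pt) : normSq₁ (nabla₁ M a Q X ψ.comp) p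
      = 2 * ‖spinNabla M a Q 1 X (ψ.comp 0) p‖ ^ 2 := by
  simp only [normSq₁, Fin.sum_univ_two, ψ.nabla_comp hM hp]
  simp; ring

theorem TwoTensor.normSq_nabla (hM : 0 < M) (ψ : TwoTensor M a Q) {p : Pt}
    (hp : p ∈ blDomain M a Q) (X : Pt → Pt) : normSq₂ (nabla₂ M a Q X ψ.comp) p
      = 4 * ‖spinNabla M a Q 2 X (ψ.comp 0 0) p‖ ^ 2 := by
  simp only [normSq₂, Fin.sum_univ_two, ψ.nabla_comp hM hp]
  simp; ring

/-- The factor 4 is `2 · 2`: the `∇` and `i *∇` parts of `𝒟` give equal contributions on a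
conjugated anti-self-dual tensor, and so do the two values of the contracted index. -/
theorem coupling_comp (hM : 0 < M) (ψ₁ : OneForm M a Q) (ψ₂ : TwoTensor M a Q) {p : Pt}
    (hp : p ∈ blDomain M a Q) : coupling M a Q ψ₁.comp ψ₂.comp p
      = 4 * ψ₁.comp 0 p * (starRingEnd ℂ (spinNabla M a Q 2 (frame a 0) (ψ₂.comp 0 0) p)
        + Complex.I * starRingEnd ℂ (spinNabla M a Q 2 (frame a 1) (ψ₂.comp 0 0) p)) := by
  simp only [coupling, calDdiv, Fin.sum_univ_two, ψ₂.nabla_conj_comp hM hp, OneForm.comp_one hp]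
  simp [eps]
  ring_nf
  simp
  ring

end Components

end

/-! ### Spin-weighted functions on the sphere and their regularity at the poles. -/

section

/-- The point of the sphere `S(t, r)` with the angular coordinates `x = (θ, φ)`. -/
def sph (t r : ℝ) (x : ℝ × ℝ) : Pt := ![t, r, x.1, x.2]

theorem contDiff_sph (t r : ℝ) : ContDiff ℝ ∞ (sph t r) := by
  rw [contDiff_pi]
  intro i
  fin_cases i <;> simp [sph] <;> fun_prop

theorem fderiv_sph (t r : ℝ) (x v : ℝ × ℝ) : fderiv ℝ (sph t r) x v = ![0, 0, v.1, v.2] := by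
  have hc : HasFDerivAt (sph t r) (ContinuousLinearMap.pi
      (![0, 0, ContinuousLinearMap.fst ℝ ℝ ℝ, ContinuousLinearMap.snd ℝ ℝ ℝ] :
        Fin 4 → ℝ × ℝ →L[ℝ] ℝ)) x := by
    refine hasFDerivAt_pi.2 fun i => ?_
    fin_cases i
    exacts [hasFDerivAt_const _ _, hasFDerivAt_const _ _, hasFDerivAt_fst, hasFDerivAt_snd]
  rw [hc.fderiv]
  ext i
  fin_cases i <;> rfl

/-- A function of spin `k` on the sphere, in the frame of the coordinates `(θ, φ)`: the
derivative `∂_φ f / sin θ + i k cot θ f` extends continuously to the poles. -/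
structure SpinFunction (k : ℝ) where
  f : ℝ × ℝ → ℂ
  azim : ℝ × ℝ → ℂ
  smooth : ContDiff ℝ ∞ f
  continuous_azim : Continuous azim
  periodic : ∀ θ, f (θ, 2 * π) = f (θ, 0)
  regular : ∀ x : ℝ × ℝ, x.1 ∈ Icc 0 π →
    sin x.1 * azim x = fderiv ℝ f x (0, 1) + k * cos x.1 * Complex.I * f x

/-- Both sides are continuous in `θ`, so the identity passes from the open interval to the poles,
where the frame `e₁, e₂` degenerates. -/
theorem spinFunction_regular_of_Ioo {k : ℝ} {f azim : ℝ × ℝ → ℂ} (hf : ContDiff ℝ ∞ f)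
    (ha : Continuous azim)
    (h : ∀ x : ℝ × ℝ, x.1 ∈ Ioo 0 π →
      sin x.1 * azim x = fderiv ℝ f x (0, 1) + k * cos x.1 * Complex.I * f x)
    (x : ℝ × ℝ) (hx : x.1 ∈ Icc 0 π) :
    sin x.1 * azim x = fderiv ℝ f x (0, 1) + k * cos x.1 * Complex.I * f x := by
  have hf' : Continuous fun y => fderiv ℝ f y (0, 1) :=
    (hf.continuous_fderiv (by simp)).clm_apply continuous_const
  have hc := hf.continuous
  have h1 : Continuous fun θ : ℝ => ((sin θ : ℝ) : ℂ) * azim (θ, x.2) := by fun_prop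
  have h2 : Continuous fun θ : ℝ => fderiv ℝ f (θ, x.2) (0, 1)
      + k * (cos θ : ℝ) * Complex.I * f (θ, x.2) := by
    have : Continuous fun θ : ℝ => fderiv ℝ f (θ, x.2) (0, 1) := hf'.comp (by fun_prop)
    fun_prop
  have he : EqOn (fun θ : ℝ => ((sin θ : ℝ) : ℂ) * azim (θ, x.2))
      (fun θ : ℝ => fderiv ℝ f (θ, x.2) (0, 1) + k * (cos θ : ℝ) * Complex.I * f (θ, x.2))
      (Ioo 0 π) := fun θ hθ => h (θ, x.2) hθ
  have := he.closure h1 h2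
  rw [closure_Ioo pi_pos.ne] at this
  exact this hx

section

variable {M a Q : ℝ}

/-- The unit coordinate vector `∂_φ`. -/
def vecPhi : Pt := ![0, 0, 0, 1]

theorem fderiv_cart_vecPhi (p : Pt) : fderiv ℝ cart p vecPhi = (p 1 * sin (p 2)) • azimVec p := by
  rw [fderiv_cart_apply]
  ext i
  fin_cases i <;> simp [vecPhi, azimVec]

theorem fderiv_polarVec_vecPhi (a : ℝ) {p : Pt} (hp : 0 < p 1) :
    fderiv ℝ (polarVec a) p vecPhi = (p 1 * cos (p 2) / absq a (p 1) (p 2)) • azimVec p := by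
  have hN := absq_pos hp a (p 2)
  have hI := hasFDerivAt_inv_comp (hasFDerivAt_absq a hp) hN.ne'
  have h := hasFDerivAt_coord p
  have hz : HasFDerivAt (fun _ : Pt => (0 : ℝ)) (0 : Pt →L[ℝ] ℝ) p := hasFDerivAt_const _ _
  have h1 := (((h 1).mul (h 2).cos).mul (h 3).cos).mul hI
  have h2 := (((h 1).mul (h 2).cos).mul (h 3).sin).mul hI
  have h3 := (((h 1).mul (h 2).sin).mul hI).neg
  rw [(fderiv_pt (F := polarVec a) hz h1 h2 h3).2]
  ext i
  fin_cases i <;> simp [vecPhi, azimVec] <;> ring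

/-- Rotation about the axis moves the base point by `r sin θ` and turns the image of `e₁` by an
amount proportional to `cos θ`, both along the azimuthal vector. The first contribution is divisible
by `sin θ`; the second produces the spin term. -/
theorem OneForm.fderiv_comp_vecPhi (hM : 0 < M) (ψ : OneForm M a Q) {p : Pt}
    (hp : rPlus M a Q < p 1) : fderiv ℝ (ψ.comp 0) p vecPhi
      = sin (p 2) * (p 1 * fderiv ℝ ψ.toFun (cart p) (azimVec p) (polarVec a p))
        + cos (p 2) * ((p 1 / absq a (p 1) (p 2) : ℝ) * ψ.toFun (cart p) (azimVec p)) := by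
  have h0 : 0 < p 1 := (hM.trans_le (rPlus_ge M a Q)).trans hp
  have hd1 : HasFDerivAt ψ.toFun (fderiv ℝ ψ.toFun (cart p)) (cart p) :=
    (((ψ.smooth _ (cart_mem_exterior hM hp)).contDiffAt ((isOpen_exterior M a Q).mem_nhds
      (cart_mem_exterior hM hp))).differentiableAt (by simp)).hasFDerivAt
  have hd2 := hd1.comp p (contDiff_cart.differentiable (by simp) p).hasFDerivAt
  have hd3 := ((contDiffAt_polarVec a h0).differentiableAt (by simp)).hasFDerivAt
  have hd := hd2.clm_apply hd3
  rw [ψ.comp_zero_eq]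
  have he := congrArg (fun L : Pt →L[ℝ] ℂ => L vecPhi) hd.fderiv
  refine he.trans ?_
  simp [fderiv_cart_vecPhi, fderiv_polarVec_vecPhi a h0]
  ring

theorem TwoTensor.fderiv_comp_vecPhi (hM : 0 < M) (ψ : TwoTensor M a Q) {p : Pt}
    (hp : rPlus M a Q < p 1) : fderiv ℝ (ψ.comp 0 0) p vecPhi
      = sin (p 2) * (p 1 * fderiv ℝ ψ.toFun (cart p) (azimVec p) (polarVec a p) (polarVec a p))
        + 2 * cos (p 2) * ((p 1 / absq a (p 1) (p 2) : ℝ)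
          * ψ.toFun (cart p) (azimVec p) (polarVec a p)) := by
  have h0 : 0 < p 1 := (hM.trans_le (rPlus_ge M a Q)).trans hp
  have hd1 : HasFDerivAt ψ.toFun (fderiv ℝ ψ.toFun (cart p)) (cart p) :=
    (((ψ.smooth _ (cart_mem_exterior hM hp)).contDiffAt ((isOpen_exterior M a Q).mem_nhds
      (cart_mem_exterior hM hp))).differentiableAt (by simp)).hasFDerivAt
  have hd2 := HasFDerivAt.comp (g := ψ.toFun) (f := cart) p hd1 (contDiff_cart.differentiable
      (by simp) p).hasFDerivAt
  have hd3 := ((contDiffAt_polarVec a h0).differentiableAt (by simp)).hasFDerivAt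
  have hd := (hd2.clm_apply hd3).clm_apply hd3
  rw [ψ.comp_zero_eq]
  have he := congrArg (fun L : Pt →L[ℝ] ℂ => L vecPhi) hd.fderiv
  refine he.trans ?_
  simp [fderiv_cart_vecPhi, fderiv_polarVec_vecPhi a h0,
    ψ.symmetric _ (cart_mem_exterior hM hp) (polarVec a p) (azimVec p)]
  ring

/-- The image of `e₂` is a combination of `∂_t` and the azimuthal vector, and anti-self-duality
gives `ψ(e₂) = -i ψ(e₁)`. The `∂_t` correction carries a factor `sin θ`, so after this substitution
only `-i k cos θ f` fails to be divisible by `sin θ`. -/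
theorem OneForm.apply_azimVec {ψ : OneForm M a Q} {p : Pt} (hp : p ∈ blDomain M a Q) :
    ((p 1 / absq a (p 1) (p 2) : ℝ) : ℂ) * ψ.toFun (cart p) (azimVec p)
      = -Complex.I * ψ.comp 0 p
        - (a * sin (p 2) / absq a (p 1) (p 2) : ℝ) * ψ.toFun (cart p) (vecT p) := by
  have h := comp_one hp (ψ := ψ)
  rw [OneForm.comp, fderiv_cart_frame_one a (sin_ne_zero_of_mem hp), map_add, map_smul, map_smul,
    Complex.real_smul, Complex.real_smul] at h
  rw [← h]; ring

theorem TwoTensor.apply_azimVec {ψ : TwoTensor M a Q} {p : Pt} (hp : p ∈ blDomain M a Q) :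
    ((p 1 / absq a (p 1) (p 2) : ℝ) : ℂ) * ψ.toFun (cart p) (azimVec p) (polarVec a p)
      = -Complex.I * ψ.comp 0 0 p
        - (a * sin (p 2) / absq a (p 1) (p 2) : ℝ) * ψ.toFun (cart p) (vecT p) (polarVec a p) := by
  have h := comp_one_left hp (ψ := ψ) 0
  rw [TwoTensor.comp, fderiv_cart_frame_one a (sin_ne_zero_of_mem hp), fderiv_cart_frame_zero,
    map_add, map_smul, map_smul, _root_.add_apply, _root_.smul_apply, _root_.smul_apply,
    Complex.real_smul, Complex.real_smul] at h
  rw [← h]; ring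

theorem sph_mem {t r : ℝ} (hr : rPlus M a Q < r) {x : ℝ × ℝ} (hx : x.1 ∈ Ioo 0 π) :
    sph t r x ∈ blDomain M a Q := ⟨hr, hx.1, hx.2⟩

theorem fderiv_comp_sph {g : Pt → ℂ} {t r : ℝ} {x : ℝ × ℝ} (hg : DifferentiableAt ℝ g (sph t r x))
    (v : ℝ × ℝ) : fderiv ℝ (fun x => g (sph t r x)) x v
      = fderiv ℝ g (sph t r x) ![0, 0, v.1, v.2] := by
  have := fderiv_comp x hg ((contDiff_sph t r).differentiable (by simp) x)
  rw [← fderiv_sph t r x v]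
  exact congrArg (fun L : ℝ × ℝ →L[ℝ] ℂ => L v) this

theorem continuous_azimVec : Continuous azimVec := by
  refine continuous_pi fun i => ?_
  fin_cases i <;> simp [azimVec] <;> fun_prop

theorem cart_periodic (t r θ : ℝ) : cart (sph t r (θ, 2 * π)) = cart (sph t r (θ, 0)) := by
  ext i; fin_cases i <;> simp [cart, sph]

theorem polarVec_periodic (t r θ : ℝ) :
    polarVec a (sph t r (θ, 2 * π)) = polarVec a (sph t r (θ, 0)) := by
  ext i; fin_cases i <;> simp [polarVec, sph]

theorem continuous_polarVec_sph {r : ℝ} (hr : 0 < r) (t : ℝ) :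
    Continuous fun x => polarVec a (sph t r x) :=
  continuous_iff_continuousAt.2 fun x =>
    ContinuousAt.comp (g := polarVec a) (contDiffAt_polarVec a (p := sph t r x) hr).continuousAt
      (contDiff_sph t r).continuous.continuousAt

theorem continuous_absq (a r : ℝ) : Continuous fun x : ℝ × ℝ => absq a r x.1 := by
  unfold absq; fun_prop

theorem continuous_comp_cart_sph (hM : 0 < M) {E : Type*} [NormedAddCommGroup E] {g : Pt → E}
    (hg : ContinuousOn g (exterior M a Q)) {r : ℝ} (hr : rPlus M a Q < r) (t : ℝ) :
    Continuous fun x => g (cart (sph t r x)) :=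
  hg.comp_continuous (contDiff_cart.continuous.comp (contDiff_sph t r).continuous)
    fun x => cart_mem_exterior hM (p := sph t r x) hr

theorem continuous_cos_div_absq {r : ℝ} (hr : 0 < r) :
    Continuous fun x : ℝ × ℝ => a * cos x.1 / absq a r x.1 :=
  Continuous.div (by fun_prop) (continuous_absq a r) fun x => (absq_pos hr a x.1).ne'

theorem OneForm.contDiff_sph (hM : 0 < M) (ψ : OneForm M a Q) (t : ℝ) {r : ℝ}
    (hr : rPlus M a Q < r) : ContDiff ℝ ∞ fun x => ψ.comp 0 (sph t r x) :=
  contDiff_iff_contDiffAt.2 fun x =>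
    (ψ.contDiffAt_comp hM (p := sph t r x) hr).comp x (KerrNewman.contDiff_sph t r).contDiffAt

theorem TwoTensor.contDiff_sph (hM : 0 < M) (ψ : TwoTensor M a Q) (t : ℝ) {r : ℝ}
    (hr : rPlus M a Q < r) : ContDiff ℝ ∞ fun x => ψ.comp 0 0 (sph t r x) :=
  contDiff_iff_contDiffAt.2 fun x =>
    (ψ.contDiffAt_comp hM (p := sph t r x) hr).comp x (KerrNewman.contDiff_sph t r).contDiffAt

/-- The regular azimuthal derivative of the component of a one-form. -/
def OneForm.azim (ψ : OneForm M a Q) (t r : ℝ) (x : ℝ × ℝ) : ℂ :=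
  r * fderiv ℝ ψ.toFun (cart (sph t r x)) (azimVec (sph t r x)) (polarVec a (sph t r x))
    - (a * cos x.1 / absq a r x.1 : ℝ) * ψ.toFun (cart (sph t r x)) (vecT 0)

/-- The regular azimuthal derivative of the component of a two-tensor. -/
def TwoTensor.azim (ψ : TwoTensor M a Q) (t r : ℝ) (x : ℝ × ℝ) : ℂ :=
  r * fderiv ℝ ψ.toFun (cart (sph t r x)) (azimVec (sph t r x)) (polarVec a (sph t r x))
      (polarVec a (sph t r x))
    - 2 * (a * cos x.1 / absq a r x.1 : ℝ) * ψ.toFun (cart (sph t r x)) (vecT 0)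
      (polarVec a (sph t r x))

theorem OneForm.continuous_azim (hM : 0 < M) (ψ : OneForm M a Q) (t : ℝ) {r : ℝ}
    (hr : rPlus M a Q < r) : Continuous (ψ.azim t r) := by
  have h0 : 0 < r := (hM.trans_le (rPlus_ge M a Q)).trans hr
  have h1 := continuous_comp_cart_sph hM
    (ψ.smooth.continuousOn_fderiv_of_isOpen (isOpen_exterior M a Q) (by simp)) hr t
  have h2 := continuous_comp_cart_sph hM ψ.smooth.continuousOn hr t
  have h3 := continuous_polarVec_sph h0 t (a := a)
  have h4 := continuous_azimVec.comp (KerrNewman.contDiff_sph t r).continuous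
  exact (continuous_const.mul ((h1.clm_apply h4).clm_apply h3)).sub
    ((Complex.continuous_ofReal.comp (continuous_cos_div_absq h0)).mul
      (h2.clm_apply continuous_const))

theorem TwoTensor.continuous_azim (hM : 0 < M) (ψ : TwoTensor M a Q) (t : ℝ) {r : ℝ}
    (hr : rPlus M a Q < r) : Continuous (ψ.azim t r) := by
  have h0 : 0 < r := (hM.trans_le (rPlus_ge M a Q)).trans hr
  have h1 := continuous_comp_cart_sph hM
    (ψ.smooth.continuousOn_fderiv_of_isOpen (isOpen_exterior M a Q) (by simp)) hr t
  have h2 := continuous_comp_cart_sph hM ψ.smooth.continuousOn hr t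
  have h3 := continuous_polarVec_sph h0 t (a := a)
  have h4 := continuous_azimVec.comp (KerrNewman.contDiff_sph t r).continuous
  exact (continuous_const.mul (((h1.clm_apply h4).clm_apply h3).clm_apply h3)).sub
    ((continuous_const.mul (Complex.continuous_ofReal.comp (continuous_cos_div_absq h0))).mul
      ((h2.clm_apply continuous_const).clm_apply h3))

/-- The component of a one-form on the sphere `S(t, r)`. -/
def OneForm.spin (hM : 0 < M) (ψ : OneForm M a Q) (t : ℝ) {r : ℝ} (hr : rPlus M a Q < r) :
    SpinFunction 1 where
  f x := ψ.comp 0 (sph t r x)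
  azim := ψ.azim t r
  smooth := ψ.contDiff_sph hM t hr
  continuous_azim := ψ.continuous_azim hM t hr
  periodic θ := by
    simp only [ψ.comp_zero_eq, cart_periodic, polarVec_periodic]
  regular := by
    refine spinFunction_regular_of_Ioo (ψ.contDiff_sph hM t hr) (ψ.continuous_azim hM t hr)
      fun x hx => ?_
    have hp := sph_mem (t := t) hr hx
    have e1 := ψ.fderiv_comp_vecPhi hM hp.1
    rw [ψ.apply_azimVec hp] at e1
    rw [fderiv_comp_sph ((ψ.contDiffAt_comp hM hp.1).differentiableAt (by simp))]
    refine Eq.trans ?_ (congrArg (· + _) e1.symm)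
    simp [sph, vecT, OneForm.azim]
    ring

/-- The component of a two-tensor on the sphere `S(t, r)`. -/
def TwoTensor.spin (hM : 0 < M) (ψ : TwoTensor M a Q) (t : ℝ) {r : ℝ} (hr : rPlus M a Q < r) :
    SpinFunction 2 where
  f x := ψ.comp 0 0 (sph t r x)
  azim := ψ.azim t r
  smooth := ψ.contDiff_sph hM t hr
  continuous_azim := ψ.continuous_azim hM t hr
  periodic θ := by
    simp only [ψ.comp_zero_eq, cart_periodic, polarVec_periodic]
  regular := by
    refine spinFunction_regular_of_Ioo (ψ.contDiff_sph hM t hr) (ψ.continuous_azim hM t hr)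
      fun x hx => ?_
    have hp := sph_mem (t := t) hr hx
    have e1 := ψ.fderiv_comp_vecPhi hM hp.1
    rw [ψ.apply_azimVec hp] at e1
    rw [fderiv_comp_sph ((ψ.contDiffAt_comp hM hp.1).differentiableAt (by simp))]
    refine Eq.trans ?_ (congrArg (· + _) e1.symm)
    simp [sph, vecT, TwoTensor.azim]
    ring

theorem frame_zero_eq_smul (a : ℝ) (p : Pt) :
    frame a 0 p = (1 / absq a (p 1) (p 2)) • (![0, 0, 1, 0] : Pt) := by
  ext i; fin_cases i <;> simp [frame_zero]

theorem frame_one_eq_smul (a : ℝ) {p : Pt} (hs : sin (p 2) ≠ 0) :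
    frame a 1 p = (1 / absq a (p 1) (p 2)) • ((a * sin (p 2)) • (vecT p)
      + (1 / sin (p 2)) • vecPhi) := by
  ext i; fin_cases i <;> simp [frame_one, vecT, vecPhi] <;> field_simp

/-- The horizontal derivatives of a component along `e₁`, `e₂` and `∂_t`, in terms of quantities
that are continuous on the whole sphere. -/
theorem spinNabla_sph (hM : 0 < M) {k : ℝ} {g : Pt → ℂ} {t r : ℝ} (hr : rPlus M a Q < r)
    (F : SpinFunction k) (hF : F.f = fun x => g (sph t r x)) {x : ℝ × ℝ} (hx : x.1 ∈ Ioo 0 π)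
    (hg : DifferentiableAt ℝ g (sph t r x)) :
    spinNabla M a Q k (frame a 0) g (sph t r x) = fderiv ℝ F.f x (1, 0) / absq a r x.1 ∧
    spinNabla M a Q k (frame a 1) g (sph t r x) = (F.azim x + (a * sin x.1 : ℝ)
      * fderiv ℝ g (sph t r x) (vecT 0) + k * (a ^ 2 * sin x.1 * cos x.1 / absq a r x.1 ^ 2 : ℝ)
        * Complex.I * F.f x) / absq a r x.1 ∧
    spinNabla M a Q k vecT g (sph t r x) = fderiv ℝ g (sph t r x) (vecT 0)
      + k * (a * cos x.1 * (Delta M a Q r - (r ^ 2 + a ^ 2)) / absq a r x.1 ^ 4 : ℝ)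
        * Complex.I * F.f x := by
  have h0 : 0 < r := (hM.trans_le (rPlus_ge M a Q)).trans hr
  have hs : sin x.1 ≠ 0 := (sin_pos_of_pos_of_lt_pi hx.1 hx.2).ne'
  have hN := (absq_pos h0 a x.1).ne'
  have hp1 : 0 < sph t r x 1 := h0
  have hp2 : sin (sph t r x 2) ≠ 0 := hs
  have hreg := F.regular x (Ioo_subset_Icc_self hx)
  have hq := absq_sq_add a r x.1
  have e1 : fderiv ℝ F.f x (0, 1) = fderiv ℝ g (sph t r x) vecPhi := by
    rw [hF, fderiv_comp_sph hg]; rfl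
  have e0 : fderiv ℝ F.f x (1, 0) = fderiv ℝ g (sph t r x) ![0, 0, 1, 0] := by
    rw [hF, fderiv_comp_sph hg]
  have ef : F.f x = g (sph t r x) := by rw [hF]
  have c1 : sph t r x 1 = r := rfl
  have c2 : sph t r x 2 = x.1 := rfl
  have hN' : (absq a r x.1 : ℂ) ≠ 0 := by exact_mod_cast hN
  have hs' : (sin x.1 : ℂ) ≠ 0 := by exact_mod_cast hs
  rw [e1] at hreg
  refine ⟨?_, ?_, ?_⟩
  · rw [spinNabla, omega_frame_zero hp1 hp2, frame_zero_eq_smul, map_smul, e0, c1, c2,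
      Complex.real_smul]
    push_cast
    field_simp
    simp
  -- Writing `r² + a² = |q|² + a² sin² θ` splits `|q| ω(e₂)` into the round `cot θ`, which belongs
  -- to `azim`, and a term regular at the poles.
  · have ha : F.azim x = (fderiv ℝ g (sph t r x) vecPhi + k * cos x.1 * Complex.I * F.f x)
        / sin x.1 := by rw [← hreg]; field_simp
    rw [ha, spinNabla, omega_frame_one hp1 hp2, frame_one_eq_smul a hp2, map_smul, map_add,
      map_smul, map_smul, ef, c1, c2, ← hq, Complex.real_smul, Complex.real_smul,
      Complex.real_smul]
    have : vecT (sph t r x) = vecT 0 := rfl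
    rw [this]
    generalize sin x.1 = sn at *
    generalize cos x.1 = cn at *
    generalize absq a r x.1 = N at *
    push_cast
    field_simp
    ring
  · rw [spinNabla, omega_vecT hp1 hp2, ef, c1, c2]
    rfl
end

end

/-! ### Integration by parts on the sphere. -/

section

open ComplexConjugate

/-- The domain of the angular coordinates. -/
def angles : Set (ℝ × ℝ) := Ioo 0 π ×ˢ Ioo 0 (2 * π)

theorem angles_ae_eq : angles =ᵐ[volume] Icc ((0, 0) : ℝ × ℝ) (π, 2 * π) := by
  rw [← Icc_prod_Icc]
  exact Measure.set_prod_ae_eq Ioo_ae_eq_Icc Ioo_ae_eq_Icc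

theorem measurableSet_angles : MeasurableSet angles := measurableSet_Ioo.prod measurableSet_Ioo

theorem integrableOn_angles {E : Type*} [NormedAddCommGroup E] {g : ℝ × ℝ → E}
    (hg : Continuous g) : IntegrableOn g angles :=
  (hg.continuousOn.integrableOn_compact isCompact_Icc).congr_set_ae angles_ae_eq

/-- In the divergence theorem on the coordinate rectangle, the sides at the poles vanish and those
at `φ = 0` and `φ = 2π` cancel. -/
theorem integral_divergence_angles {P R : ℝ × ℝ → ℂ} (hP : ContDiff ℝ 1 P) (hR : ContDiff ℝ 1 R)
    (h0 : ∀ φ, P (0, φ) = 0) (hπ : ∀ φ, P (π, φ) = 0) (hper : ∀ θ, R (θ, 2 * π) = R (θ, 0)) :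
    ∫ x in angles, (fderiv ℝ P x (1, 0) + fderiv ℝ R x (0, 1)) = 0 := by
  have cP : Continuous fun x => fderiv ℝ P x (1, 0) :=
    (hP.continuous_fderiv one_ne_zero).clm_apply continuous_const
  have cR : Continuous fun x => fderiv ℝ R x (0, 1) :=
    (hR.continuous_fderiv one_ne_zero).clm_apply continuous_const
  rw [setIntegral_congr_set angles_ae_eq,
    integral_divergence_prod_Icc_of_hasFDerivAt_of_le P R (fderiv ℝ P) (fderiv ℝ R) (0, 0)
      (π, 2 * π) ⟨pi_pos.le, by positivity⟩ hP.continuous.continuousOn hR.continuous.continuousOn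
      (fun x _ => (hP.differentiable one_ne_zero x).hasFDerivAt)
      (fun x _ => (hR.differentiable one_ne_zero x).hasFDerivAt)
      ((cP.add cR).continuousOn.integrableOn_compact isCompact_Icc)]
  simp [h0, hπ, hper]

/-- The polar derivative `∂_θ f`. -/
def SpinFunction.pol {k : ℝ} (F : SpinFunction k) (x : ℝ × ℝ) : ℂ := fderiv ℝ F.f x (1, 0)

theorem SpinFunction.continuous_pol {k : ℝ} (F : SpinFunction k) : Continuous F.pol :=
  (F.smooth.continuous_fderiv (by simp)).clm_apply continuous_const

theorem fderiv_conj (f : ℝ × ℝ → ℂ) (x v : ℝ × ℝ) :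
    fderiv ℝ (fun x => conj (f x)) x v = conj (fderiv ℝ f x v) := by
  have := fderiv_star (𝕜 := ℝ) (f := f) (x := x)
  have h2 := congrArg (fun L : ℝ × ℝ →L[ℝ] ℂ => L v) this
  simpa using h2

theorem contDiff_conj {n : ℕ∞ω} {f : ℝ × ℝ → ℂ} (hf : ContDiff ℝ n f) :
    ContDiff ℝ n fun x => conj (f x) := Complex.conjCLE.contDiff.comp hf

theorem fderiv_mul_apply' {f g : ℝ × ℝ → ℂ} (hf : ContDiff ℝ 1 f) (hg : ContDiff ℝ 1 g)
    (x v : ℝ × ℝ) : fderiv ℝ (fun x => f x * g x) x v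
      = f x * fderiv ℝ g x v + g x * fderiv ℝ f x v := by
  rw [fderiv_fun_mul (hf.differentiable one_ne_zero x) (hg.differentiable one_ne_zero x)]
  simp

theorem fderiv_ofReal_fst {w : ℝ → ℝ} (hw : ContDiff ℝ 1 w) (x v : ℝ × ℝ) :
    fderiv ℝ (fun x : ℝ × ℝ => (w x.1 : ℂ)) x v = v.1 * deriv w x.1 := by
  have h := Complex.ofRealCLM.hasFDerivAt.comp x
    ((hw.differentiable one_ne_zero x.1).hasDerivAt.comp_hasFDerivAt
    x (hasFDerivAt_fst (𝕜 := ℝ) (E := ℝ) (F := ℝ) (p := x)))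
  have h2 := congrArg (fun L : ℝ × ℝ →L[ℝ] ℂ => L v) h.fderiv
  refine h2.trans ?_
  simp [mul_comm]

theorem contDiff_ofReal_fst {n : ℕ∞ω} {w : ℝ → ℝ} (hw : ContDiff ℝ n w) :
    ContDiff ℝ n fun x : ℝ × ℝ => (w x.1 : ℂ) :=
  Complex.ofRealCLM.contDiff.comp (hw.comp contDiff_fst)

theorem SpinFunction.fderiv_azimuthal {k : ℝ} (F : SpinFunction k) {x : ℝ × ℝ}
    (hx : x.1 ∈ Icc 0 π) : fderiv ℝ F.f x (0, 1)
      = sin x.1 * F.azim x - k * cos x.1 * Complex.I * F.f x := by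
  rw [F.regular x hx]; ring

/-- The periodicity of `f` passes to `∂_θ f`. -/
theorem SpinFunction.pol_periodic {k : ℝ} (F : SpinFunction k) (θ : ℝ) :
    F.pol (θ, 2 * π) = F.pol (θ, 0) := by
  have h (φ : ℝ) : F.pol (θ, φ) = deriv (fun τ => F.f (τ, φ)) θ := by
    have h1 := (F.smooth.differentiable (by simp) (θ, φ)).hasFDerivAt
    have h2 : HasDerivAt (fun τ : ℝ => (τ, φ)) ((1, 0) : ℝ × ℝ) θ :=
      (hasDerivAt_id θ).prodMk (hasDerivAt_const θ φ)
    exact (h1.comp_hasDerivAt θ h2).deriv.symm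
  rw [h, h, funext F.periodic]

/-- The sphere density whose integral vanishes by the weighted commutation identity between
`∂_θ` and the azimuthal derivative. -/
def SpinFunction.curv {k : ℝ} (F : SpinFunction k) (w : ℝ → ℝ) (x : ℝ × ℝ) : ℝ :=
  deriv w x.1 * (F.f x * conj (F.azim x)).im
    + w x.1 * (2 * (F.pol x * conj (F.azim x)).im + k * ‖F.f x‖ ^ 2)

theorem SpinFunction.integral_curv {k : ℝ} (F : SpinFunction k) {w : ℝ → ℝ}
    (hw : ContDiff ℝ ∞ w) : ∫ x in angles, sin x.1 * F.curv w x = 0 := by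
  have hF := F.smooth
  have cpol := F.continuous_pol
  have caz := F.continuous_azim
  have hw1 : ContDiff ℝ 1 w := hw.of_le (by simp)
  have hF1 : ContDiff ℝ 1 F.f := hF.of_le (by simp)
  have hd : ContDiff ℝ 1 (fderiv ℝ F.f) := hF.fderiv_right (by norm_cast)
  have hθ : ContDiff ℝ 1 fun x => fderiv ℝ F.f x (1, 0) := hd.clm_apply contDiff_const
  have hφ : ContDiff ℝ 1 fun x => fderiv ℝ F.f x (0, 1) := hd.clm_apply contDiff_const
  have hcos : ContDiff ℝ 1 (fun θ => k * cos θ) := contDiff_const.mul contDiff_cos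
  have hcF : ContDiff ℝ 1 fun x : ℝ × ℝ => ((k * cos x.1 : ℝ) : ℂ) * Complex.I * F.f x :=
    ((contDiff_ofReal_fst hcos).mul contDiff_const).mul hF1
  have hI : ContDiff ℝ 1 fun x : ℝ × ℝ => ((k * cos x.1 : ℝ) : ℂ) * Complex.I :=
    (contDiff_ofReal_fst hcos).mul contDiff_const
  -- The second factor equals the conjugate of `sin θ · azim`, so `P` vanishes at both poles.
  -- Differentiating `k cos θ` in `θ` is what produces `k ‖f‖²`.
  set P : ℝ × ℝ → ℂ := fun x => (w x.1 * F.f x) * conj (fderiv ℝ F.f x (0, 1)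
    + ((k * cos x.1 : ℝ) : ℂ) * Complex.I * F.f x) with hP
  set R : ℝ × ℝ → ℂ := fun x => (w x.1 * F.f x) * conj (-fderiv ℝ F.f x (1, 0)) with hR
  have hwF : ContDiff ℝ 1 fun x : ℝ × ℝ => (w x.1 : ℂ) * F.f x :=
    (contDiff_ofReal_fst hw1).mul hF1
  have cP : ContDiff ℝ 1 P := hwF.mul (contDiff_conj (hφ.add hcF))
  have cR : ContDiff ℝ 1 R := hwF.mul (contDiff_conj hθ.neg)
  have hz := integral_divergence_angles cP cR ?_ ?_ ?_
  · have hi : IntegrableOn (fun x => fderiv ℝ P x (1, 0) + fderiv ℝ R x (0, 1)) angles :=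
      integrableOn_angles (((cP.continuous_fderiv one_ne_zero).clm_apply continuous_const).add
        ((cR.continuous_fderiv one_ne_zero).clm_apply continuous_const))
    have h1 := Complex.imCLM.integral_comp_comm hi
    rw [hz, map_zero] at h1
    rw [← h1]
    refine setIntegral_congr_fun measurableSet_angles fun x hx => ?_
    have hreg := F.regular x (Ioo_subset_Icc_self hx.1)
    -- In the sum of the divergences the second derivatives of `f` cancel by symmetry.
    have hsymm : fderiv ℝ (fderiv ℝ F.f) x (1, 0) (0, 1)
        = fderiv ℝ (fderiv ℝ F.f) x (0, 1) (1, 0) :=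
      (hF.contDiffAt.isSymmSndFDerivAt (by simp; norm_cast)).eq _ _
    have e1 : fderiv ℝ (fun x => fderiv ℝ F.f x (0, 1)) x (1, 0)
        = fderiv ℝ (fderiv ℝ F.f) x (1, 0) (0, 1) := by
      rw [fderiv_clm_apply (hd.differentiable one_ne_zero x) (differentiableAt_const _)]; simp
    have e2 : fderiv ℝ (fun x => -fderiv ℝ F.f x (1, 0)) x (0, 1)
        = -fderiv ℝ (fderiv ℝ F.f) x (0, 1) (1, 0) := by
      rw [fderiv_fun_neg, fderiv_clm_apply (hd.differentiable one_ne_zero x)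
        (differentiableAt_const _)]; simp
    have e3 : fderiv ℝ (fun x => fderiv ℝ F.f x (0, 1)
        + ((k * cos x.1 : ℝ) : ℂ) * Complex.I * F.f x) x (1, 0)
        = fderiv ℝ (fderiv ℝ F.f) x (1, 0) (0, 1) + ((k * cos x.1 : ℝ) * Complex.I * F.pol x
          - (k * sin x.1 : ℝ) * Complex.I * F.f x) := by
      rw [fderiv_fun_add (hφ.differentiable one_ne_zero x) (hcF.differentiable one_ne_zero x),
        _root_.add_apply, e1, fderiv_mul_apply' hI hF1, fderiv_mul_apply'
        (contDiff_ofReal_fst hcos) contDiff_const, fderiv_ofReal_fst hcos]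
      have : deriv (fun θ => k * cos θ) x.1 = -(k * sin x.1) := by
        simp
      rw [this]
      simp [SpinFunction.pol]
      ring
    have eP : fderiv ℝ P x (1, 0) = (w x.1 * F.f x) * conj (fderiv ℝ (fderiv ℝ F.f) x (1, 0) (0, 1)
        + ((k * cos x.1 : ℝ) * Complex.I * F.pol x - (k * sin x.1 : ℝ) * Complex.I * F.f x))
        + conj ((sin x.1 : ℂ) * F.azim x)
          * (w x.1 * F.pol x + F.f x * deriv w x.1) := by
      rw [hP, fderiv_mul_apply' hwF (contDiff_conj (hφ.add hcF)), fderiv_conj, e3,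
        fderiv_mul_apply' (contDiff_ofReal_fst hw1) hF1, fderiv_ofReal_fst hw1, hreg]
      simp [SpinFunction.pol]
    have eR : fderiv ℝ R x (0, 1)
        = -(w x.1 * F.f x) * conj (fderiv ℝ (fderiv ℝ F.f) x (0, 1) (1, 0))
          - conj (F.pol x) * (w x.1 *
            (sin x.1 * F.azim x - k * cos x.1 * Complex.I * F.f x)) := by
      rw [hR, fderiv_mul_apply' hwF (contDiff_conj hθ.neg), fderiv_conj, e2,
        fderiv_mul_apply' (contDiff_ofReal_fst hw1) hF1, fderiv_ofReal_fst hw1,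
        F.fderiv_azimuthal (Ioo_subset_Icc_self hx.1)]
      simp [SpinFunction.pol]
      ring
    simp only [eP, eR, hsymm, SpinFunction.curv, Complex.imCLM_apply, ← Complex.normSq_eq_norm_sq,
      Complex.normSq_apply]
    simp [-Complex.ofReal_sin, -Complex.ofReal_cos]
    ring
  · intro φ
    have h := F.regular (0, φ) ⟨le_rfl, pi_pos.le⟩
    simp only [sin_zero, Complex.ofReal_zero, zero_mul] at h
    simp only [hP, Complex.ofReal_mul]
    rw [← h, map_zero, mul_zero]
  · intro φ
    have h := F.regular (π, φ) ⟨pi_pos.le, le_rfl⟩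
    simp only [sin_pi, Complex.ofReal_zero, zero_mul] at h
    simp only [hP, Complex.ofReal_mul]
    rw [← h, map_zero, mul_zero]
  · intro θ
    have := F.pol_periodic θ
    simp only [SpinFunction.pol] at this
    simp [hR, this, F.periodic]

/-- The sphere density whose integral vanishes by integrating by parts the pairing of a function of
spin one with a function of spin two. -/
def pairingDensity (F : SpinFunction 1) (G : SpinFunction 2) (W : ℝ → ℝ) (x : ℝ × ℝ) : ℝ :=
  (W x.1 * ((F.pol x + Complex.I * F.azim x) * conj (G.f x)
    + F.f x * (conj (G.pol x) + Complex.I * conj (G.azim x)))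
    + deriv W x.1 * (F.f x * conj (G.f x))).re

theorem integral_pairingDensity (F : SpinFunction 1) (G : SpinFunction 2) {W : ℝ → ℝ}
    (hW : ContDiff ℝ ∞ W) : ∫ x in angles, sin x.1 * pairingDensity F G W x = 0 := by
  have hW1 : ContDiff ℝ 1 W := hW.of_le (by simp)
  have hF1 : ContDiff ℝ 1 F.f := F.smooth.of_le (by simp)
  have hG1 : ContDiff ℝ 1 G.f := G.smooth.of_le (by simp)
  have hsin : ContDiff ℝ 1 sin := contDiff_sin
  have hWF : ContDiff ℝ 1 fun x : ℝ × ℝ => (W x.1 : ℂ) * F.f x :=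
    (contDiff_ofReal_fst hW1).mul hF1
  have hWFG : ContDiff ℝ 1 fun x : ℝ × ℝ => (W x.1 : ℂ) * F.f x * conj (G.f x) :=
    hWF.mul (contDiff_conj hG1)
  -- The `cos θ` terms cancel because the spins are 1 and 2: differentiating `sin θ` gives
  -- coefficient 1, spin 1 gives another 1, and spin 2 gives `-2`.
  set P : ℝ × ℝ → ℂ := fun x => (sin x.1 : ℝ) * (W x.1 * F.f x * conj (G.f x)) with hP
  set R : ℝ × ℝ → ℂ := fun x => Complex.I * (W x.1 * F.f x * conj (G.f x)) with hR
  have cP : ContDiff ℝ 1 P := (contDiff_ofReal_fst hsin).mul hWFG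
  have cR : ContDiff ℝ 1 R := contDiff_const.mul hWFG
  have hz := integral_divergence_angles cP cR (by simp [hP]) (by simp [hP])
    (by simp [hR, F.periodic, G.periodic])
  have hi : IntegrableOn (fun x => fderiv ℝ P x (1, 0) + fderiv ℝ R x (0, 1)) angles :=
    integrableOn_angles (((cP.continuous_fderiv one_ne_zero).clm_apply continuous_const).add
      ((cR.continuous_fderiv one_ne_zero).clm_apply continuous_const))
  have h1 := Complex.reCLM.integral_comp_comm hi
  rw [hz, map_zero] at h1
  rw [← h1]
  refine setIntegral_congr_fun measurableSet_angles fun x hx => ?_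
  have eW (v : ℝ × ℝ) : fderiv ℝ (fun x : ℝ × ℝ => (W x.1 : ℂ) * F.f x * conj (G.f x)) x v
      = W x.1 * F.f x * conj (fderiv ℝ G.f x v) + conj (G.f x) * (W x.1 * fderiv ℝ F.f x v
        + F.f x * (v.1 * deriv W x.1)) := by
    rw [fderiv_mul_apply' hWF (contDiff_conj hG1), fderiv_conj,
      fderiv_mul_apply' (contDiff_ofReal_fst hW1) hF1, fderiv_ofReal_fst hW1]
  have eP : fderiv ℝ P x (1, 0) = (sin x.1 : ℝ) * (W x.1 * F.f x * conj (G.pol x)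
      + conj (G.f x) * (W x.1 * F.pol x + F.f x * (deriv W x.1)))
      + (W x.1 * F.f x * conj (G.f x)) * (cos x.1 : ℝ) := by
    rw [hP, fderiv_mul_apply' (contDiff_ofReal_fst hsin) hWFG, fderiv_ofReal_fst hsin, eW]
    simp [SpinFunction.pol]
  have eR : fderiv ℝ R x (0, 1) = Complex.I * (W x.1 * F.f x
      * conj (sin x.1 * G.azim x - (2 : ℝ) * cos x.1 * Complex.I * G.f x)
      + conj (G.f x) * (W x.1 * (sin x.1 * F.azim x - (1 : ℝ) * cos x.1 * Complex.I * F.f x))) := by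
    rw [hR, fderiv_mul_apply' contDiff_const hWFG, eW,
      F.fderiv_azimuthal (Ioo_subset_Icc_self hx.1), G.fderiv_azimuthal (Ioo_subset_Icc_self hx.1)]
    simp
  simp only [eP, eR, pairingDensity, Complex.reCLM_apply]
  simp [-Complex.ofReal_sin, -Complex.ofReal_cos]
  ring

end

/-! ### Weights on the sphere and uniform bounds in the exterior. -/

section

open ComplexConjugate

/-- The area density of `S(t, r)` divided by `sin θ`. -/
def sig (M a Q r θ : ℝ) : ℝ := √((r ^ 2 + a ^ 2) ^ 2 - a ^ 2 * Delta M a Q r * sin θ ^ 2)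

/-- `𝒯/(r² + a²) + Δ r/(2|q|²)`. -/
def gfac (M a Q r θ : ℝ) : ℝ :=
  trap M a Q r / (r ^ 2 + a ^ 2) + Delta M a Q r * r / (2 * absq a r θ ^ 2)

/-- The real leading part of the factor of `u ψ₁ · (𝒟 · ψ̄₂)`. -/
def cfac (M a Q r θ : ℝ) : ℝ :=
  8 * Q ^ 2 / (absq a r θ ^ 5 * (r ^ 2 + a ^ 2) ^ 2) * (r ^ 3 * gfac M a Q r θ)

/-- The weight of the gradient terms on the unit sphere. -/
def gradWeight (M a Q r θ : ℝ) : ℝ := sig M a Q r θ / absq a r θ ^ 2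

/-- The weight of the coupling term on the unit sphere. -/
def couplingWeight (M a Q r θ : ℝ) : ℝ := 4 * sig M a Q r θ * cfac M a Q r θ / absq a r θ

/-- A point of the exterior of a subextremal Kerr-Newman black hole. -/
structure Exterior (M a Q r : ℝ) : Prop where
  pos : 0 < M
  sub : a ^ 2 + Q ^ 2 < M ^ 2
  lt : rPlus M a Q < r

namespace Exterior

variable {M a Q r : ℝ}


theorem mass_le (h : Exterior M a Q r) : M ≤ r := (rPlus_ge M a Q).trans h.lt.le

theorem radius_pos (h : Exterior M a Q r) : 0 < r := h.pos.trans_le h.mass_le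

theorem abs_le_mass (h : Exterior M a Q r) : |a| ≤ M :=
  abs_le_of_sq_le_sq (by nlinarith [h.sub, sq_nonneg Q]) h.pos.le

theorem abs_le_radius (h : Exterior M a Q r) : |a| ≤ r := h.abs_le_mass.trans h.mass_le

theorem charge_sq_le (h : Exterior M a Q r) : Q ^ 2 ≤ M ^ 2 := by nlinarith [h.sub, sq_nonneg a]

theorem sq_le (h : Exterior M a Q r) : a ^ 2 ≤ r ^ 2 := by
  rw [← sq_abs a]; exact pow_le_pow_left₀ (abs_nonneg a) h.abs_le_radius 2

theorem mass_sq_le (h : Exterior M a Q r) : M ^ 2 ≤ r ^ 2 := pow_le_pow_left₀ h.pos.le h.mass_le 2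

theorem delta_eq (h : Exterior M a Q r) : Delta M a Q r = r ^ 2 - 2 * M * r + a ^ 2 + Q ^ 2 := by
  have := sq_sqrt (show 0 ≤ M ^ 2 - a ^ 2 - Q ^ 2 by linarith [h.sub])
  simp only [Delta, rPlus, rMinus]
  linear_combination -this

theorem delta_nonneg (h : Exterior M a Q r) : 0 ≤ Delta M a Q r := by
  have h1 := h.lt
  have h2 : rMinus M a Q ≤ rPlus M a Q := by
    simp only [rMinus, rPlus]; linarith [sqrt_nonneg (M ^ 2 - a ^ 2 - Q ^ 2)]
  exact mul_nonneg (by linarith) (by linarith)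

theorem delta_le (h : Exterior M a Q r) : Delta M a Q r ≤ r ^ 2 := by
  rw [h.delta_eq]
  nlinarith [h.sub, h.mass_le, h.pos]

theorem abs_delta_sub_le (h : Exterior M a Q r) : |Delta M a Q r - (r ^ 2 + a ^ 2)|
    ≤ 2 * M * r := by
  rw [h.delta_eq, abs_le]
  constructor <;> nlinarith [h.charge_sq_le, h.mass_le, h.pos, sq_nonneg Q]

theorem absq_pos (h : Exterior M a Q r) (θ : ℝ) :
    0 < absq a r θ := KerrNewman.absq_pos h.radius_pos a θ

theorem le_absq (θ : ℝ) : r ≤ absq a r θ :=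
  le_sqrt_of_sq_le (le_add_of_nonneg_right (by positivity))

theorem le_absq_sq (h : Exterior M a Q r) (θ : ℝ) : r ^ 2 ≤ absq a r θ ^ 2 :=
  pow_le_pow_left₀ h.radius_pos.le (le_absq θ) 2

theorem absq_le (h : Exterior M a Q r) (θ : ℝ) : absq a r θ ≤ 2 * r := by
  refine sqrt_le_iff.2 ⟨by linarith [h.radius_pos], ?_⟩
  nlinarith [h.sq_le, cos_sq_le_one θ, sq_nonneg a, sq_nonneg (cos θ), sq_nonneg r]

/-- Since `0 ≤ Δ ≤ r²`, the subtracted term is absorbed by `2 a² r²`. The bound gives both `sig ≥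
r²` and the smoothness of the square root. -/
theorem sig_arg_ge (h : Exterior M a Q r) (θ : ℝ) :
    r ^ 4 ≤ (r ^ 2 + a ^ 2) ^ 2 - a ^ 2 * Delta M a Q r * sin θ ^ 2 := by
  have h1 : a ^ 2 * Delta M a Q r * sin θ ^ 2 ≤ a ^ 2 * r ^ 2 * 1 := by
    have := h.delta_nonneg
    have := h.delta_le
    have := sin_sq_le_one θ
    gcongr
  nlinarith [sq_nonneg (a ^ 2), sq_nonneg (a * r)]

theorem le_sig (h : Exterior M a Q r) (θ : ℝ) : r ^ 2 ≤ sig M a Q r θ :=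
  le_sqrt_of_sq_le ((by ring : (r ^ 2) ^ 2 = r ^ 4).trans_le (h.sig_arg_ge θ))

theorem sig_pos (h : Exterior M a Q r) (θ : ℝ) : 0 < sig M a Q r θ :=
  (pow_pos h.radius_pos 2).trans_le (h.le_sig θ)

theorem sig_le (h : Exterior M a Q r) (θ : ℝ) : sig M a Q r θ ≤ 2 * r ^ 2 := by
  refine sqrt_le_iff.2 ⟨by positivity, ?_⟩
  have : 0 ≤ a ^ 2 * Delta M a Q r * sin θ ^ 2 := by
    have := h.delta_nonneg
    positivity
  nlinarith [h.sq_le, sq_nonneg a, sq_nonneg r]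

theorem abs_trap_le (h : Exterior M a Q r) : |trap M a Q r| ≤ 7 * r ^ 3 := by
  have hr := h.radius_pos
  have h1 := h.mass_le
  have h2 : Q ^ 2 ≤ r ^ 2 := h.charge_sq_le.trans h.mass_sq_le
  have h3 := h.sq_le
  have hM := h.pos
  have e1 : M * r ^ 2 ≤ r * r ^ 2 := by gcongr
  have e2 : Q ^ 2 * r ≤ r ^ 2 * r := by gcongr
  have e3 : a ^ 2 * r ≤ r ^ 2 * r := by gcongr
  have e4 : M * a ^ 2 ≤ r * r ^ 2 := by gcongr
  have e5 : 0 ≤ M * r ^ 2 := by positivity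
  have e6 : 0 ≤ Q ^ 2 * r := by positivity
  have e7 : 0 ≤ a ^ 2 * r := by positivity
  have e8 : 0 ≤ M * a ^ 2 := by positivity
  rw [trap, abs_le]
  constructor <;> nlinarith

theorem abs_gfac_le (h : Exterior M a Q r) (θ : ℝ) : |gfac M a Q r θ| ≤ 9 * r := by
  have hr := h.radius_pos
  have e1 : |trap M a Q r / (r ^ 2 + a ^ 2)| ≤ 7 * r := by
    rw [abs_div, abs_of_pos (by positivity : 0 < r ^ 2 + a ^ 2), div_le_iff₀ (by positivity)]
    nlinarith [h.abs_trap_le, mul_nonneg hr.le (sq_nonneg a)]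
  have e2 : |Delta M a Q r * r / (2 * absq a r θ ^ 2)| ≤ 2 * r := by
    have := h.absq_pos θ
    have hd := h.delta_nonneg
    rw [abs_of_nonneg (by positivity), div_le_iff₀ (by positivity)]
    nlinarith [mul_le_mul_of_nonneg_right (h.delta_le.trans (h.le_absq_sq θ)) hr.le,
      mul_pos hr (pow_pos this 2)]
  exact (abs_add_le _ _).trans (by linarith)

theorem hasDerivAt_sig (h : Exterior M a Q r) (θ : ℝ) : HasDerivAt (sig M a Q r)
    (-(a ^ 2 * Delta M a Q r * (sin θ * cos θ)) / sig M a Q r θ) θ := by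
  have h1 := (((((hasDerivAt_sin θ).pow 2).const_mul (a ^ 2 * Delta M a Q r)).const_sub
    ((r ^ 2 + a ^ 2) ^ 2)).sqrt
    (ne_of_gt ((pow_pos h.radius_pos 4).trans_le (h.sig_arg_ge θ))))
  refine h1.congr_deriv ?_
  have := (h.sig_pos θ).ne'
  simp only [sig, Pi.pow_apply] at this ⊢
  field_simp
  simp
  ring

theorem hasDerivAt_absq_sq (θ : ℝ) : HasDerivAt (fun θ => absq a r θ ^ 2)
    (-(2 * a ^ 2 * (sin θ * cos θ))) θ := by
  have h1 := (((hasDerivAt_cos θ).pow 2).const_mul (a ^ 2)).const_add (r ^ 2)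
  simp only [absq_sq]
  refine h1.congr_deriv ?_
  simp
  ring

theorem abs_sin_mul_cos_le (θ : ℝ) : |sin θ * cos θ| ≤ 1 := by
  rw [abs_mul]
  exact mul_le_one₀ (abs_sin_le_one θ) (abs_nonneg _) (abs_cos_le_one θ)

theorem abs_deriv_sig_le (h : Exterior M a Q r) (θ : ℝ) :
    |-(a ^ 2 * Delta M a Q r * (sin θ * cos θ)) / sig M a Q r θ| ≤ a ^ 2 := by
  have hs := h.sig_pos θ
  rw [abs_div, abs_neg, abs_mul, abs_of_pos hs, div_le_iff₀ hs, abs_mul, abs_of_nonneg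
      (sq_nonneg a),
    abs_of_nonneg h.delta_nonneg]
  calc a ^ 2 * Delta M a Q r * |sin θ * cos θ| ≤ a ^ 2 * sig M a Q r θ * 1 := by
        have := h.delta_nonneg
        have := h.delta_le.trans (h.le_sig θ)
        have := abs_sin_mul_cos_le θ
        gcongr
    _ = _ := mul_one _

theorem abs_deriv_absq_sq_le (θ : ℝ) : |-(2 * a ^ 2 * (sin θ * cos θ))| ≤ 2 * a ^ 2 := by
  rw [abs_neg, abs_mul, abs_of_nonneg (by positivity : 0 ≤ 2 * a ^ 2)]
  exact mul_le_of_le_one_right (by positivity) (abs_sin_mul_cos_le θ)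

/-- The polar angle enters only through `a² sin² θ` and `a² cos² θ`, hence the factor `a²`. The
constant 5 is 1 from the area density plus 4 from `|q|²`. -/
theorem abs_deriv_gradWeight_le (h : Exterior M a Q r) (θ : ℝ) :
    |deriv (gradWeight M a Q r) θ| ≤ 5 * a ^ 2 / r ^ 2 := by
  have hr := h.radius_pos
  have hN := h.absq_pos θ
  have hN2 := h.le_absq_sq θ
  have hd := (h.hasDerivAt_sig θ).fun_div (hasDerivAt_absq_sq θ) (by positivity)
  have hS := h.abs_deriv_sig_le θ
  have hn := abs_deriv_absq_sq_le (a := a) θ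
  have hs := h.sig_pos θ
  have hs2 := h.sig_le θ
  have : deriv (gradWeight M a Q r) θ = _ := hd.deriv
  rw [this]
  generalize -(a ^ 2 * Delta M a Q r * (sin θ * cos θ)) / sig M a Q r θ = S' at *
  generalize -(2 * a ^ 2 * (sin θ * cos θ)) = n' at *
  have e : (S' * absq a r θ ^ 2 - sig M a Q r θ * n') / (absq a r θ ^ 2) ^ 2
      = S' / absq a r θ ^ 2 - sig M a Q r θ * n' / (absq a r θ ^ 2) ^ 2 := by
    field_simp
  rw [e]
  have e1 : |S' / absq a r θ ^ 2| ≤ a ^ 2 / r ^ 2 := by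
    rw [abs_div, abs_of_pos (by positivity : 0 < absq a r θ ^ 2)]
    gcongr
  have e2 : |sig M a Q r θ * n' / (absq a r θ ^ 2) ^ 2|
      ≤ 2 * r ^ 2 * (2 * a ^ 2) / (r ^ 2) ^ 2 := by
    rw [abs_div, abs_of_pos (by positivity : 0 < (absq a r θ ^ 2) ^ 2), abs_mul, abs_of_pos hs]
    gcongr
  refine (abs_sub _ _).trans ((add_le_add e1 e2).trans_eq ?_)
  field_simp
  ring

/-- Here `|q|` appears only through `|q|²`, which is polynomial in `cos θ` and easy to
differentiate. -/
theorem couplingWeight_eq (h : Exterior M a Q r) (θ : ℝ) : couplingWeight M a Q r θ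
    = 32 * Q ^ 2 * r ^ 3 / (r ^ 2 + a ^ 2) ^ 2 *
      (sig M a Q r θ * gfac M a Q r θ / (absq a r θ ^ 2) ^ 3) := by
  have hN := h.absq_pos θ
  have hr := h.radius_pos
  have : r ^ 2 + a ^ 2 ≠ 0 := by positivity
  simp only [couplingWeight, cfac]
  field_simp
  ring

theorem abs_couplingWeight_le (h : Exterior M a Q r) (θ : ℝ) : |couplingWeight M a Q r θ|
    ≤ 576 * Q ^ 2 / r ^ 4 := by
  have hr := h.radius_pos
  have hN := h.absq_pos θ
  have hs := h.sig_pos θ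
  have e1 : |sig M a Q r θ * gfac M a Q r θ / (absq a r θ ^ 2) ^ 3|
      ≤ 2 * r ^ 2 * (9 * r) / (r ^ 2) ^ 3 := by
    rw [abs_div, abs_mul, abs_of_pos hs, abs_of_pos (by positivity : 0 < (absq a r θ ^ 2) ^ 3)]
    have := h.sig_le θ
    have := h.abs_gfac_le θ
    have := h.le_absq_sq θ
    gcongr
  have e2 : 32 * Q ^ 2 * r ^ 3 / (r ^ 2 + a ^ 2) ^ 2 ≤ 32 * Q ^ 2 * r ^ 3 / (r ^ 2) ^ 2 := by
    gcongr
    exact le_add_of_nonneg_right (sq_nonneg a)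
  rw [h.couplingWeight_eq, abs_mul,
    abs_of_nonneg (by positivity : 0 ≤ 32 * Q ^ 2 * r ^ 3 / (r ^ 2 + a ^ 2) ^ 2)]
  refine (mul_le_mul e2 e1 (abs_nonneg _) (by positivity)).trans_eq ?_
  field_simp
  ring

/-- The constant is `32 (9 + 2 + 108)`, from differentiating the area density, `gfac` and `|q|⁻⁶`
respectively. As for the other weight, the gain is `a²`. -/
theorem abs_deriv_couplingWeight_le (h : Exterior M a Q r) (θ : ℝ) :
    |deriv (couplingWeight M a Q r) θ| ≤ 3808 * Q ^ 2 * a ^ 2 / r ^ 6 := by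
  have hr := h.radius_pos
  have hN := h.absq_pos θ
  have hN2 := h.le_absq_sq θ
  have hg : HasDerivAt (gfac M a Q r) (-(Delta M a Q r * r)
      * (-(2 * a ^ 2 * (sin θ * cos θ))) / (2 * (absq a r θ ^ 2) ^ 2)) θ := by
    have := ((hasDerivAt_const θ (Delta M a Q r * r)).fun_div
      ((hasDerivAt_absq_sq θ).const_mul 2) (by positivity)).const_add
      (trap M a Q r / (r ^ 2 + a ^ 2))
    refine this.congr_deriv ?_
    field_simp
    ring
  have hd := ((((h.hasDerivAt_sig θ).mul hg).fun_div ((hasDerivAt_absq_sq θ).pow 3)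
    (by simp only [Pi.pow_apply]; positivity)).const_mul (32 * Q ^ 2 * r ^ 3 / (r ^ 2 + a ^ 2) ^ 2))
  have hfun : couplingWeight M a Q r = _ := funext h.couplingWeight_eq
  rw [hfun]
  refine (congrArg abs hd.deriv).trans_le ?_
  have hS := h.abs_deriv_sig_le θ
  have hn := abs_deriv_absq_sq_le (a := a) θ
  have hs := h.sig_pos θ
  have hs2 := h.sig_le θ
  have hG := h.abs_gfac_le θ
  have hG' : |-(Delta M a Q r * r) * (-(2 * a ^ 2 * (sin θ * cos θ))) / (2 * (absq a r θ ^ 2) ^ 2)|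
      ≤ a ^ 2 / r := by
    have hD := h.delta_nonneg
    have hD2 := h.delta_le
    rw [abs_div, abs_of_pos (by positivity : 0 < 2 * (absq a r θ ^ 2) ^ 2), abs_mul, abs_neg,
      abs_of_nonneg (by positivity : 0 ≤ Delta M a Q r * r)]
    calc _ ≤ r ^ 2 * r * (2 * a ^ 2) / (2 * (r ^ 2) ^ 2) := by gcongr
      _ = a ^ 2 / r := by field_simp
  simp only [Pi.mul_apply, Pi.pow_apply]
  generalize -(Delta M a Q r * r) * (-(2 * a ^ 2 * (sin θ * cos θ)))
    / (2 * (absq a r θ ^ 2) ^ 2) = G' at *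
  generalize -(a ^ 2 * Delta M a Q r * (sin θ * cos θ)) / sig M a Q r θ = S' at *
  generalize -(2 * a ^ 2 * (sin θ * cos θ)) = n' at *
  generalize gfac M a Q r θ = G at *
  generalize sig M a Q r θ = S at *
  generalize absq a r θ ^ 2 = n at *
  have hn0 : 0 < n := (pow_pos hr 2).trans_le hN2
  have e : ((S' * G + S * G') * n ^ 3 - S * G * ((3 : ℕ) * n ^ (3 - 1) * n')) / (n ^ 3) ^ 2
      = S' * G / n ^ 3 + S * G' / n ^ 3 - 3 * S * G * n' / n ^ 4 := by
    simp only [Nat.cast_ofNat]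
    norm_num
    field_simp
  rw [e, abs_mul, abs_of_nonneg (by positivity : 0 ≤ 32 * Q ^ 2 * r ^ 3 / (r ^ 2 + a ^ 2) ^ 2)]
  have e1 : |S' * G / n ^ 3| ≤ a ^ 2 * (9 * r) / (r ^ 2) ^ 3 := by
    rw [abs_div, abs_mul, abs_of_pos (by positivity : 0 < n ^ 3)]
    gcongr
  have e2 : |S * G' / n ^ 3| ≤ 2 * r ^ 2 * (a ^ 2 / r) / (r ^ 2) ^ 3 := by
    rw [abs_div, abs_mul, abs_of_pos (by positivity : 0 < n ^ 3), abs_of_pos hs]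
    gcongr
  have e3 : |3 * S * G * n' / n ^ 4| ≤ 3 * (2 * r ^ 2) * (9 * r) * (2 * a ^ 2) / (r ^ 2) ^ 4 := by
    rw [abs_div, abs_mul, abs_mul, abs_mul, abs_of_pos (by positivity : 0 < n ^ 4), abs_of_pos hs,
      abs_of_pos (by norm_num : (0 : ℝ) < 3)]
    gcongr
  have e4 : 32 * Q ^ 2 * r ^ 3 / (r ^ 2 + a ^ 2) ^ 2 ≤ 32 * Q ^ 2 * r ^ 3 / (r ^ 2) ^ 2 := by
    gcongr
    exact le_add_of_nonneg_right (sq_nonneg a)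
  have e5 := (abs_sub (S' * G / n ^ 3 + S * G' / n ^ 3) (3 * S * G * n' / n ^ 4)).trans
    (add_le_add ((abs_add_le _ _).trans (add_le_add e1 e2)) e3)
  refine (mul_le_mul e4 e5 (abs_nonneg _) (by positivity)).trans_eq ?_
  field_simp
  ring

theorem contDiff_absq (h : Exterior M a Q r) : ContDiff ℝ ∞ (absq a r) := by
  have hr := h.radius_pos
  unfold absq
  refine ContDiff.sqrt ?_ fun θ => by positivity
  fun_prop

theorem contDiff_sig (h : Exterior M a Q r) : ContDiff ℝ ∞ (sig M a Q r) := by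
  unfold sig
  refine ContDiff.sqrt ?_ fun θ => ne_of_gt ((pow_pos h.radius_pos 4).trans_le (h.sig_arg_ge θ))
  fun_prop

theorem contDiff_gfac (h : Exterior M a Q r) : ContDiff ℝ ∞ (gfac M a Q r) :=
  contDiff_const.add (contDiff_const.div (contDiff_const.mul (h.contDiff_absq.pow 2))
    fun θ => by have := h.absq_pos θ; positivity)

theorem contDiff_cfac (h : Exterior M a Q r) : ContDiff ℝ ∞ (cfac M a Q r) :=
  (contDiff_const.div ((h.contDiff_absq.pow 5).mul contDiff_const)
    fun θ => by have := h.absq_pos θ; have := h.radius_pos; positivity).mul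
    (contDiff_const.mul h.contDiff_gfac)

theorem contDiff_gradWeight (h : Exterior M a Q r) : ContDiff ℝ ∞ (gradWeight M a Q r) :=
  h.contDiff_sig.div (h.contDiff_absq.pow 2) fun θ => by have := h.absq_pos θ; positivity

theorem contDiff_couplingWeight (h : Exterior M a Q r) : ContDiff ℝ ∞ (couplingWeight M a Q r) :=
  ((contDiff_const.mul h.contDiff_sig).mul h.contDiff_cfac).div h.contDiff_absq
    fun θ => (h.absq_pos θ).ne'

end Exterior

end

/-! ### The Poincaré inequality with its square retained. -/

section

open ComplexConjugate

/-- The time component of `|q| e₂` and the deviation of the connection from the round one. -/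
def frameDefect (a r θ k : ℝ) (f F : ℂ) : ℂ :=
  (a * sin θ : ℝ) * F + k * (a ^ 2 * sin θ * cos θ / absq a r θ ^ 2 : ℝ) * Complex.I * f

/-- The derivative `∇_T` in terms of `F = ∂_t f`. -/
def timeDeriv (M a Q r θ k : ℝ) (f F : ℂ) : ℂ :=
  F + k * (a * cos θ * (Delta M a Q r - (r ^ 2 + a ^ 2)) / absq a r θ ^ 4 : ℝ) * Complex.I * f

/-- The constant in the coercivity estimate. -/
def coercConst (M : ℝ) : ℝ :=
  6 + 12 / M + (6 + M) * (2 + 72 / M ^ 2)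

theorem coercConst_pos {M : ℝ} (hM : 0 < M) : 0 < coercConst M := by
  unfold coercConst; positivity

/-- This collects the errors of the coercivity estimate after rescaling: `y`, `t`, `p` stand for the
sizes of `∇_{e₂} f`, `∇_T f / r` and `f / r`, while `z` bounds the frame defect divided by `|a|`. -/
theorem coercConst_quadratic {M y t p z : ℝ} (hM : 0 < M) (hz : z = t + 6 / M * p) :
    2 * (y * z) + M * z ^ 2 + 2 / M * p ^ 2 + (10 / M * (p * y) + 10 * (p * z))
      ≤ coercConst M * (y ^ 2 + t ^ 2 + p ^ 2) := by
  have hz2 : z ^ 2 ≤ (2 + 72 / M ^ 2) * (t ^ 2 + p ^ 2) := by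
    have h1 : z ^ 2 + (t - 6 / M * p) ^ 2 = 2 * t ^ 2 + 72 / M ^ 2 * p ^ 2 := by
      rw [hz]; field_simp; ring
    have h2 : 0 ≤ 2 * p ^ 2 + 72 / M ^ 2 * t ^ 2 := by positivity
    linarith [sq_nonneg (t - 6 / M * p)]
  have h1 : 10 / M * (p * y) ≤ 5 / M * (p ^ 2 + y ^ 2) := by
    have h2 : 0 ≤ 5 / M * (p - y) ^ 2 := by positivity
    have h3 : 5 / M * (p - y) ^ 2 = 5 / M * (p ^ 2 + y ^ 2) - 10 / M * (p * y) := by ring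
    linarith
  have h2 : (6 + M) * z ^ 2 ≤ (6 + M) * ((2 + 72 / M ^ 2) * (t ^ 2 + p ^ 2)) := by gcongr
  have h3 : 0 ≤ 12 / M * t ^ 2 + 5 / M * p ^ 2 + 7 / M * y ^ 2 + 5 * y ^ 2 + p ^ 2 + 6 * t ^ 2
      + (6 + M) * (2 + 72 / M ^ 2) * y ^ 2 := by positivity
  have h4 : coercConst M * (y ^ 2 + t ^ 2 + p ^ 2)
      = 6 * (y ^ 2 + t ^ 2 + p ^ 2) + 12 / M * (y ^ 2 + t ^ 2 + p ^ 2)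
        + (6 + M) * (2 + 72 / M ^ 2) * y ^ 2 + (6 + M) * ((2 + 72 / M ^ 2) * (t ^ 2 + p ^ 2)) := by
    unfold coercConst; ring
  have h5 : 2 / M * p ^ 2 + 5 / M * (p ^ 2 + y ^ 2) + (12 / M * t ^ 2 + 5 / M * p ^ 2
      + 7 / M * y ^ 2)
      = 12 / M * (y ^ 2 + t ^ 2 + p ^ 2) := by ring
  linarith [sq_nonneg (y - z), sq_nonneg (p - z)]

namespace Exterior

variable {M a Q r : ℝ}

/-- Replacing `∂_t f` by `∇_T f` costs a connection term of the same nature as the one already in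
the defect. Together they are `O(|a| / r)` because `|a| ≤ r` and `M |a| ≤ r²`; the factor 3 is `1 +
2`. -/
theorem norm_frameDefect_le (h : Exterior M a Q r) {k : ℝ} (hk : 0 ≤ k) (θ : ℝ) (f F : ℂ) :
    ‖frameDefect a r θ k f F‖
      ≤ |a| * ‖timeDeriv M a Q r θ k f F‖ + 3 * k * (|a| / r) * ‖f‖ := by
  have hr := h.radius_pos
  have hN := h.absq_pos θ
  have hM := h.pos
  have hN2 := h.le_absq_sq θ
  set b := |a| with hb
  have hb0 : 0 ≤ b := abs_nonneg a
  have hbM := h.abs_le_mass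
  have hbr := h.abs_le_radius
  have hMr := h.mass_le
  have e1 : |a * cos θ * (Delta M a Q r - (r ^ 2 + a ^ 2)) / absq a r θ ^ 4|
      ≤ b * 1 * (2 * M * r) / r ^ 4 := by
    rw [abs_div, abs_mul, abs_mul, abs_of_pos (by positivity : 0 < absq a r θ ^ 4)]
    have := h.abs_delta_sub_le
    have := abs_cos_le_one θ
    have := le_absq (a := a) (r := r) θ
    gcongr
  have e2 : |a ^ 2 * sin θ * cos θ / absq a r θ ^ 2| ≤ b ^ 2 * 1 / r ^ 2 := by
    rw [abs_div, mul_assoc, abs_mul, abs_of_pos (by positivity : 0 < absq a r θ ^ 2),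
      abs_of_nonneg (sq_nonneg a), ← sq_abs a]
    have := abs_sin_mul_cos_le θ
    gcongr
  have e3 : |a * sin θ| ≤ b := by
    rw [abs_mul]; exact mul_le_of_le_one_right hb0 (abs_sin_le_one θ)
  set om := a * cos θ * (Delta M a Q r - (r ^ 2 + a ^ 2)) / absq a r θ ^ 4 with hom
  set c := a ^ 2 * sin θ * cos θ / absq a r θ ^ 2 with hc
  have hF : frameDefect a r θ k f F = (a * sin θ : ℝ) * timeDeriv M a Q r θ k f F
      + ((k * (c - a * sin θ * om) : ℝ) : ℂ) * Complex.I * f := by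
    simp only [frameDefect, timeDeriv, ← hom, ← hc]
    push_cast
    ring
  have e4 : |k * (c - a * sin θ * om)| ≤ 3 * k * (b / r) := by
    rw [abs_mul, abs_of_nonneg hk]
    have h1 : |c - a * sin θ * om| ≤ b ^ 2 * 1 / r ^ 2 + b * (b * 1 * (2 * M * r) / r ^ 4) := by
      refine (abs_sub _ _).trans (add_le_add e2 ?_)
      rw [abs_mul]
      gcongr
    have h2 : b ^ 2 * 1 / r ^ 2 ≤ b / r := by
      rw [div_le_div_iff₀ (by positivity) hr]
      nlinarith [mul_nonneg hb0 hr.le, mul_le_mul_of_nonneg_left hbr (mul_nonneg hb0 hr.le)]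
    have h3 : b * (b * 1 * (2 * M * r) / r ^ 4) ≤ 2 * (b / r) := by
      have : b * (b * 1 * (2 * M * r) / r ^ 4) = 2 * (b / r) * (b * M / r ^ 2) := by
        field_simp
      rw [this]
      refine mul_le_of_le_one_right (by positivity) ?_
      rw [div_le_one (by positivity)]
      nlinarith
    calc k * |c - a * sin θ * om| ≤ k * (3 * (b / r)) := by
          gcongr
          linarith
      _ = _ := by ring
  rw [hF]
  refine (norm_add_le _ _).trans (add_le_add ?_ ?_)
  · rw [norm_mul, Complex.norm_real, norm_eq_abs]
    gcongr
  · rw [norm_mul, norm_mul, Complex.norm_real, Complex.norm_I, mul_one, norm_eq_abs]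
    gcongr

/-- The pointwise form of the Poincaré inequality on the sphere, up to a density with vanishing
integral and an error of size `|a|`. -/
theorem coercivity (h : Exterior M a Q r) {k : ℝ} (hk : 0 ≤ k) (hk2 : k ≤ 2) (θ : ℝ)
    (x X f F n g : ℂ) (hn : n = X + frameDefect a r θ k f F) (hg : g = timeDeriv M a Q r θ k f F) :
    gradWeight M a Q r θ * ‖x + Complex.I * X‖ ^ 2 + k * sig M a Q r θ * ‖f‖ ^ 2 / r ^ 2
      - (deriv (gradWeight M a Q r) θ * (f * conj X).im
          + gradWeight M a Q r θ * (2 * (x * conj X).im + k * ‖f‖ ^ 2))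
      - coercConst M * |a| * sig M a Q r θ *
        ((‖x‖ ^ 2 + ‖n‖ ^ 2) / absq a r θ ^ 2 + ‖g‖ ^ 2 / r ^ 2 + ‖f‖ ^ 2 / r ^ 2)
      ≤ sig M a Q r θ * ((‖x‖ ^ 2 + ‖n‖ ^ 2) / absq a r θ ^ 2) := by
  have hr := h.radius_pos
  have hN := h.absq_pos θ
  have hM := h.pos
  have hMr := h.mass_le
  have hN2 := h.le_absq_sq θ
  have hNr := le_absq (a := a) (r := r) θ
  have hN3 := h.absq_le θ
  have hS := h.sig_pos θ
  have hS2 := h.le_sig θ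
  have hw' := h.abs_deriv_gradWeight_le θ
  have he := h.norm_frameDefect_le hk θ f F
  rw [← hg] at he
  have hb0 : 0 ≤ |a| := abs_nonneg a
  have hbM := h.abs_le_mass
  have hbr := h.abs_le_radius
  have hab : a ^ 2 = |a| ^ 2 := (sq_abs a).symm
  have hNa : absq a r θ ^ 2 = r ^ 2 + a ^ 2 * cos θ ^ 2 := absq_sq a r θ
  set e := frameDefect a r θ k f F with hedef
  set b := |a| with hb
  set N := absq a r θ with hNdef
  set S := sig M a Q r θ with hSdef
  set w' := deriv (gradWeight M a Q r) θ
  have hw : gradWeight M a Q r θ = S / N ^ 2 := rfl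
  rw [hw]
  -- the quantities rescaled by powers of `r`
  set y := ‖n‖ / N with hy
  set z := ‖g‖ / r + 6 / M * (‖f‖ / r) with hz
  set p := ‖f‖ / r with hp
  set t := ‖g‖ / r with ht
  have hy0 : 0 ≤ y := by positivity
  have hp0 : 0 ≤ p := by positivity
  have ht0 : 0 ≤ t := by positivity
  have hz0 : 0 ≤ z := by positivity
  -- The coefficient `6 / M` in `z` comes from `3 k ≤ 6` and `1 / r ≤ 1 / M`.
  have hη : ‖e‖ / N ≤ b * z := by
    have h1 : ‖e‖ / N ≤ ‖e‖ / r := by gcongr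
    have h2 : ‖e‖ / r ≤ (b * ‖g‖ + 3 * k * (b / r) * ‖f‖) / r := by gcongr
    have h3 : 3 * k * (b / r) * ‖f‖ ≤ 6 * (b / M) * ‖f‖ := by
      gcongr
      linarith
    refine h1.trans (h2.trans ?_)
    rw [div_le_iff₀ hr]
    have : b * z * r = b * ‖g‖ + 6 * (b / M) * ‖f‖ := by
      rw [hz, ht, hp]; field_simp
    rw [this]
    linarith
  set η := ‖e‖ / N with hηdef
  have hη0 : 0 ≤ η := by positivity
  have en : ‖n‖ = y * N := by rw [hy]; field_simp
  have ee : ‖e‖ = η * N := by rw [hηdef]; field_simp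
  have ef : ‖f‖ = p * r := by rw [hp]; field_simp
  -- the exact expansion
  have hX : X = n - e := by rw [hn]; ring
  have hexp : ‖x + Complex.I * X‖ ^ 2 = ‖x‖ ^ 2 + ‖X‖ ^ 2 + 2 * (x * conj X).im := by
    simp only [← Complex.normSq_eq_norm_sq, Complex.normSq_apply]
    simp
    ring
  have hXn : ‖X‖ ^ 2 = ‖n‖ ^ 2 - 2 * (n * conj e).re + ‖e‖ ^ 2 := by
    rw [hX]
    simp only [← Complex.normSq_eq_norm_sq, Complex.normSq_apply]
    simp
    ring
  have hre : -(y * N * (η * N)) ≤ (n * conj e).re := by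
    have h1 := (abs_le.1 (Complex.abs_re_le_norm (n * conj e))).1
    rw [norm_mul, RCLike.norm_conj, en, ee] at h1
    exact h1
  have him : -(5 * b ^ 2 / r ^ 2 * (p * r * (y * N + η * N))) ≤ w' * (f * conj X).im := by
    have h1 : |w' * (f * conj X).im| ≤ 5 * a ^ 2 / r ^ 2 * (p * r * (y * N + η * N)) := by
      rw [abs_mul]
      have h2 : |(f * conj X).im| ≤ p * r * (y * N + η * N) := by
        refine (Complex.abs_im_le_norm _).trans ?_
        rw [norm_mul, RCLike.norm_conj, ← ef, ← en, ← ee, hX]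
        gcongr
        exact norm_sub_le _ _
      gcongr
    rw [hab] at h1
    exact (abs_le.1 h1).1
  -- The cross term `Im(x X̄)` is kept exact: it is part of the density of zero integral. Only the
  -- terms containing the defect `e` are estimated.
  have hkey : S / N ^ 2 * (‖x‖ ^ 2 + ‖n‖ ^ 2) = S / N ^ 2 * ‖x + Complex.I * X‖ ^ 2
      - S / N ^ 2 * (2 * (x * conj X).im) + S / N ^ 2 * (2 * (n * conj e).re) - S * η ^ 2 := by
    rw [hexp, hXn, ee]; field_simp; ring
  have b1 : -(2 * b * S * (y * z)) ≤ S / N ^ 2 * (2 * (n * conj e).re) := by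
    have h1 : S / N ^ 2 * (2 * -(y * N * (η * N))) ≤ S / N ^ 2 * (2 * (n * conj e).re) := by
      gcongr
    have h2 : S / N ^ 2 * (2 * -(y * N * (η * N))) = -(2 * S * y * η) := by
      field_simp
    have h3 : 2 * S * y * η ≤ 2 * S * y * (b * z) := by gcongr
    linarith
  have b2 : S * η ^ 2 ≤ b * S * (M * z ^ 2) := by
    calc S * η ^ 2 ≤ S * (b * z) ^ 2 := by gcongr
      _ = b * S * (b * z ^ 2) := by ring
      _ ≤ _ := by gcongr
  -- The density carries `k ‖f‖² / |q|²` whereas the claim has `k ‖f‖² / r²`. The discrepancy is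
  -- governed by `|q|² - r² ≤ a²`.
  have b3 : k * S * ‖f‖ ^ 2 / r ^ 2 - S / N ^ 2 * (k * ‖f‖ ^ 2) ≤ b * S * (2 / M * p ^ 2) := by
    have h1 : k * S * ‖f‖ ^ 2 / r ^ 2 - S / N ^ 2 * (k * ‖f‖ ^ 2)
        = k * S * p ^ 2 * ((N ^ 2 - r ^ 2) / N ^ 2) := by
      rw [ef]; field_simp
    have h2 : (N ^ 2 - r ^ 2) / N ^ 2 ≤ b / M := by
      rw [div_le_div_iff₀ (by positivity) hM]
      have h3 : N ^ 2 - r ^ 2 ≤ b ^ 2 := by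
        rw [hNa, hab]; linarith [mul_le_of_le_one_right (sq_nonneg b) (cos_sq_le_one θ)]
      calc (N ^ 2 - r ^ 2) * M ≤ b ^ 2 * M := by gcongr
        _ = b * (b * M) := by ring
        _ ≤ b * (r * r) := by gcongr
        _ ≤ b * N ^ 2 := by rw [← sq]; gcongr
    rw [h1]
    calc k * S * p ^ 2 * ((N ^ 2 - r ^ 2) / N ^ 2) ≤ 2 * S * p ^ 2 * (b / M) := by gcongr
      _ = _ := by ring
  have b4 : 5 * b ^ 2 / r ^ 2 * (p * r * (y * N + η * N))
      ≤ b * S * (10 / M * (p * y) + 10 * (p * z)) := by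
    have h1 : y * N + η * N ≤ (y + b * z) * (2 * r) := by
      rw [← add_mul]; gcongr
    calc 5 * b ^ 2 / r ^ 2 * (p * r * (y * N + η * N))
        ≤ 5 * b ^ 2 / r ^ 2 * (p * r * ((y + b * z) * (2 * r))) := by gcongr
      _ = b * (b * 10 * (p * y) + b * b * 10 * (p * z)) := by field_simp; ring
      _ ≤ b * (S * (1 / M) * 10 * (p * y) + S * 10 * (p * z)) := by
        have h2 : b ≤ S * (1 / M) := by
          rw [mul_one_div, le_div_iff₀ hM]
          exact ((mul_le_mul hbr hMr hM.le hr.le).trans_eq (sq r).symm).trans hS2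
        have h3 : b * b ≤ S :=
          ((mul_le_mul hbr hbr hb0 hr.le).trans_eq (sq r).symm).trans hS2
        gcongr
      _ = _ := by ring
  have hquad := coercConst_quadratic (y := y) hM hz
  have hY : y ^ 2 + t ^ 2 + p ^ 2
      ≤ (‖x‖ ^ 2 + ‖n‖ ^ 2) / N ^ 2 + ‖g‖ ^ 2 / r ^ 2 + ‖f‖ ^ 2 / r ^ 2 := by
    have h1 : y ^ 2 ≤ (‖x‖ ^ 2 + ‖n‖ ^ 2) / N ^ 2 := by
      rw [hy, div_pow]
      gcongr
      exact le_add_of_nonneg_left (sq_nonneg _)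
    rw [ht, hp, div_pow ‖g‖, div_pow ‖f‖]
    linarith
  have hfin := mul_le_mul_of_nonneg_left (hquad.trans (mul_le_mul_of_nonneg_left hY
    (coercConst_pos hM).le)) (by positivity : 0 ≤ b * S)
  have hdiv : S * ((‖x‖ ^ 2 + ‖n‖ ^ 2) / N ^ 2) = S / N ^ 2 * (‖x‖ ^ 2 + ‖n‖ ^ 2) := by ring
  have hl : b * S * (2 * (y * z) + M * z ^ 2 + 2 / M * p ^ 2 + (10 / M * (p * y) + 10 * (p * z)))
      = 2 * b * S * (y * z) + b * S * (M * z ^ 2) + b * S * (2 / M * p ^ 2)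
        + b * S * (10 / M * (p * y) + 10 * (p * z)) := by ring
  have hr' (Y : ℝ) : b * S * (coercConst M * Y) = coercConst M * b * S * Y := by ring
  have hs' : S / N ^ 2 * (2 * (x * conj X).im + k * ‖f‖ ^ 2)
      = S / N ^ 2 * (2 * (x * conj X).im) + S / N ^ 2 * (k * ‖f‖ ^ 2) := by ring
  rw [hl, hr'] at hfin
  rw [hdiv, hkey, hs']
  linarith

end Exterior

end

/-! ### Pointwise estimates of the coupling term. -/

section

open ComplexConjugate

/-- The constant multiplying `|a|` in the absorption of the time derivative. -/
def absorbConst (M p : ℝ) : ℝ := 32 * (M ^ 2 + M ^ 3) / p ^ 2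

/-- When `b = 0` this is Young's inequality, with a perfect square to spare. The perturbation `b H
B` is absorbed by that square and by terms in `A²` and `B²`, so the coefficient of `H²` stays exact.
-/
theorem young_with_slack {M y ε p b A B H : ℝ} (hM : 0 < M) (hy0 : 0 ≤ y) (hy : y ≤ M ^ 2)
    (hε0 : 0 < ε) (hε : ε ≤ 1) (hp0 : 0 < p) (hp : p ≤ 1) (hb0 : 0 ≤ b) (hb : b ≤ M) :
    32 * p * y * H * A + 32 * y * b * H * B
      ≤ 16 * y * ε * A ^ 2 + absorbConst M p * b * (A ^ 2 / 2 + B ^ 2)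
        + 16 * p ^ 2 * y * H ^ 2 / ε := by
  -- The unused square is `16 y D² / ε`. Substituting `H = (ε A - D) / p` turns `b H B` into `b A
  -- B`, an admissible error, and `b D B`, absorbed by the square at the price of `b² B² ≤ M b B²`.
  set D := ε * A - p * H with hD
  have e1 : 16 * y * ε * A ^ 2 + 16 * p ^ 2 * y * H ^ 2 / ε - 32 * p * y * H * A
      = 16 * y / ε * D ^ 2 := by
    rw [hD]; field_simp; ring
  have e2 : 32 * y * b * H * B = 32 * y * b / p * (ε * (A * B)) - 32 * y * b / p * (D * B) := by
    rw [hD]; field_simp; ring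
  have e3 : 32 * y * b / p * (ε * (A * B)) ≤ 32 * M ^ 2 / p ^ 2 * b * (A ^ 2 / 2 + B ^ 2 / 2) := by
    have h1 : ε * (A * B) ≤ A ^ 2 / 2 + B ^ 2 / 2 := by
      have h2 : ε * (A * B) ≤ ε * (A ^ 2 / 2 + B ^ 2 / 2) := by
        gcongr; nlinarith [sq_nonneg (A - B)]
      have h3 : ε * (A ^ 2 / 2 + B ^ 2 / 2) ≤ 1 * (A ^ 2 / 2 + B ^ 2 / 2) := by gcongr
      linarith
    calc 32 * y * b / p * (ε * (A * B)) ≤ 32 * y * b / p * (A ^ 2 / 2 + B ^ 2 / 2) := by gcongr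
      _ ≤ 32 * M ^ 2 * b / p ^ 2 * (A ^ 2 / 2 + B ^ 2 / 2) := by
        have : p ^ 2 ≤ p := by nlinarith
        gcongr
      _ = _ := by ring
  have e4 : -(32 * y * b / p * (D * B)) ≤ 16 * y / ε * D ^ 2 + 16 * M ^ 3 / p ^ 2 * b * B ^ 2 := by
    have h1 : 0 ≤ 16 * y / ε * (D + ε * b / p * B) ^ 2 := by positivity
    have h2 : 16 * y / ε * (D + ε * b / p * B) ^ 2
        = 16 * y / ε * D ^ 2 + 32 * y * b / p * (D * B)
            + 16 * (y * (ε * (b * b))) / p ^ 2 * B ^ 2 := by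
      field_simp; ring
    have h3 : y * (ε * (b * b)) ≤ M ^ 2 * (1 * (M * b)) := by gcongr
    have h4 : 16 * (y * (ε * (b * b))) / p ^ 2 * B ^ 2
        ≤ 16 * (M ^ 2 * (1 * (M * b))) / p ^ 2 * B ^ 2 := by
      gcongr
    have h5 : 16 * (M ^ 2 * (1 * (M * b))) / p ^ 2 * B ^ 2
        = 16 * M ^ 3 / p ^ 2 * b * B ^ 2 := by ring
    linarith
  have e5 : 0 ≤ 32 * M ^ 2 / p ^ 2 * b * (B ^ 2 / 2) + 16 * M ^ 3 / p ^ 2 * b * A ^ 2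
      + 16 * M ^ 3 / p ^ 2 * b * B ^ 2 := by positivity
  have e6 : absorbConst M p * b * (A ^ 2 / 2 + B ^ 2)
      = 32 * M ^ 2 / p ^ 2 * b * (A ^ 2 / 2 + B ^ 2 / 2) + 16 * M ^ 3 / p ^ 2 * b * B ^ 2
        + (32 * M ^ 2 / p ^ 2 * b * (B ^ 2 / 2) + 16 * M ^ 3 / p ^ 2 * b * A ^ 2
          + 16 * M ^ 3 / p ^ 2 * b * B ^ 2) := by
    unfold absorbConst; ring
  linarith

/-- The coefficient of `v |ψ|²` in `A₁` and `A₂`, up to numerical factors. -/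
def zeroOrder (M a Q r θ : ℝ) : ℝ :=
  Q ^ 2 * r ^ 6 / (absq a r θ ^ 10 * (r ^ 2 + a ^ 2)) * gfac M a Q r θ ^ 2

namespace Exterior

variable {M a Q r : ℝ}

theorem abs_cfac (h : Exterior M a Q r) (θ : ℝ) : |cfac M a Q r θ|
    = 8 * Q ^ 2 / (absq a r θ ^ 5 * (r ^ 2 + a ^ 2) ^ 2) * (r ^ 3 * |gfac M a Q r θ|) := by
  have hr := h.radius_pos
  have hN := h.absq_pos θ
  rw [cfac, abs_mul, abs_mul, abs_of_pos (pow_pos hr 3), abs_of_nonneg (by positivity)]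

/-- The part of the coupling estimated through `|∇ψ₂|`, with the time derivative absorbed. -/
theorem coupling_absorb (h : Exterior M a Q r) {p ε v f P g R θ : ℝ} (hp0 : 0 < p) (hp : p ≤ 1)
    (hε0 : 0 < ε) (hε : ε ≤ 1) (hv : 0 ≤ v) (hf : 0 ≤ f) (hP : 0 ≤ P) (hg : 0 ≤ g)
    (hR : |R| ≤ 4 * f * √(2 * P)) :
    4 * (|v * trap M a Q r| * |cfac M a Q r θ|) * |a| * f * g / absq a r θ
      ≤ 32 * Q ^ 2 * ε * (v * trap M a Q r * trap M a Q r / (r ^ 2 + a ^ 2) ^ 3) * P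
        + absorbConst M p * |a| * (v * trap M a Q r * trap M a Q r / (r ^ 2 + a ^ 2) ^ 3)
          * (P + g ^ 2 / r ^ 2)
        + 2 * (8 * p ^ 2 / ε * v * zeroOrder M a Q r θ) * f ^ 2
        + p * (v * trap M a Q r) * cfac M a Q r θ * R := by
  have hr := h.radius_pos
  have hN := h.absq_pos θ
  have hNr := le_absq (a := a) (r := r) θ
  have hρ : 0 < r ^ 2 + a ^ 2 := by positivity
  set T := trap M a Q r with hT
  set X := √(2 * P) with hX
  have hX0 : 0 ≤ X := sqrt_nonneg _
  have hPX : P = X ^ 2 / 2 := by rw [hX, sq_sqrt (by positivity)]; ring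
  have hB := h.abs_cfac θ
  have hz : zeroOrder M a Q r θ
    = Q ^ 2 * r ^ 6 / (absq a r θ ^ 10 * (r ^ 2 + a ^ 2)) * |gfac M a Q r θ| ^ 2 := by
    rw [sq_abs]; rfl
  have e1 : -(p * (|v * T| * |cfac M a Q r θ|) * (4 * f * X))
      ≤ p * (v * T) * cfac M a Q r θ * R := by
    have h1 : |p * (v * T) * cfac M a Q r θ * R|
        ≤ p * (|v * T| * |cfac M a Q r θ|) * (4 * f * X) := by
      rw [abs_mul, abs_mul, abs_mul, abs_of_pos hp0, mul_assoc p]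
      gcongr
    exact (abs_le.1 h1).1
  have hgN : g / absq a r θ ≤ g / r := by gcongr
  -- Both `A` and `B` carry the factor `|𝒯|`, so their squares have the weight `v 𝒯²` of `ℰ₁`. `H`
  -- carries no `𝒯`, and its square gives the zero-order term of `A₁`.
  have hy := young_with_slack (M := M) (y := Q ^ 2) (ε := ε) (p := p) (b := |a|) (A := |T| * X)
    (B := |T| * (g / r)) (H := (r ^ 2 + a ^ 2) * (r ^ 3 * |gfac M a Q r θ|) * f / absq a r θ ^ 5)
    h.pos (sq_nonneg Q) h.charge_sq_le hε0 hε hp0 hp (abs_nonneg a) h.abs_le_mass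
  have hy' := mul_le_mul_of_nonneg_left hy (by positivity : 0 ≤ v / (r ^ 2 + a ^ 2) ^ 3)
  have e2 : 4 * (|v * T| * |cfac M a Q r θ|) * |a| * f * g / absq a r θ
      ≤ 4 * (|v * T| * |cfac M a Q r θ|) * |a| * f * (g / r) := by
    rw [mul_div_assoc]; gcongr
  refine e2.trans ?_
  have hTT : T * T = |T| ^ 2 := by rw [sq_abs, sq]
  have e3 : v * T * T / (r ^ 2 + a ^ 2) ^ 3 = v * |T| ^ 2 / (r ^ 2 + a ^ 2) ^ 3 := by
    rw [mul_assoc, hTT]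
  have e4 : |v * T| = v * |T| := by rw [abs_mul, abs_of_nonneg hv]
  rw [e3]
  rw [e4] at e1 ⊢
  rw [hB] at e1 ⊢
  rw [hz, hPX]
  generalize |gfac M a Q r θ| = G at *
  generalize |T| = τ at *
  generalize absq a r θ = N at *
  generalize r ^ 2 + a ^ 2 = ρ at *
  have l1 : v / ρ ^ 3 * (32 * p * Q ^ 2 * (ρ * (r ^ 3 * G) * f / N ^ 5) * (τ * X)
      + 32 * Q ^ 2 * |a| * (ρ * (r ^ 3 * G) * f / N ^ 5) * (τ * (g / r)))
      = p * (v * τ * (8 * Q ^ 2 / (N ^ 5 * ρ ^ 2) * (r ^ 3 * G))) * (4 * f * X)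
        + 4 * (v * τ * (8 * Q ^ 2 / (N ^ 5 * ρ ^ 2) * (r ^ 3 * G))) * |a| * f * (g / r) := by
    field_simp
    ring
  have l2 : v / ρ ^ 3 * (16 * Q ^ 2 * ε * (τ * X) ^ 2
      + absorbConst M p * |a| * ((τ * X) ^ 2 / 2 + (τ * (g / r)) ^ 2)
      + 16 * p ^ 2 * Q ^ 2 * (ρ * (r ^ 3 * G) * f / N ^ 5) ^ 2 / ε)
      = 32 * Q ^ 2 * ε * (v * τ ^ 2 / ρ ^ 3) * (X ^ 2 / 2)
        + absorbConst M p * |a| * (v * τ ^ 2 / ρ ^ 3) * (X ^ 2 / 2 + g ^ 2 / r ^ 2)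
        + 2 * (8 * p ^ 2 / ε * v * (Q ^ 2 * r ^ 6 / (N ^ 10 * ρ) * G ^ 2)) * f ^ 2 := by
    field_simp
    ring
  rw [l1, l2] at hy'
  linarith

/-- The part of the coupling estimated, after an integration by parts, through `|∇ψ₁|`. -/
theorem coupling_transposed (h : Exterior M a Q r) {p δ v s z θ : ℝ} (hδ : δ < 1) (hv : 0 ≤ v) :
    p * (|v * trap M a Q r| * |couplingWeight M a Q r θ|) * (s * z)
      ≤ 2 * (1 - δ) * (v * trap M a Q r * trap M a Q r / (r ^ 2 + a ^ 2) ^ 3)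
          * (gradWeight M a Q r θ * z ^ 2)
        + 32 * Q ^ 2 * (4 * p ^ 2 / (1 - δ) * v * zeroOrder M a Q r θ) * sig M a Q r θ * s ^ 2 := by
  have hr := h.radius_pos
  have hN := h.absq_pos θ
  have hρ : 0 < r ^ 2 + a ^ 2 := by positivity
  have hS := h.sig_pos θ
  have hδ' : 0 < 1 - δ := by linarith
  have hW : |couplingWeight M a Q r θ| = 4 * sig M a Q r θ * |cfac M a Q r θ| / absq a r θ := by
    rw [couplingWeight, abs_div, abs_mul, abs_of_pos hN, abs_of_pos (by positivity)]
  have hg : gradWeight M a Q r θ = sig M a Q r θ / absq a r θ ^ 2 := rfl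
  have hz : zeroOrder M a Q r θ
    = Q ^ 2 * r ^ 6 / (absq a r θ ^ 10 * (r ^ 2 + a ^ 2)) * |gfac M a Q r θ| ^ 2 := by
    rw [sq_abs]; rfl
  have hT : v * trap M a Q r * trap M a Q r = v * |trap M a Q r| ^ 2 := by rw [sq_abs]; ring
  rw [hW, h.abs_cfac, hz, hg, hT, abs_mul, abs_of_nonneg hv]
  generalize |gfac M a Q r θ| = G at *
  generalize |trap M a Q r| = τ at *
  generalize absq a r θ = N at *
  generalize r ^ 2 + a ^ 2 = ρ at *
  generalize sig M a Q r θ = S at *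
  -- The square is weighted so that its expansion gives exactly the available gradient term, the
  -- zero-order term of `A₂`, and the coupling.
  have key : 0 ≤ v * S / ρ ^ 3 * (2 / (1 - δ))
      * ((1 - δ) * (τ * z / N) - 8 * p * Q ^ 2 * (ρ * (r ^ 3 * G) * s / N ^ 5)) ^ 2 := by positivity
  have e : v * S / ρ ^ 3 * (2 / (1 - δ))
      * ((1 - δ) * (τ * z / N) - 8 * p * Q ^ 2 * (ρ * (r ^ 3 * G) * s / N ^ 5)) ^ 2
      = 2 * (1 - δ) * (v * τ ^ 2 / ρ ^ 3) * (S / N ^ 2 * z ^ 2)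
        + 32 * Q ^ 2 * (4 * p ^ 2 / (1 - δ) * v * (Q ^ 2 * r ^ 6 /
            (N ^ 10 * ρ) * G ^ 2)) * S * s ^ 2
        - p * (v * τ * (4 * S * (8 * Q ^ 2 / (N ^ 5 * ρ ^ 2) * (r ^ 3 * G)) / N)) * (s * z) := by
    field_simp
    ring
  linarith

/-- The factor of the coupling term is real up to an error of size `|a|`. -/
theorem coupling_factor (h : Exterior M a Q r) (θ u : ℝ) (K : ℂ) :
    u * cfac M a Q r θ * K.re - 256 * M ^ 2 * |a| * (|u| / r ^ 6 * (|K.re| + |K.im|))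
      ≤ 8 * Q ^ 2 / (absq a r θ ^ 5 * (r ^ 2 + a ^ 2) ^ 2) *
        ((u : ℂ) * q a r θ ^ 3 * (((trap M a Q r / (r ^ 2 + a ^ 2) : ℝ) : ℂ)
          + (Delta M a Q r : ℂ) * ((r : ℂ) + 3 * Complex.I * ((a * cos θ : ℝ) : ℂ))
            / ((2 * absq a r θ ^ 2 : ℝ) : ℂ)) * K).re := by
  have hr := h.radius_pos
  have hN := h.absq_pos θ
  have hNr := le_absq (a := a) (r := r) θ
  have hρ : 0 < r ^ 2 + a ^ 2 := by positivity
  set t := a * cos θ with ht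
  set d := Delta M a Q r / (2 * absq a r θ ^ 2) with hd
  set G := gfac M a Q r θ with hG
  set b := |a| with hb
  have hb0 : 0 ≤ b := abs_nonneg a
  have hbr : b ≤ r := h.abs_le_radius
  have htb : |t| ≤ b := by
    rw [ht, abs_mul]; exact mul_le_of_le_one_right hb0 (abs_cos_le_one θ)
  have ht2 : t ^ 2 ≤ b * r := by
    rw [← sq_abs t, sq]; exact mul_le_mul htb (htb.trans hbr) (abs_nonneg t) hb0
  have ht2r : t ^ 2 ≤ r ^ 2 := ht2.trans (by rw [sq]; gcongr)
  have hd0 : 0 ≤ d := by have := h.delta_nonneg; positivity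
  have hd1 : d ≤ 1 / 2 := by
    rw [hd, div_le_iff₀ (by positivity)]
    linarith [h.delta_le, h.le_absq_sq θ]
  have hG9 : |G| ≤ 9 * r := h.abs_gfac_le θ
  have hGd : G = trap M a Q r / (r ^ 2 + a ^ 2) + d * r := by
    rw [hG, gfac, hd]; ring
  -- Separating real and imaginary parts in powers of `t = a cos θ`: the real part is `r³ G` plus
  -- multiples of `t²`, and the imaginary part is a multiple of `t`. Both deviations are therefore
  -- `O(|a| r³)`.
  have hz : q a r θ ^ 3 * (((trap M a Q r / (r ^ 2 + a ^ 2) : ℝ) : ℂ)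
          + (Delta M a Q r : ℂ) * ((r : ℂ) + 3 * Complex.I * ((t : ℝ) : ℂ))
            / ((2 * absq a r θ ^ 2 : ℝ) : ℂ))
      = ((r ^ 3 * G + (-(3 * r * t ^ 2) * G - 3 * d * t ^ 2 * (3 * r ^ 2 - t ^ 2)) : ℝ) : ℂ)
        + ((t * (3 * r ^ 2 - t ^ 2) * G + (r ^ 3 - 3 * r * t ^ 2) * (3 * d * t) : ℝ) : ℂ)
          * Complex.I := by
    have h1 : (Delta M a Q r : ℂ) * ((r : ℂ) + 3 * Complex.I * (t : ℂ))
        / ((2 * absq a r θ ^ 2 : ℝ) : ℂ) = (d : ℂ) * ((r : ℂ) + 3 * Complex.I * (t : ℂ)) := by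
      rw [hd]; push_cast; ring
    rw [h1, hGd, q, ← ht]
    have hI3 : Complex.I ^ 3 = -Complex.I := by rw [pow_succ, Complex.I_sq]; ring
    have hI4 : Complex.I ^ 4 = 1 := Complex.I_pow_four
    push_cast
    ring_nf
    simp only [hI3, hI4, Complex.I_sq]
    ring
  set d1 := -(3 * r * t ^ 2) * G - 3 * d * t ^ 2 * (3 * r ^ 2 - t ^ 2) with hd1def
  set d2 := t * (3 * r ^ 2 - t ^ 2) * G + (r ^ 3 - 3 * r * t ^ 2) * (3 * d * t) with hd2def
  have h3 : |3 * r ^ 2 - t ^ 2| ≤ 3 * r ^ 2 := by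
    rw [abs_of_nonneg (by linarith [sq_nonneg r])]; linarith [sq_nonneg t]
  have b1 : |d1| ≤ 32 * r ^ 3 * b := by
    have e1 : |-(3 * r * t ^ 2) * G| ≤ 3 * r * (b * r) * (9 * r) := by
      rw [abs_mul, abs_neg, abs_of_nonneg (by positivity : 0 ≤ 3 * r * t ^ 2)]
      gcongr
    have e2 : |3 * d * t ^ 2 * (3 * r ^ 2 - t ^ 2)| ≤ 3 * (1 / 2) * (b * r) * (3 * r ^ 2) := by
      rw [abs_mul, abs_of_nonneg (by positivity : 0 ≤ 3 * d * t ^ 2)]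
      gcongr
    refine (abs_sub _ _).trans ((add_le_add e1 e2).trans ?_)
    have : 0 ≤ r ^ 3 * b := by positivity
    nlinarith
  have b2 : |d2| ≤ 32 * r ^ 3 * b := by
    have e1 : |t * (3 * r ^ 2 - t ^ 2) * G| ≤ b * (3 * r ^ 2) * (9 * r) := by
      rw [abs_mul, abs_mul]
      gcongr
    have e2 : |(r ^ 3 - 3 * r * t ^ 2) * (3 * d * t)| ≤ 2 * r ^ 3 * (3 * (1 / 2) * b) := by
      rw [abs_mul, abs_mul (3 * d), abs_of_nonneg (by positivity : 0 ≤ 3 * d)]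
      have : |r ^ 3 - 3 * r * t ^ 2| ≤ 2 * r ^ 3 := by
        have h1 : r * t ^ 2 ≤ r * r ^ 2 := by gcongr
        have h2 : 0 ≤ r * t ^ 2 := by positivity
        rw [abs_le]; constructor <;> nlinarith [pow_pos hr 3]
      gcongr
    refine (abs_add_le _ _).trans ((add_le_add e1 e2).trans ?_)
    have : 0 ≤ r ^ 3 * b := by positivity
    nlinarith
  set m := 8 * Q ^ 2 / (absq a r θ ^ 5 * (r ^ 2 + a ^ 2) ^ 2) with hm
  have hm0 : 0 ≤ m := by positivity
  have hmr : m * (32 * r ^ 3 * b) ≤ 256 * M ^ 2 * b / r ^ 6 := by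
    have h1 : m ≤ 8 * M ^ 2 / (r ^ 5 * (r ^ 2) ^ 2) := by
      have := h.charge_sq_le
      rw [hm]
      gcongr
      exact le_add_of_nonneg_right (sq_nonneg a)
    calc m * (32 * r ^ 3 * b) ≤ 8 * M ^ 2 / (r ^ 5 * (r ^ 2) ^ 2) * (32 * r ^ 3 * b) := by gcongr
      _ = _ := by field_simp; ring
  have hre : ((u : ℂ) * q a r θ ^ 3 * (((trap M a Q r / (r ^ 2 + a ^ 2) : ℝ) : ℂ)
          + (Delta M a Q r : ℂ) * ((r : ℂ) + 3 * Complex.I * ((t : ℝ) : ℂ))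
            / ((2 * absq a r θ ^ 2 : ℝ) : ℂ)) * K).re
      = u * (r ^ 3 * G) * K.re + u * (d1 * K.re - d2 * K.im) := by
    rw [mul_assoc (u : ℂ), hz]
    simp [-Complex.ofReal_add, -Complex.ofReal_mul, -Complex.ofReal_pow]
    ring
  rw [hre]
  have hc : cfac M a Q r θ = m * (r ^ 3 * G) := rfl
  have e1 : |m * (u * (d1 * K.re - d2 * K.im))|
      ≤ 256 * M ^ 2 * b * (|u| / r ^ 6 * (|K.re| + |K.im|)) := by
    have h1 : |d1 * K.re - d2 * K.im| ≤ 32 * r ^ 3 * b * |K.re| + 32 * r ^ 3 * b * |K.im| := by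
      refine (abs_sub _ _).trans ?_
      rw [abs_mul, abs_mul]
      gcongr
    rw [abs_mul, abs_mul, abs_of_nonneg hm0]
    calc m * (|u| * |d1 * K.re - d2 * K.im|)
        ≤ m * (|u| * (32 * r ^ 3 * b * |K.re| + 32 * r ^ 3 * b * |K.im|)) := by gcongr
      _ = m * (32 * r ^ 3 * b) * (|u| * (|K.re| + |K.im|)) := by ring
      _ ≤ 256 * M ^ 2 * b / r ^ 6 * (|u| * (|K.re| + |K.im|)) := by gcongr
      _ = _ := by ring
  have e2 := (abs_le.1 e1).1
  rw [hc]
  have e3 : m * (u * (r ^ 3 * G) * K.re + u * (d1 * K.re - d2 * K.im))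
      = u * (m * (r ^ 3 * G)) * K.re + m * (u * (d1 * K.re - d2 * K.im)) := by ring
  linarith

end Exterior

end

/-! ### Assembly of the pointwise estimate. -/

section

open ComplexConjugate

/-- The constant of the main estimate. -/
def mainConst (M p : ℝ) : ℝ := coercConst M * (1 + 8 * M ^ 2) + absorbConst M p + 7520 * M ^ 2

theorem mainConst_pos {M p : ℝ} (hM : 0 < M) (hp : 0 < p) : 0 < mainConst M p := by
  have := coercConst_pos hM
  unfold mainConst absorbConst
  positivity

namespace Exterior

variable {M a Q r : ℝ}

/-- The lower order terms produced by the integration by parts of the coupling. -/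
theorem pairing_errors (h : Exterior M a Q r) {p u θ : ℝ} (hp0 : 0 ≤ p) (hp : p ≤ 1)
    (f s e : ℂ) {g : ℝ} (he : ‖e‖ ≤ |a| * g + 6 * (|a| / r) * ‖s‖) :
    |p * u * (deriv (couplingWeight M a Q r) θ * (f * conj s).re)|
      + |p * u * (couplingWeight M a Q r θ * (Complex.I * (f * conj e)).re)|
      ≤ 7264 * M ^ 2 * |a| * (|u| / r ^ 6 * (sig M a Q r θ * (‖f‖ * ‖s‖) / r))
        + |u| * |couplingWeight M a Q r θ| * (|a| * ‖f‖ * g) := by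
  have hr := h.radius_pos
  have hS := h.le_sig θ
  have hb0 := abs_nonneg a
  have hbr := h.abs_le_radius
  have hM := h.pos
  have h1 : |p * u * (deriv (couplingWeight M a Q r) θ * (f * conj s).re)|
      ≤ 3808 * M ^ 2 * |a| * (|u| / r ^ 6 * (sig M a Q r θ * (‖f‖ * ‖s‖) / r)) := by
    have e1 : |(f * conj s).re| ≤ ‖f‖ * ‖s‖ := by
      refine (Complex.abs_re_le_norm _).trans ?_
      rw [norm_mul, RCLike.norm_conj]
    -- The derivative of the weight is `O(a²)`; one factor `|a|` is traded for `r`.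
    have e2 : |deriv (couplingWeight M a Q r) θ| ≤ 3808 * M ^ 2 * (|a| * r) / r ^ 6 := by
      refine (h.abs_deriv_couplingWeight_le θ).trans ?_
      rw [← sq_abs a, sq |a|]
      have := h.charge_sq_le
      gcongr
    rw [abs_mul, abs_mul p, abs_mul (deriv _ _), abs_of_nonneg hp0]
    calc p * |u| * (|deriv (couplingWeight M a Q r) θ| * |(f * conj s).re|)
        ≤ 1 * |u| * (3808 * M ^ 2 * (|a| * r) / r ^ 6 * (‖f‖ * ‖s‖)) := by gcongr
      _ = 3808 * M ^ 2 * |a| * (|u| / r ^ 6 * (r ^ 2 * (‖f‖ * ‖s‖) / r)) := by field_simp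
      _ ≤ _ := by gcongr
  have h2 : |p * u * (couplingWeight M a Q r θ * (Complex.I * (f * conj e)).re)|
      ≤ 3456 * M ^ 2 * |a| * (|u| / r ^ 6 * (sig M a Q r θ * (‖f‖ * ‖s‖) / r))
        + |u| * |couplingWeight M a Q r θ| * (|a| * ‖f‖ * g) := by
    have e1 : |(Complex.I * (f * conj e)).re| ≤ ‖f‖ * (|a| * g + 6 * (|a| / r) * ‖s‖) := by
      refine (Complex.abs_re_le_norm _).trans ?_
      rw [norm_mul, norm_mul, RCLike.norm_conj, Complex.norm_I, one_mul]
      gcongr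
    have e2 : |couplingWeight M a Q r θ| ≤ 576 * M ^ 2 / r ^ 4 := by
      refine (h.abs_couplingWeight_le θ).trans ?_
      have := h.charge_sq_le
      gcongr
    rw [abs_mul, abs_mul p, abs_mul (couplingWeight _ _ _ _ _), abs_of_nonneg hp0]
    have e3 : |u| * (|couplingWeight M a Q r θ| * (‖f‖ * (6 * (|a| / r) * ‖s‖)))
        ≤ 3456 * M ^ 2 * |a| * (|u| / r ^ 6 * (sig M a Q r θ * (‖f‖ * ‖s‖) / r)) := by
      calc _ ≤ |u| * (576 * M ^ 2 / r ^ 4 * (‖f‖ * (6 * (|a| / r) * ‖s‖))) := by gcongr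
        _ = 3456 * M ^ 2 * |a| * (|u| / r ^ 6 * (r ^ 2 * (‖f‖ * ‖s‖) / r)) := by field_simp; ring
        _ ≤ _ := by gcongr
    calc p * |u| * (|couplingWeight M a Q r θ| * |(Complex.I * (f * conj e)).re|)
        ≤ 1 * |u| * (|couplingWeight M a Q r θ| * (‖f‖ * (|a| * g + 6 * (|a| / r) * ‖s‖))) := by
          gcongr
      _ = |u| * (|couplingWeight M a Q r θ| * (‖f‖ * (6 * (|a| / r) * ‖s‖)))
          + |u| * |couplingWeight M a Q r θ| * (|a| * ‖f‖ * g) := by ring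
      _ ≤ _ := by gcongr
  linarith

/-- The coupling term as a pairing density and a transposed coupling. -/
theorem coupling_by_parts (h : Exterior M a Q r) (θ : ℝ) (x X y Y f s n e : ℂ) (hn : n = Y + e) :
    sig M a Q r θ * cfac M a Q r θ * (4 * f * (conj (y / absq a r θ)
        + Complex.I * conj (n / absq a r θ))).re
      = (couplingWeight M a Q r θ * ((x + Complex.I * X) * conj s
          + f * (conj y + Complex.I * conj Y))
          + deriv (couplingWeight M a Q r) θ * (f * conj s)).re
        - couplingWeight M a Q r θ * ((x + Complex.I * X) * conj s).re
        - deriv (couplingWeight M a Q r) θ * (f * conj s).re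
        + couplingWeight M a Q r θ * (Complex.I * (f * conj e)).re := by
  have hN := (h.absq_pos θ).ne'
  have hN' : (absq a r θ : ℂ) ≠ 0 := by exact_mod_cast hN
  have hW : sig M a Q r θ * cfac M a Q r θ = couplingWeight M a Q r θ * absq a r θ / 4 := by
    rw [couplingWeight]; field_simp
  have e1 : 4 * f * (conj (y / absq a r θ) + Complex.I * conj (n / absq a r θ))
      = ((4 / absq a r θ : ℝ) : ℂ) * (f * (conj y + Complex.I * conj Y)
          + Complex.I * (f * conj e)) := by
    rw [hn]
    simp only [map_div₀, map_add, Complex.conj_ofReal]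
    push_cast
    field_simp
    ring
  rw [hW, e1, Complex.re_ofReal_mul, Complex.add_re, Complex.add_re, Complex.re_ofReal_mul,
    Complex.re_ofReal_mul, Complex.add_re]
  field_simp
  ring

theorem norm_coupling_le (h : Exterior M a Q r) (θ : ℝ) (y n f : ℂ) :
    ‖4 * f * (conj (y / absq a r θ) + Complex.I * conj (n / absq a r θ))‖
      ≤ 4 * ‖f‖ * √(2 * ((‖y‖ ^ 2 + ‖n‖ ^ 2) / absq a r θ ^ 2)) := by
  have hN := h.absq_pos θ
  rw [norm_mul, norm_mul]
  have h1 : ‖conj (y / absq a r θ) + Complex.I * conj (n / absq a r θ)‖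
      ≤ ‖y‖ / absq a r θ + ‖n‖ / absq a r θ := by
    refine (norm_add_le _ _).trans_eq ?_
    rw [norm_mul, Complex.norm_I, one_mul, RCLike.norm_conj, RCLike.norm_conj, norm_div, norm_div,
      Complex.norm_real, norm_of_nonneg hN.le]
  have h2 : ‖y‖ / absq a r θ + ‖n‖ / absq a r θ
      ≤ √(2 * ((‖y‖ ^ 2 + ‖n‖ ^ 2) / absq a r θ ^ 2)) := by
    refine le_sqrt_of_sq_le ?_
    rw [← add_div, div_pow, ← mul_div_assoc]
    gcongr
    nlinarith [sq_nonneg (‖y‖ - ‖n‖)]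
  have h4 : ‖(4 : ℂ)‖ = 4 := by norm_num
  rw [h4]
  gcongr
  exact h1.trans h2

/-- In `ℰ₁` the terms in `ψ₂` have no factor `Q²`, so `Q² ≤ M²` is used. The `8 M²` in the constant
is `32 M²` divided by the 4 in `|ψ₂|² = 4 ‖s‖²`. -/
theorem gradient_errors_le {M Q δ p c B C S b α P₁ P₂ g f k s : ℝ} (hS : 0 ≤ S) (hb : 0 ≤ b)
    (hα : 0 ≤ α) (hP₁ : 0 ≤ P₁) (hP₂ : 0 ≤ P₂) (hg : 0 ≤ g) (hf : 0 ≤ f) (hk : 0 ≤ k) (hs : 0 ≤ s)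
    (hδ0 : 0 ≤ δ) (hδ1 : δ ≤ 1) (hp0 : 0 ≤ p) (hp1 : p ≤ 1) (hQ : Q ^ 2 ≤ M ^ 2) (hc : 0 ≤ c)
    (hB : 0 ≤ B) (hC : c * (1 + 8 * M ^ 2) + B ≤ C) :
    2 * (1 - δ) * α * (c * b * S * (P₁ + g + f))
      + 32 * Q ^ 2 * (1 - δ) * (1 - p) * α * (c * b * S * (P₂ + k + s))
      + S * (B * b * α * (P₂ + k))
      ≤ S * (C * b * (α * (2 * P₁ + 2 * g + 2 * f + 4 * P₂ + 4 * k + 4 * s))) := by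
  have hcM : 0 ≤ c * (8 * M ^ 2) := by positivity
  have hδ : 0 ≤ 1 - δ := by linarith
  have hp : 0 ≤ 1 - p := by linarith
  have i1 : 2 * (1 - δ) * α * (c * b * S * (P₁ + g + f))
      ≤ 2 * 1 * α * (C * b * S * (P₁ + g + f)) := by
    have : c ≤ C := by linarith
    gcongr
    linarith
  have i2 : 32 * Q ^ 2 * (1 - δ) * (1 - p) * α * (c * b * S * (P₂ + k + s))
      ≤ 32 * M ^ 2 * 1 * 1 * α * (c * b * S * (P₂ + k + s)) := by
    gcongr <;> linarith
  have i3 : 0 ≤ S * B * b * α * (3 * (P₂ + k) + 4 * s) := by positivity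
  have i4 : (32 * M ^ 2 * c + 4 * B) * (b * α * S * (P₂ + k + s))
      ≤ 4 * C * (b * α * S * (P₂ + k + s)) := by
    gcongr
    linarith
  linear_combination i1 + i2 + i3 + i4

/-- The constant 7520 is `256 + 7264`: the error from making the coupling factor real plus the
lower-order errors of the integration by parts. -/
theorem coupling_errors_le {A C S b w l r f s : ℝ} (hS : 0 ≤ S) (hb : 0 ≤ b) (hw : 0 ≤ w)
    (hA : 0 ≤ A) (hl : 0 ≤ l) (hr : 0 < r) (hC : 7520 * A ≤ C) :
    S * (256 * A * b * (w * l)) + 7264 * A * b * (w * (S * (f * s) / r))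
      ≤ S * (C * b * (w * (l + 2 * f ^ 2 / r + 4 * s ^ 2 / r))) := by
  have hfs : f * s ≤ 2 * f ^ 2 + 4 * s ^ 2 := by
    nlinarith [sq_nonneg (f - s), sq_nonneg f, sq_nonneg s]
  have i1 : 7264 * A * b * (w * (S * (f * s) / r))
      ≤ 7264 * A * b * (w * (S * (2 * f ^ 2 + 4 * s ^ 2) / r)) := by gcongr
  have i2 : 7520 * A * (S * b * (w * (l + 2 * f ^ 2 / r + 4 * s ^ 2 / r)))
      ≤ C * (S * b * (w * (l + 2 * f ^ 2 / r + 4 * s ^ 2 / r))) := by gcongr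
  have i3 : 0 ≤ S * (A * b * (w * (7264 * l + 256 * (2 * f ^ 2 / r + 4 * s ^ 2 / r)))) := by
    positivity
  linear_combination i1 + i2 + i3

/-- The pointwise form of the main estimate, up to densities with vanishing integral. -/
theorem pointwise_estimate (h : Exterior M a Q r) {p₁ p₂ δ v θ : ℝ} (hp₁ : p₁ ∈ Ioc (0 : ℝ) 1)
    (hp₂ : p₂ ∈ Ioc (0 : ℝ) 1) (hδ : δ ∈ Ioo (0 : ℝ) 1) (hv : 0 ≤ v)
    (x X f F n g y Y s E m k : ℂ)
    (hn : n = X + frameDefect a r θ 1 f F) (hg : g = timeDeriv M a Q r θ 1 f F)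
    (hm : m = Y + frameDefect a r θ 2 s E) (hk : k = timeDeriv M a Q r θ 2 s E)
    (K : ℂ) (hK : K = 4 * f * (conj (y / absq a r θ) + Complex.I * conj (m / absq a r θ)))
    (u α P₁ P₂ Z : ℝ) (hu : u = v * trap M a Q r)
    (hα : α = u * trap M a Q r / (r ^ 2 + a ^ 2) ^ 3)
    (hP₁ : P₁ = (‖x‖ ^ 2 + ‖n‖ ^ 2) / absq a r θ ^ 2)
    (hP₂ : P₂ = (‖y‖ ^ 2 + ‖m‖ ^ 2) / absq a r θ ^ 2)
    (hZ : u * cfac M a Q r θ * K.re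
      - 256 * M ^ 2 * |a| * (|u| / r ^ 6 * (|K.re| + |K.im|)) ≤ Z) :
    -(2 * (1 - δ) * α) * (deriv (gradWeight M a Q r) θ * (f * conj X).im
          + gradWeight M a Q r θ * (2 * (x * conj X).im + 1 * ‖f‖ ^ 2))
      - 32 * Q ^ 2 * (1 - δ) * (1 - p₂) * α * (deriv (gradWeight M a Q r) θ * (s * conj Y).im
          + gradWeight M a Q r θ * (2 * (y * conj Y).im + 2 * ‖s‖ ^ 2))
      + (1 - p₁) * u * (couplingWeight M a Q r θ * ((x + Complex.I * X) * conj s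
          + f * (conj y + Complex.I * conj Y))
          + deriv (couplingWeight M a Q r) θ * (f * conj s)).re
      ≤ sig M a Q r θ * ((α * (2 * P₁ + 8 * Q ^ 2 * (4 * P₂)) + Z)
        - (δ * α * (2 * P₁ + 8 * Q ^ 2 * (4 * P₂))
          + ((1 - δ) * α * (1 / r ^ 2)
            - 8 * p₁ ^ 2 / ((1 - δ) * p₂) * v * zeroOrder M a Q r θ) * (2 * ‖f‖ ^ 2)
          + 8 * Q ^ 2 * ((1 - δ) * (2 * (1 - p₂) * α) * (1 / r ^ 2)
            - 4 * (1 - p₁) ^ 2 / (1 - δ) * v * zeroOrder M a Q r θ) * (4 * ‖s‖ ^ 2)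
          - mainConst M p₁ * |a| * (α * (2 * P₁ + 2 * ‖g‖ ^ 2 / r ^ 2 + 2 * ‖f‖ ^ 2 / r ^ 2
            + 4 * P₂ + 4 * ‖k‖ ^ 2 / r ^ 2 + 4 * ‖s‖ ^ 2 / r ^ 2))
          - mainConst M p₁ * |a| * (|u| / r ^ 6 * (|K.re| + |K.im| + 2 * ‖f‖ ^ 2 / r
            + 4 * ‖s‖ ^ 2 / r)))) := by
  obtain ⟨hp10, hp11⟩ := hp₁
  obtain ⟨hp20, hp21⟩ := hp₂
  obtain ⟨hδ0, hδ1⟩ := hδ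
  have hr := h.radius_pos
  have hM := h.pos
  have hN := h.absq_pos θ
  have hS := h.sig_pos θ
  have hb0 := abs_nonneg a
  have hδ' : 0 < 1 - δ := by linarith
  have hq' : 0 ≤ 1 - p₂ := by linarith
  have hα' : α = v * trap M a Q r * trap M a Q r / (r ^ 2 + a ^ 2) ^ 3 := by rw [hα, hu]
  have hα0 : 0 ≤ α := by
    have : v * trap M a Q r * trap M a Q r = v * trap M a Q r ^ 2 := by ring
    rw [hα', this]; positivity
  have hP₁0 : 0 ≤ P₁ := by rw [hP₁]; positivity
  have hP₂0 : 0 ≤ P₂ := by rw [hP₂]; positivity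
  have hc := coercConst_pos hM
  have hab : 0 ≤ absorbConst M p₁ := by unfold absorbConst; positivity
  -- The whole share `1 - δ` of `|∇ψ₁|²` is used here; the square it yields pays for the transposed
  -- coupling in `L5`.
  have L1 := mul_le_mul_of_nonneg_left (h.coercivity zero_le_one one_le_two θ x X f F n g hn hg)
    (by positivity : 0 ≤ 2 * (1 - δ) * α)
  -- Only the fraction `1 - p₂` of the available `|∇ψ₂|²` is spent here. The fraction `p₂` enters
  -- `L8` through `ε = (1 - δ) p₂`.
  have L2 := mul_le_mul_of_nonneg_left (h.coercivity zero_le_two le_rfl θ y Y s E m k hm hk)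
    (by positivity : 0 ≤ 32 * Q ^ 2 * (1 - δ) * (1 - p₂) * α)
  have L3 := mul_le_mul_of_nonneg_left hZ hS.le
  have L4 := h.coupling_by_parts θ x X y Y f s m _ hm
  rw [← hK] at L4
  have L5 := h.coupling_transposed (p := 1 - p₁) (v := v) (s := ‖s‖) (z := ‖x + Complex.I * X‖)
    (θ := θ) hδ1 hv
  have he := h.norm_frameDefect_le zero_le_two θ s E
  rw [← hk] at he
  norm_num at he
  have L6 := h.pairing_errors (p := 1 - p₁) (u := u) (θ := θ) (by linarith) (by linarith) f s _ he
  have hε1 : (1 - δ) * p₂ ≤ 1 := mul_le_one₀ (by linarith) hp20.le hp21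
  have hKn : |K.re| ≤ 4 * ‖f‖ * √(2 * P₂) := by
    refine (Complex.abs_re_le_norm _).trans ?_
    rw [hK, hP₂]
    exact h.norm_coupling_le θ y m f
  have L8 := mul_le_mul_of_nonneg_left (h.coupling_absorb (p := p₁) (ε := (1 - δ) * p₂)
      (θ := θ) hp10 hp11
    (by positivity) hε1 hv (norm_nonneg f) hP₂0 (norm_nonneg k) hKn) hS.le
  rw [← hα', ← hu] at L8
  rw [← hα', ← hu] at L5
  rw [← hP₁] at L1
  rw [← hP₂] at L2
  -- bookkeeping of the error terms
  have hW : sig M a Q r θ * (4 * (|u| * |cfac M a Q r θ|) * |a| * ‖f‖ * ‖k‖ / absq a r θ)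
      = |u| * |couplingWeight M a Q r θ| * (|a| * ‖f‖ * ‖k‖) := by
    have : |couplingWeight M a Q r θ| = 4 * sig M a Q r θ * |cfac M a Q r θ| / absq a r θ := by
      rw [couplingWeight, abs_div, abs_mul, abs_of_pos hN, abs_of_pos (by positivity)]
    rw [this]; ring
  rw [hW] at L8
  have hpair : -((1 - p₁) * (|u| * |couplingWeight M a Q r θ|) * (‖s‖ * ‖x + Complex.I * X‖))
      ≤ -((1 - p₁) * u * (couplingWeight M a Q r θ * ((x + Complex.I * X) * conj s).re)) := by
    have h1 : |(1 - p₁) * u * (couplingWeight M a Q r θ * ((x + Complex.I * X) * conj s).re)|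
        ≤ (1 - p₁) * (|u| * |couplingWeight M a Q r θ|) * (‖s‖ * ‖x + Complex.I * X‖) := by
      have h2 : |((x + Complex.I * X) * conj s).re| ≤ ‖s‖ * ‖x + Complex.I * X‖ := by
        refine (Complex.abs_re_le_norm _).trans_eq ?_
        rw [norm_mul, RCLike.norm_conj, mul_comm]
      rw [abs_mul, abs_mul, abs_mul, abs_of_nonneg (by linarith : 0 ≤ 1 - p₁)]
      calc (1 - p₁) * |u| * (|couplingWeight M a Q r θ| * |((x + Complex.I * X) * conj s).re|)
          ≤ (1 - p₁) * |u| * (|couplingWeight M a Q r θ| * (‖s‖ * ‖x + Complex.I * X‖)) := by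
            gcongr
        _ = _ := by ring
    linarith [(abs_le.1 h1).2]
  have hA := neg_abs_le ((1 - p₁) * u * (couplingWeight M a Q r θ
    * (Complex.I * (f * conj (frameDefect a r θ 2 s E))).re))
  have hB := le_abs_self ((1 - p₁) * u * (deriv (couplingWeight M a Q r) θ * (f * conj s).re))
  have hw0 : 0 ≤ gradWeight M a Q r θ := by unfold gradWeight; positivity
  -- The square obtained from `∇ψ₂` has nothing left to control and is discarded.
  have hdrop : 0 ≤ 32 * Q ^ 2 * (1 - δ) * (1 - p₂) * α
      * (gradWeight M a Q r θ * ‖y + Complex.I * Y‖ ^ 2) := by positivity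
  have hE1 := gradient_errors_le (g := ‖g‖ ^ 2 / r ^ 2) (f := ‖f‖ ^ 2 / r ^ 2)
      (k := ‖k‖ ^ 2 / r ^ 2)
    (s := ‖s‖ ^ 2 / r ^ 2) (p := p₂) (δ := δ) hS.le hb0 hα0 hP₁0 hP₂0 (by positivity)
        (by positivity)
    (by positivity) (by positivity) hδ0.le hδ1.le hp20.le hp21 h.charge_sq_le hc.le hab
    (by unfold mainConst; linarith [(by positivity : 0 ≤ 7520 * M ^ 2)] :
      coercConst M * (1 + 8 * M ^ 2) + absorbConst M p₁ ≤ mainConst M p₁)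
  have hE2 := coupling_errors_le (A := M ^ 2) (l := |K.re| + |K.im|) (w := |u| / r ^ 6) (r := r)
    (f := ‖f‖) (s := ‖s‖) hS.le hb0 (by positivity) (by positivity) (by positivity) hr
    (by unfold mainConst; linarith [(by positivity : 0 ≤ coercConst M * (1 + 8 * M ^ 2))] :
      7520 * M ^ 2 ≤ mainConst M p₁)
  clear hZ he hKn hK hn hm hg hk hP₁ hP₂ hα hα' hu hW
  generalize (couplingWeight M a Q r θ * ((x + Complex.I * X) * conj s
          + f * (conj y + Complex.I * conj Y))
          + deriv (couplingWeight M a Q r) θ * (f * conj s)).re = J₃ at *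
  generalize deriv (gradWeight M a Q r) θ * (f * conj X).im
          + gradWeight M a Q r θ * (2 * (x * conj X).im + 1 * ‖f‖ ^ 2) = J₁ at *
  generalize deriv (gradWeight M a Q r) θ * (s * conj Y).im
          + gradWeight M a Q r θ * (2 * (y * conj Y).im + 2 * ‖s‖ ^ 2) = J₂ at *
  generalize (f * conj s).re = t1 at *
  generalize (Complex.I * (f * conj (frameDefect a r θ 2 s E))).re = t2 at *
  generalize ((x + Complex.I * X) * conj s).re = t3 at *
  linear_combination L1 + L2 + L3 + L5 + L6 + L8 + hpair + hA + hB + hdrop + hE1 + hE2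
    - (1 - p₁) * u * L4
end Exterior

end

/-! ### Passage from the pointwise estimate to the integrals over spheres. -/

section

open ComplexConjugate

variable {M a Q : ℝ}

/-- The numerator of the derivative along `e₂` of a spin-weighted function, `τ` being its time
derivative. -/
def SpinFunction.horiz {k : ℝ} (a r : ℝ) (F : SpinFunction k) (τ : ℝ × ℝ → ℂ) (x : ℝ × ℝ) : ℂ :=
  F.azim x + frameDefect a r x.1 k (F.f x) (τ x)

/-- The covariant time derivative of a spin-weighted function. -/
def SpinFunction.time {k : ℝ} (M a Q r : ℝ) (F : SpinFunction k) (τ : ℝ × ℝ → ℂ) (x : ℝ × ℝ) : ℂ :=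
  timeDeriv M a Q r x.1 k (F.f x) (τ x)

/-- The squared norm of the horizontal gradient of a spin-weighted function. -/
def SpinFunction.gradSq {k : ℝ} (a r : ℝ) (F : SpinFunction k) (τ : ℝ × ℝ → ℂ) (x : ℝ × ℝ) : ℝ :=
  (‖F.pol x‖ ^ 2 + ‖F.horiz a r τ x‖ ^ 2) / absq a r x.1 ^ 2

theorem spinNabla_sph_eq (hM : 0 < M) {k : ℝ} {g : Pt → ℂ} {t r : ℝ} (hr : rPlus M a Q < r)
    (F : SpinFunction k) (hF : F.f = fun x => g (sph t r x)) {x : ℝ × ℝ} (hx : x.1 ∈ Ioo 0 π)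
    (hg : DifferentiableAt ℝ g (sph t r x)) :
    spinNabla M a Q k (frame a 0) g (sph t r x) = F.pol x / absq a r x.1 ∧
    spinNabla M a Q k (frame a 1) g (sph t r x)
      = F.horiz a r (fun x => fderiv ℝ g (sph t r x) (vecT 0)) x / absq a r x.1 ∧
    spinNabla M a Q k vecT g (sph t r x)
      = F.time M a Q r (fun x => fderiv ℝ g (sph t r x) (vecT 0)) x := by
  obtain ⟨h0, h1, h2⟩ := spinNabla_sph hM hr F hF hx hg
  refine ⟨h0, ?_, ?_⟩
  · rw [h1, SpinFunction.horiz, frameDefect]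
    push_cast
    ring
  · rw [h2, SpinFunction.time, timeDeriv]

theorem continuous_frameDefect {r : ℝ} (hr : 0 < r) (k : ℝ) {f τ : ℝ × ℝ → ℂ} (hf : Continuous f)
    (hτ : Continuous τ) : Continuous fun x => frameDefect a r x.1 k (f x) (τ x) := by
  have h1 := continuous_absq a r
  have h2 : Continuous fun x : ℝ × ℝ => a ^ 2 * sin x.1 * cos x.1 / absq a r x.1 ^ 2 :=
    Continuous.div (by fun_prop) (by fun_prop) fun x => (pow_pos (absq_pos hr a x.1) 2).ne'
  have h3 : Continuous fun x : ℝ × ℝ => ((a ^ 2 * sin x.1 * cos x.1 / absq a r x.1 ^ 2 : ℝ) : ℂ) :=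
    Complex.continuous_ofReal.comp h2
  unfold frameDefect
  fun_prop

theorem SpinFunction.continuous_horiz {r : ℝ} (hr : 0 < r) {k : ℝ} (F : SpinFunction k)
    {τ : ℝ × ℝ → ℂ} (hτ : Continuous τ) : Continuous (F.horiz a r τ) :=
  F.continuous_azim.add (continuous_frameDefect hr k F.smooth.continuous hτ)

theorem SpinFunction.continuous_time {r : ℝ} (hr : 0 < r) {k : ℝ} (F : SpinFunction k)
    {τ : ℝ × ℝ → ℂ} (hτ : Continuous τ) : Continuous (F.time M a Q r τ) := by
  have h1 := continuous_absq a r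
  have h2 : Continuous fun x : ℝ × ℝ =>
      a * cos x.1 * (Delta M a Q r - (r ^ 2 + a ^ 2)) / absq a r x.1 ^ 4 :=
    Continuous.div (by fun_prop) (by fun_prop) fun x => (pow_pos (absq_pos hr a x.1) 4).ne'
  have h3 : Continuous fun x : ℝ × ℝ =>
      ((a * cos x.1 * (Delta M a Q r - (r ^ 2 + a ^ 2)) / absq a r x.1 ^ 4 : ℝ) : ℂ) :=
    Complex.continuous_ofReal.comp h2
  have hf := F.smooth.continuous
  unfold SpinFunction.time timeDeriv
  fun_prop

theorem SpinFunction.continuous_gradSq {r : ℝ} (hr : 0 < r) {k : ℝ} (F : SpinFunction k)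
    {τ : ℝ × ℝ → ℂ} (hτ : Continuous τ) : Continuous (F.gradSq a r τ) := by
  have h1 := continuous_absq a r
  have h2 := F.continuous_pol
  have h3 := F.continuous_horiz (a := a) hr hτ
  exact Continuous.div (by fun_prop) (by fun_prop) fun x => (pow_pos (absq_pos hr a x.1) 2).ne'

/-- The time derivative of the component of a one-form on the sphere `S(t, r)`. -/
def OneForm.timeSph (ψ : OneForm M a Q) (t r : ℝ) (x : ℝ × ℝ) : ℂ :=
  fderiv ℝ (ψ.comp 0) (sph t r x) (vecT 0)

/-- The time derivative of the component of a two-tensor on the sphere `S(t, r)`. -/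
def TwoTensor.timeSph (ψ : TwoTensor M a Q) (t r : ℝ) (x : ℝ × ℝ) : ℂ :=
  fderiv ℝ (ψ.comp 0 0) (sph t r x) (vecT 0)

theorem continuous_fderiv_sph {g : Pt → ℂ} {t r : ℝ} (hr : rPlus M a Q < r)
    (hg : ∀ p : Pt, rPlus M a Q < p 1 → ContDiffAt ℝ ∞ g p) (v : Pt) :
    Continuous fun x => fderiv ℝ g (sph t r x) v := by
  rw [continuous_iff_continuousAt]
  intro x
  have h1 : ContinuousAt (fderiv ℝ g) (sph t r x) :=
    ((hg _ hr).fderiv_right (m := 0) (by simp)).continuousAt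
  exact (ContinuousAt.comp (f := sph t r) h1 (contDiff_sph t r).continuous.continuousAt).clm_apply
    continuousAt_const

theorem OneForm.continuous_timeSph (hM : 0 < M) (ψ : OneForm M a Q) (t : ℝ) {r : ℝ}
    (hr : rPlus M a Q < r) : Continuous (ψ.timeSph t r) :=
  continuous_fderiv_sph hr (fun _ hp => ψ.contDiffAt_comp hM hp) _

theorem TwoTensor.continuous_timeSph (hM : 0 < M) (ψ : TwoTensor M a Q) (t : ℝ) {r : ℝ}
    (hr : rPlus M a Q < r) : Continuous (ψ.timeSph t r) :=
  continuous_fderiv_sph hr (fun _ hp => ψ.contDiffAt_comp hM hp) _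

section Sphere

variable {t r : ℝ} {x : ℝ × ℝ}

theorem OneForm.spinNabla_sph (hM : 0 < M) (ψ : OneForm M a Q) (hr : rPlus M a Q < r)
    (hx : x.1 ∈ Ioo 0 π) :
    spinNabla M a Q 1 (frame a 0) (ψ.comp 0) (sph t r x)
      = (ψ.spin hM t hr).pol x / absq a r x.1 ∧
    spinNabla M a Q 1 (frame a 1) (ψ.comp 0) (sph t r x)
      = (ψ.spin hM t hr).horiz a r (ψ.timeSph t r) x / absq a r x.1 ∧
    spinNabla M a Q 1 vecT (ψ.comp 0) (sph t r x)
      = (ψ.spin hM t hr).time M a Q r (ψ.timeSph t r) x :=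
  spinNabla_sph_eq hM hr (ψ.spin hM t hr) rfl hx
    ((ψ.contDiffAt_comp hM (p := sph t r x) hr).differentiableAt (by simp))

theorem TwoTensor.spinNabla_sph (hM : 0 < M) (ψ : TwoTensor M a Q) (hr : rPlus M a Q < r)
    (hx : x.1 ∈ Ioo 0 π) :
    spinNabla M a Q 2 (frame a 0) (ψ.comp 0 0) (sph t r x)
      = (ψ.spin hM t hr).pol x / absq a r x.1 ∧
    spinNabla M a Q 2 (frame a 1) (ψ.comp 0 0) (sph t r x)
      = (ψ.spin hM t hr).horiz a r (ψ.timeSph t r) x / absq a r x.1 ∧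
    spinNabla M a Q 2 vecT (ψ.comp 0 0) (sph t r x)
      = (ψ.spin hM t hr).time M a Q r (ψ.timeSph t r) x :=
  spinNabla_sph_eq hM hr (ψ.spin hM t hr) rfl hx
    ((ψ.contDiffAt_comp hM (p := sph t r x) hr).differentiableAt (by simp))

theorem OneForm.gradSq_sph (hM : 0 < M) (ψ : OneForm M a Q) (hr : rPlus M a Q < r)
    (hx : x.1 ∈ Ioo 0 π) : gradSq₁ M a Q ψ.comp (sph t r x)
      = 2 * (ψ.spin hM t hr).gradSq a r (ψ.timeSph t r) x := by
  have hp := sph_mem (t := t) hr hx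
  obtain ⟨h0, h1, -⟩ := ψ.spinNabla_sph hM (t := t) hr hx
  rw [gradSq₁, Fin.sum_univ_two, ψ.normSq_nabla hM hp, ψ.normSq_nabla hM hp, h0, h1,
    SpinFunction.gradSq, norm_div, norm_div, Complex.norm_real, norm_eq_abs, div_pow, div_pow,
    sq_abs]
  ring

theorem TwoTensor.gradSq_sph (hM : 0 < M) (ψ : TwoTensor M a Q) (hr : rPlus M a Q < r)
    (hx : x.1 ∈ Ioo 0 π) : gradSq₂ M a Q ψ.comp (sph t r x)
      = 4 * (ψ.spin hM t hr).gradSq a r (ψ.timeSph t r) x := by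
  have hp := sph_mem (t := t) hr hx
  obtain ⟨h0, h1, -⟩ := ψ.spinNabla_sph hM (t := t) hr hx
  rw [gradSq₂, Fin.sum_univ_two, ψ.normSq_nabla hM hp, ψ.normSq_nabla hM hp, h0, h1,
    SpinFunction.gradSq, norm_div, norm_div, Complex.norm_real, norm_eq_abs, div_pow, div_pow,
    sq_abs]
  ring

theorem OneForm.nablaTSq_sph (hM : 0 < M) (ψ : OneForm M a Q) (hr : rPlus M a Q < r)
    (hx : x.1 ∈ Ioo 0 π) : nablaTSq₁ M a Q ψ.comp (sph t r x)
      = 2 * ‖(ψ.spin hM t hr).time M a Q r (ψ.timeSph t r) x‖ ^ 2 := by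
  rw [nablaTSq₁, ψ.normSq_nabla hM (sph_mem hr hx), (ψ.spinNabla_sph hM hr hx).2.2]

theorem TwoTensor.nablaTSq_sph (hM : 0 < M) (ψ : TwoTensor M a Q) (hr : rPlus M a Q < r)
    (hx : x.1 ∈ Ioo 0 π) : nablaTSq₂ M a Q ψ.comp (sph t r x)
      = 4 * ‖(ψ.spin hM t hr).time M a Q r (ψ.timeSph t r) x‖ ^ 2 := by
  rw [nablaTSq₂, ψ.normSq_nabla hM (sph_mem hr hx), (ψ.spinNabla_sph hM hr hx).2.2]

theorem OneForm.normSq_sph (hM : 0 < M) (ψ : OneForm M a Q) (hr : rPlus M a Q < r)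
    (hx : x.1 ∈ Ioo 0 π) : normSq₁ ψ.comp (sph t r x) = 2 * ‖(ψ.spin hM t hr).f x‖ ^ 2 :=
  ψ.normSq_comp (sph_mem hr hx)

theorem TwoTensor.normSq_sph (hM : 0 < M) (ψ : TwoTensor M a Q) (hr : rPlus M a Q < r)
    (hx : x.1 ∈ Ioo 0 π) : normSq₂ ψ.comp (sph t r x) = 4 * ‖(ψ.spin hM t hr).f x‖ ^ 2 :=
  ψ.normSq_comp hM (sph_mem hr hx)

/-- The scalar `ψ₁ · (𝒟 · ψ̄₂)` in terms of the spin-weighted components. -/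
def spinCoupling (a r : ℝ) (F : SpinFunction 1) (G : SpinFunction 2) (τ : ℝ × ℝ → ℂ)
    (x : ℝ × ℝ) : ℂ :=
  4 * F.f x * (conj (G.pol x / absq a r x.1) + Complex.I * conj (G.horiz a r τ x / absq a r x.1))

theorem coupling_sph (hM : 0 < M) (ψ₁ : OneForm M a Q) (ψ₂ : TwoTensor M a Q)
    (hr : rPlus M a Q < r) (hx : x.1 ∈ Ioo 0 π) : coupling M a Q ψ₁.comp ψ₂.comp (sph t r x)
      = spinCoupling a r (ψ₁.spin hM t hr) (ψ₂.spin hM t hr) (ψ₂.timeSph t r) x := by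
  obtain ⟨h0, h1, -⟩ := ψ₂.spinNabla_sph hM (t := t) hr hx
  rw [coupling_comp hM ψ₁ ψ₂ (sph_mem hr hx), h0, h1]
  rfl

theorem areaDensity_sph (hr : 0 < r) (hx : x.1 ∈ Ioo 0 π) :
    areaDensity M a Q (sph t r x) = sin x.1 * sig M a Q r x.1 :=
  areaDensity_eq hr (sin_nonneg_of_mem_Icc (Ioo_subset_Icc_self hx))

end Sphere

theorem continuous_spinCoupling {r : ℝ} (hr : 0 < r) (F : SpinFunction 1) (G : SpinFunction 2)
    {τ : ℝ × ℝ → ℂ} (hτ : Continuous τ) : Continuous (spinCoupling a r F G τ) := by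
  have h1 : Continuous fun x : ℝ × ℝ => (absq a r x.1 : ℂ) :=
    Complex.continuous_ofReal.comp (continuous_absq a r)
  have h0 : ∀ x : ℝ × ℝ, (absq a r x.1 : ℂ) ≠ 0 := fun x => by
    exact_mod_cast (absq_pos hr a x.1).ne'
  have h2 := Complex.continuous_conj.comp (G.continuous_pol.div h1 h0)
  have h3 := Complex.continuous_conj.comp ((G.continuous_horiz (a := a) hr hτ).div h1 h0)
  exact (continuous_const.mul F.smooth.continuous).mul (h2.add (continuous_const.mul h3))

theorem SpinFunction.continuous_curv {k : ℝ} (F : SpinFunction k) {w : ℝ → ℝ}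
    (hw : ContDiff ℝ ∞ w) : Continuous (F.curv w) := by
  have h1 := hw.continuous
  have h2 : Continuous (deriv w) := hw.continuous_deriv (by simp)
  have h3 := F.smooth.continuous
  have h4 := F.continuous_pol
  have h5 := F.continuous_azim
  unfold SpinFunction.curv
  fun_prop

theorem continuous_pairingDensity (F : SpinFunction 1) (G : SpinFunction 2) {W : ℝ → ℝ}
    (hW : ContDiff ℝ ∞ W) : Continuous (pairingDensity F G W) := by
  have h1 := hW.continuous
  have h2 : Continuous (deriv W) := hW.continuous_deriv (by simp)
  have h3 := F.smooth.continuous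
  have h4 := F.continuous_pol
  have h5 := F.continuous_azim
  have h6 := G.smooth.continuous
  have h7 := G.continuous_pol
  have h8 := G.continuous_azim
  unfold pairingDensity
  fun_prop

/-- Comparison of the integrals of two densities on a sphere whose difference dominates, pointwise,
a density with vanishing integral. -/
theorem geS_of_pointwise {t r : ℝ} (h : Exterior M a Q r) {Φ Γ : Pt → ℝ} {φ γ J : ℝ × ℝ → ℝ}
    (hφ : Continuous φ) (hγ : Continuous γ) (hJ : Continuous J)
    (hΦ : ∀ x : ℝ × ℝ, x.1 ∈ Ioo 0 π → Φ (sph t r x) = φ x)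
    (hΓ : ∀ x : ℝ × ℝ, x.1 ∈ Ioo 0 π → Γ (sph t r x) = γ x)
    (hle : ∀ x, J x ≤ sig M a Q r x.1 * (φ x - γ x))
    (h0 : ∫ x in angles, sin x.1 * J x = 0) : GeS M a Q t r Φ Γ := by
  have hsig : Continuous (sig M a Q r) := h.contDiff_sig.continuous
  have key : ∀ {Ψ : Pt → ℝ} {χ : ℝ × ℝ → ℝ}, Continuous χ →
      (∀ x : ℝ × ℝ, x.1 ∈ Ioo 0 π → Ψ (sph t r x) = χ x) →
      EqOn (fun x : ℝ × ℝ => χ x * (sin x.1 * sig M a Q r x.1))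
        (fun x => Ψ (sph t r x) * areaDensity M a Q (sph t r x)) angles ∧
      IntegrableOn (fun x : ℝ × ℝ => χ x * (sin x.1 * sig M a Q r x.1)) angles := by
    intro Ψ χ hχ hΨ
    refine ⟨fun x hx => ?_, integrableOn_angles (by fun_prop)⟩
    simp only [hΨ x hx.1, areaDensity_sph h.radius_pos hx.1]
  obtain ⟨e1, i1⟩ := key hφ hΦ
  obtain ⟨e2, i2⟩ := key hγ hΓ
  refine ⟨i1.congr_fun e1 measurableSet_angles, i2.congr_fun e2 measurableSet_angles, ?_⟩
  have s1 : sphereIntegral M a Q t r Φ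
      = ∫ x in angles, φ x * (sin x.1 * sig M a Q r x.1) :=
    (setIntegral_congr_fun measurableSet_angles e1).symm
  have s2 : sphereIntegral M a Q t r Γ
      = ∫ x in angles, γ x * (sin x.1 * sig M a Q r x.1) :=
    (setIntegral_congr_fun measurableSet_angles e2).symm
  rw [s1, s2, ← sub_nonneg, ← integral_sub i1 i2, ← h0]
  refine setIntegral_mono_on (integrableOn_angles (by fun_prop)) (i1.sub i2) measurableSet_angles
    fun x hx => ?_
  have hs : 0 ≤ sin x.1 := sin_nonneg_of_mem_Icc (Ioo_subset_Icc_self hx.1)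
  have := mul_le_mul_of_nonneg_left (hle x) hs
  linarith

/-- The potential terms do not depend on the polar angle. -/
theorem calV_eq_of_potential (u : ℝ → ℝ) {V : ℝ → ℝ → ℝ} {W : ℝ → ℝ}
    (hV : ∀ s θ, 0 < s → absq a s θ ^ 2 * V s θ = W s) {r : ℝ} (hr : 0 < r) (θ : ℝ) :
    calV M a Q u V r θ = calV M a Q u V r 0 := by
  have key : ∀ θ, deriv (fun s => Delta M a Q s / (s ^ 2 + a ^ 2) ^ 2 * absq a s θ ^ 2 * V s θ) r
      = deriv (fun s => Delta M a Q s / (s ^ 2 + a ^ 2) ^ 2 * W s) r := by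
    intro θ
    refine Filter.EventuallyEq.deriv_eq ?_
    filter_upwards [lt_mem_nhds hr] with s hs
    rw [mul_assoc, hV s θ hs]
  rw [calV, calV, key θ, key 0]

theorem calV₁_eq (u : ℝ → ℝ) {r : ℝ} (hr : 0 < r) (θ : ℝ) :
    calV M a Q u (V₁ M a Q) r θ = calV M a Q u (V₁ M a Q) r 0 :=
  calV_eq_of_potential (W := fun s => 1 - 2 * M / s + 6 * Q ^ 2 / s ^ 2) u (fun s θ hs => by
    have := absq_pos hs a θ
    rw [V₁]; field_simp) hr θ

theorem calV₂_eq (u : ℝ → ℝ) {r : ℝ} (hr : 0 < r) (θ : ℝ) :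
    calV M a Q u (V₂ M a Q) r θ = calV M a Q u (V₂ M a Q) r 0 :=
  calV_eq_of_potential (W := fun s => 4 * (1 - 2 * M / s + 3 * Q ^ 2 / (2 * s ^ 2))) u
    (fun s θ hs => by
    have := absq_pos hs a θ
    rw [V₂]; field_simp) hr θ

/-- With the potential frozen at `θ = 0`, the remaining `θ`-dependence is explicit and continuous,
whatever the function `u` is. -/
theorem A₁_eq (p₁ p₂ δ : ℝ) (u v : ℝ → ℝ) {r : ℝ} (hr : 0 < r) (θ : ℝ) :
    A₁ M a Q p₁ p₂ δ u v r θ = (1 - δ) * (u r * trap M a Q r / (r ^ 2 + a ^ 2) ^ 3) * (1 / r ^ 2)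
      - 8 * p₁ ^ 2 / ((1 - δ) * p₂) * v r * zeroOrder M a Q r θ
      + 1 / absq a r θ ^ 2 * calV M a Q u (V₁ M a Q) r 0 := by
  have e : 8 * p₁ ^ 2 * Q ^ 2 * r ^ 6 / ((1 - δ) * p₂ * absq a r θ ^ 10 * (r ^ 2 + a ^ 2))
      = 8 * p₁ ^ 2 / ((1 - δ) * p₂) * (Q ^ 2 * r ^ 6 / (absq a r θ ^ 10 * (r ^ 2 + a ^ 2))) := by
    rw [div_mul_div_comm]
    congr 1 <;> ring
  rw [A₁, calV₁_eq u hr, zeroOrder, gfac, e]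
  ring

theorem A₂_eq (p₁ p₂ δ : ℝ) (u v : ℝ → ℝ) {r : ℝ} (hr : 0 < r) (θ : ℝ) :
    A₂ M a Q p₁ p₂ δ u v r θ
      = (1 - δ) * (2 * (1 - p₂) * (u r * trap M a Q r / (r ^ 2 + a ^ 2) ^ 3)) * (1 / r ^ 2)
      - 4 * (1 - p₁) ^ 2 / (1 - δ) * v r * zeroOrder M a Q r θ
      + 1 / absq a r θ ^ 2 * calV M a Q u (V₂ M a Q) r 0 := by
  have e : 4 * (1 - p₁) ^ 2 * Q ^ 2 * r ^ 6 / ((1 - δ) * absq a r θ ^ 10 * (r ^ 2 + a ^ 2))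
      = 4 * (1 - p₁) ^ 2 / (1 - δ) * (Q ^ 2 * r ^ 6 / (absq a r θ ^ 10 * (r ^ 2 + a ^ 2))) := by
    rw [div_mul_div_comm]
    congr 1 <;> ring
  rw [A₂, calV₂_eq u hr, zeroOrder, gfac, e]
  ring

theorem Exterior.continuous_zeroOrder {r : ℝ} (h : Exterior M a Q r) :
    Continuous (zeroOrder M a Q r) := by
  have h1 := h.contDiff_absq.continuous
  have h2 := h.contDiff_gfac.continuous
  have h3 := h.radius_pos
  refine Continuous.mul (Continuous.div continuous_const (by fun_prop) fun θ => ?_) (by fun_prop)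
  have := h.absq_pos θ
  positivity

/-- The coupling part of the term `I`, in terms of the scalar `K = ψ₁ · (𝒟 · ψ̄₂)`. -/
def couplingTerm (M a Q u r θ : ℝ) (K : ℂ) : ℝ :=
  8 * Q ^ 2 / (absq a r θ ^ 5 * (r ^ 2 + a ^ 2) ^ 2) *
    ((u : ℂ) * q a r θ ^ 3 * (((trap M a Q r / (r ^ 2 + a ^ 2) : ℝ) : ℂ)
      + (Delta M a Q r : ℂ) * ((r : ℂ) + 3 * Complex.I * ((a * cos θ : ℝ) : ℂ))
        / ((2 * absq a r θ ^ 2 : ℝ) : ℂ)) * K).re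

theorem Exterior.continuous_couplingTerm {r : ℝ} (h : Exterior M a Q r) (u : ℝ) {K : ℝ × ℝ → ℂ}
    (hK : Continuous K) : Continuous fun x => couplingTerm M a Q u r x.1 (K x) := by
  have h1 := continuous_absq a r
  have h3 := h.radius_pos
  have hc : Continuous fun x : ℝ × ℝ => ((a * cos x.1 : ℝ) : ℂ) :=
    Complex.continuous_ofReal.comp (by fun_prop)
  have hN : Continuous fun x : ℝ × ℝ => ((2 * absq a r x.1 ^ 2 : ℝ) : ℂ) :=
    Complex.continuous_ofReal.comp (by fun_prop)
  have h0 : ∀ x : ℝ × ℝ, ((2 * absq a r x.1 ^ 2 : ℝ) : ℂ) ≠ 0 := fun x => by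
    have := h.absq_pos x.1
    exact_mod_cast (by positivity : 2 * absq a r x.1 ^ 2 ≠ 0)
  refine Continuous.mul (Continuous.div continuous_const (by fun_prop) fun x => ?_)
    (Complex.continuous_re.comp (Continuous.mul (Continuous.mul ?_ ?_) hK))
  · have := h.absq_pos x.1
    positivity
  · unfold q
    fun_prop
  · exact continuous_const.add (Continuous.div (by fun_prop) hN h0)

theorem integral_combination (F : SpinFunction 1) (G : SpinFunction 2) {w W : ℝ → ℝ}
    (hw : ContDiff ℝ ∞ w) (hW : ContDiff ℝ ∞ W) (b c d : ℝ) :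
    ∫ x in angles, sin x.1 * (b * F.curv w x + c * G.curv w x
        + d * pairingDensity F G W x) = 0 := by
  have c1 := F.continuous_curv hw
  have c2 := G.continuous_curv hw
  have c3 := continuous_pairingDensity F G hW
  have i1 : IntegrableOn (fun x : ℝ × ℝ => b * (sin x.1 * F.curv w x)) angles :=
    integrableOn_angles (by fun_prop)
  have i2 : IntegrableOn (fun x : ℝ × ℝ => c * (sin x.1 * G.curv w x)) angles :=
    integrableOn_angles (by fun_prop)
  have i3 : IntegrableOn (fun x : ℝ × ℝ => d * (sin x.1 * pairingDensity F G W x)) angles :=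
    integrableOn_angles (by fun_prop)
  have e : (fun x : ℝ × ℝ =>
        sin x.1 * (b * F.curv w x + c * G.curv w x + d * pairingDensity F G W x))
      = fun x => b * (sin x.1 * F.curv w x) + c * (sin x.1 * G.curv w x)
        + d * (sin x.1 * pairingDensity F G W x) := by
    funext x
    ring
  rw [e, integral_add (f := fun x : ℝ × ℝ => b * (sin x.1 * F.curv w x)
      + c * (sin x.1 * G.curv w x)) (i1.add i2) i3, integral_add i1 i2, integral_const_mul,
          integral_const_mul,
    integral_const_mul, F.integral_curv hw, G.integral_curv hw, integral_pairingDensity F G hW]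
  simp

/-- The lower bound of the Morawetz bulk on a sphere, with an explicit constant. -/
theorem geS_morawetz {r : ℝ} (h : Exterior M a Q r) {p₁ p₂ δ : ℝ} (hp₁ : p₁ ∈ Ioc (0 : ℝ) 1)
    (hp₂ : p₂ ∈ Ioc (0 : ℝ) 1) (hδ : δ ∈ Ioo (0 : ℝ) 1) (u v : ℝ → ℝ) (hv : 0 ≤ v r)
    (hu : u r = v r * trap M a Q r) (ψ₁ : OneForm M a Q) (ψ₂ : TwoTensor M a Q) (t : ℝ) :
    GeS M a Q t r
      (fun p => termI M a Q u ψ₁.comp ψ₂.comp p + termII M a Q u ψ₁.comp ψ₂.comp p)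
      (fun p => δ * (u (p 1) * trap M a Q (p 1) / ((p 1) ^ 2 + a ^ 2) ^ 3)
            * (gradSq₁ M a Q ψ₁.comp p + 8 * Q ^ 2 * gradSq₂ M a Q ψ₂.comp p)
          + A₁ M a Q p₁ p₂ δ u v (p 1) (p 2) * normSq₁ ψ₁.comp p
          + 8 * Q ^ 2 * A₂ M a Q p₁ p₂ δ u v (p 1) (p 2) * normSq₂ ψ₂.comp p
          - mainConst M p₁ * |a| * error₁ M a Q u ψ₁.comp ψ₂.comp p
          - mainConst M p₁ * |a| * error₂ M a Q u ψ₁.comp ψ₂.comp p) := by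
  have hM := h.pos
  have hr := h.radius_pos
  let F := ψ₁.spin hM t h.lt
  let G := ψ₂.spin hM t h.lt
  let τ₁ := ψ₁.timeSph t r
  let τ₂ := ψ₂.timeSph t r
  have hτ₁ : Continuous τ₁ := ψ₁.continuous_timeSph hM t h.lt
  have hτ₂ : Continuous τ₂ := ψ₂.continuous_timeSph hM t h.lt
  obtain ⟨P₁, hP₁, cP₁⟩ : ∃ P, P = F.gradSq a r τ₁ ∧ Continuous P :=
    ⟨_, rfl, F.continuous_gradSq hr hτ₁⟩
  obtain ⟨P₂, hP₂, cP₂⟩ : ∃ P, P = G.gradSq a r τ₂ ∧ Continuous P :=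
    ⟨_, rfl, G.continuous_gradSq hr hτ₂⟩
  obtain ⟨g, hg, cg⟩ : ∃ g, g = F.time M a Q r τ₁ ∧ Continuous g :=
    ⟨_, rfl, F.continuous_time hr hτ₁⟩
  obtain ⟨k, hk, ck⟩ : ∃ g, g = G.time M a Q r τ₂ ∧ Continuous g :=
    ⟨_, rfl, G.continuous_time hr hτ₂⟩
  obtain ⟨f, hf, cf⟩ : ∃ f, f = F.f ∧ Continuous f := ⟨_, rfl, F.smooth.continuous⟩
  obtain ⟨s, hs, cs⟩ : ∃ f, f = G.f ∧ Continuous f := ⟨_, rfl, G.smooth.continuous⟩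
  obtain ⟨K, hK, cK⟩ : ∃ K, K = spinCoupling a r F G τ₂ ∧ Continuous K :=
    ⟨_, rfl, continuous_spinCoupling hr F G hτ₂⟩
  obtain ⟨Z, hZ, cZ⟩ : ∃ Z : ℝ × ℝ → ℝ, (Z = fun x => couplingTerm M a Q (u r) r x.1 (K x)) ∧
    Continuous Z := ⟨_, rfl, h.continuous_couplingTerm _ cK⟩
  obtain ⟨N, hN, cN⟩ : ∃ N : ℝ × ℝ → ℝ, (N = fun x => 1 / absq a r x.1 ^ 2) ∧ Continuous N :=
    ⟨_, rfl, Continuous.div continuous_const ((continuous_absq a r).pow 2)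
      fun x => (pow_pos (h.absq_pos x.1) 2).ne'⟩
  obtain ⟨z, hz, cz⟩ : ∃ z : ℝ × ℝ → ℝ, (z = fun x => zeroOrder M a Q r x.1) ∧ Continuous z :=
    ⟨_, rfl, h.continuous_zeroOrder.comp continuous_fst⟩
  have cKr := Complex.continuous_re.comp cK
  have cKi := Complex.continuous_im.comp cK
  have hgs₁ : ∀ x : ℝ × ℝ, x.1 ∈ Ioo 0 π → gradSq₁ M a Q ψ₁.comp (sph t r x) = 2 * P₁ x :=
    fun x hx => by rw [hP₁]; exact ψ₁.gradSq_sph hM h.lt hx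
  have hgs₂ : ∀ x : ℝ × ℝ, x.1 ∈ Ioo 0 π → gradSq₂ M a Q ψ₂.comp (sph t r x) = 4 * P₂ x :=
    fun x hx => by rw [hP₂]; exact ψ₂.gradSq_sph hM h.lt hx
  have hts₁ : ∀ x : ℝ × ℝ, x.1 ∈ Ioo 0 π →
      nablaTSq₁ M a Q ψ₁.comp (sph t r x) = 2 * ‖g x‖ ^ 2 :=
    fun x hx => by rw [hg]; exact ψ₁.nablaTSq_sph hM h.lt hx
  have hts₂ : ∀ x : ℝ × ℝ, x.1 ∈ Ioo 0 π →
      nablaTSq₂ M a Q ψ₂.comp (sph t r x) = 4 * ‖k x‖ ^ 2 :=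
    fun x hx => by rw [hk]; exact ψ₂.nablaTSq_sph hM h.lt hx
  have hns₁ : ∀ x : ℝ × ℝ, x.1 ∈ Ioo 0 π → normSq₁ ψ₁.comp (sph t r x) = 2 * ‖f x‖ ^ 2 :=
    fun x hx => by rw [hf]; exact ψ₁.normSq_sph hM h.lt hx
  have hns₂ : ∀ x : ℝ × ℝ, x.1 ∈ Ioo 0 π → normSq₂ ψ₂.comp (sph t r x) = 4 * ‖s x‖ ^ 2 :=
    fun x hx => by rw [hs]; exact ψ₂.normSq_sph hM h.lt hx
  have hcs : ∀ x : ℝ × ℝ, x.1 ∈ Ioo 0 π → coupling M a Q ψ₁.comp ψ₂.comp (sph t r x) = K x :=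
    fun x hx => by rw [hK]; exact coupling_sph hM ψ₁ ψ₂ h.lt hx
  set α := u r * trap M a Q r / (r ^ 2 + a ^ 2) ^ 3 with hα
  -- On a fixed sphere the potentials are constants, and they occur identically in both densities,
  -- so they cancel in the difference.
  let c₁ := calV M a Q u (V₁ M a Q) r 0
  let c₂ := calV M a Q u (V₂ M a Q) r 0
  refine geS_of_pointwise h
    (φ := fun x => (α * (2 * P₁ x + 8 * Q ^ 2 * (4 * P₂ x)) + Z x)
      + N x * (c₁ * (2 * ‖f x‖ ^ 2) + 8 * Q ^ 2 * (c₂ * (4 * ‖s x‖ ^ 2))))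
    (γ := fun x => δ * α * (2 * P₁ x + 8 * Q ^ 2 * (4 * P₂ x))
          + ((1 - δ) * α * (1 / r ^ 2)
            - 8 * p₁ ^ 2 / ((1 - δ) * p₂) * v r * z x + N x * c₁) * (2 * ‖f x‖ ^ 2)
          + 8 * Q ^ 2 * ((1 - δ) * (2 * (1 - p₂) * α) * (1 / r ^ 2)
            - 4 * (1 - p₁) ^ 2 / (1 - δ) * v r * z x + N x * c₂) * (4 * ‖s x‖ ^ 2)
          - mainConst M p₁ * |a| * (α * (2 * P₁ x + 2 * ‖g x‖ ^ 2 / r ^ 2 + 2 * ‖f x‖ ^ 2 / r ^ 2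
            + 4 * P₂ x + 4 * ‖k x‖ ^ 2 / r ^ 2 + 4 * ‖s x‖ ^ 2 / r ^ 2))
          - mainConst M p₁ * |a| * (|u r| / r ^ 6 * (|(K x).re| + |(K x).im| + 2 * ‖f x‖ ^ 2 / r
            + 4 * ‖s x‖ ^ 2 / r)))
    -- The curvature densities carry the coefficients of the two uses of coercivity, and the pairing
    -- density that of the transposed share `1 - p₁` of the coupling.
    (J := fun x => -(2 * (1 - δ) * α) * F.curv (gradWeight M a Q r) x
      + -(32 * Q ^ 2 * (1 - δ) * (1 - p₂) * α) * G.curv (gradWeight M a Q r) x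
      + (1 - p₁) * u r * pairingDensity F G (couplingWeight M a Q r) x)
    ?_ ?_ ?_ (fun x hx => ?_) (fun x hx => ?_) (fun x => ?_)
    (integral_combination F G h.contDiff_gradWeight h.contDiff_couplingWeight _ _ _)
  · fun_prop
  · have cKr' : Continuous fun x => (K x).re := cKr
    have cKi' : Continuous fun x => (K x).im := cKi
    fun_prop
  · have d1 := F.continuous_curv h.contDiff_gradWeight
    have d2 := G.continuous_curv h.contDiff_gradWeight
    have d3 := continuous_pairingDensity F G h.contDiff_couplingWeight
    fun_prop
  · have e1 : sph t r x 1 = r := rfl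
    have e2 : sph t r x 2 = x.1 := rfl
    simp only [termI, termII, hgs₁ x hx, hgs₂ x hx, hns₁ x hx, hns₂ x hx, hcs x hx, e1, e2,
      calV₁_eq u hr x.1, calV₂_eq u hr x.1]
    rw [hZ, hN]
    rfl
  · have e1 : sph t r x 1 = r := rfl
    have e2 : sph t r x 2 = x.1 := rfl
    simp only [error₁, error₂, hgs₁ x hx, hgs₂ x hx, hts₁ x hx, hts₂ x hx, hns₁ x hx, hns₂ x hx,
      hcs x hx, e1, e2, A₁_eq p₁ p₂ δ u v hr x.1, A₂_eq p₁ p₂ δ u v hr x.1]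
    rw [hz, hN]
  · have key := h.pointwise_estimate hp₁ hp₂ hδ hv (F.pol x) (F.azim x) (F.f x) (τ₁ x)
      (F.horiz a r τ₁ x) (F.time M a Q r τ₁ x) (G.pol x) (G.azim x) (G.f x) (τ₂ x)
      (G.horiz a r τ₂ x) (G.time M a Q r τ₂ x) rfl rfl rfl rfl (spinCoupling a r F G τ₂ x) rfl
      (u r) α (F.gradSq a r τ₁ x) (G.gradSq a r τ₂ x)
      (couplingTerm M a Q (u r) r x.1 (spinCoupling a r F G τ₂ x)) hu hα rfl rfl
      (h.coupling_factor x.1 (u r) _)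
    subst hP₁ hP₂ hg hk hf hs hK hZ hN hz
    simp only [SpinFunction.curv, pairingDensity]
    linear_combination key

end

end KerrNewman

end

theorem mainTheorem5 (M : ℝ) (hM : 0 < M) (p₁ p₂ δ : ℝ)
    (hp₁ : p₁ ∈ Set.Ioc (0 : ℝ) 1) (hp₂ : p₂ ∈ Set.Ioc (0 : ℝ) 1) (hδ : δ ∈ Set.Ioo (0 : ℝ) 1) :
    ∃ C : ℝ, 0 < C ∧
      ∀ a Q : ℝ, a ^ 2 + Q ^ 2 < M ^ 2 →
      ∀ u v : ℝ → ℝ, ContDiffOn ℝ ∞ u (Set.Ioi (KerrNewman.rPlus M a Q)) →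
        (∀ r, KerrNewman.rPlus M a Q < r → 0 ≤ v r ∧ u r = v r * KerrNewman.trap M a Q r) →
      ∀ (ψ₁ : KerrNewman.OneForm M a Q) (ψ₂ : KerrNewman.TwoTensor M a Q),
      ∀ t r : ℝ, KerrNewman.rPlus M a Q < r →
        KerrNewman.GeS M a Q t r
          (fun p => KerrNewman.termI M a Q u ψ₁.comp ψ₂.comp p
            + KerrNewman.termII M a Q u ψ₁.comp ψ₂.comp p)
          (fun p =>
            δ * (u (p 1) * KerrNewman.trap M a Q (p 1) / ((p 1) ^ 2 + a ^ 2) ^ 3)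
                * (KerrNewman.gradSq₁ M a Q ψ₁.comp p
                  + 8 * Q ^ 2 * KerrNewman.gradSq₂ M a Q ψ₂.comp p)
              + KerrNewman.A₁ M a Q p₁ p₂ δ u v (p 1) (p 2) * KerrNewman.normSq₁ ψ₁.comp p
              + 8 * Q ^ 2 * KerrNewman.A₂ M a Q p₁ p₂ δ u v (p 1) (p 2)
                * KerrNewman.normSq₂ ψ₂.comp p
              - C * |a| * KerrNewman.error₁ M a Q u ψ₁.comp ψ₂.comp p
              - C * |a| * KerrNewman.error₂ M a Q u ψ₁.comp ψ₂.comp p) := by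
  -- The constant does not involve `δ` or `p₂`: these enter the error bounds only through factors at
  -- most 1.
  refine ⟨KerrNewman.mainConst M p₁, KerrNewman.mainConst_pos hM hp₁.1,
    fun a Q haQ u v _ huv ψ₁ ψ₂ t r hr => ?_⟩
  exact KerrNewman.geS_morawetz ⟨hM, haQ, hr⟩ hp₁ hp₂ hδ u v (huv r hr).1 (huv r hr).2 ψ₁ ψ₂ t
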